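/- All vector spaces are over $\mathbb C$. For a vector space $W$ put $\mathcal E(W)=\mathrm{Hom}(W,W((x)))$, let $1_W\in\mathcal E(W)$ be the identity, and let $W((x_1,\dots,x_r))=W[[x_1,\dots,x_r]][x_1^{-1},\dots,x_r^{-1}]$. Powers $(x\pm y)^n$, $n\in\mathbb Z$, are expanded in nonnegative powers of the second variable. **Definitions.** - A finite sequence $(\psi_1,\dots,\psi_r)$ in $\mathcal E(W)$ is *quasi compatible* if there is a nonzero polynomial $p(x,y)$ with $\prod_{i<j}p(x_i,x_j)\,\psi_1(x_1)\cdots\psi_r(x_r)\in\mathrm{Hom}(W,W((x_1,\dots,x_r)))$; a subset of $\mathcal E(W)$ is quasi compatible if all finite sequences in it are. - For a quasi compatible pair $(a,b)$ the products $a(x)_nb(x)$, $n\in\mathbb Z$, are defined by $$\sum_{n\in\mathbb Z}(a(x)_nb(x))\,x_0^{-n-1}=\iota_{x,x_0}\big(p(x_0+x,x)^{-1}\big)\,\big(p(x_1,x)a(x_1)b(x)\big)\big|_{x_1=x+x_0},$$ where $p$ is any nonzero polynomial with $p(x_1,x_2)a(x_1)b(x_2)\in\mathrm{Hom}(W,W((x_1,x_2)))$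 and $\iota_{x,x_0}$ is expansion in $\mathbb C((x))((x_0))$; this does not depend on $p$. A quasi compatible subspace is *closed* if it is closed under all these products. - For a quasi compatible subset $S$, $\langle S\rangle$ is the smallest closed quasi compatible subspace of $\mathcal E(W)$ containing $S\cup\{1_W\}$. - A subset $S\subset\mathcal E(W)$ is *$\mathcal S$-local* if for all $a,b\in S$ there are $k\in\mathbb N$ and finitely many $f_i\in\mathbb C((x))$, $u_i,v_i\in S$ with $$(x_1-x_2)^ka(x_1)b(x_2)=(x_1-x_2)^k\sum_i f_i(x_2-x_1)\,u_i(x_2)v_i(x_1).$$ - A *nonlocal vertex algebra* is a triple $(V,Y,\mathbf 1)$ with $\mathbf 1\in V$ and $Y:V\to\mathcal E(V)$, $v\mapsto Y(v,x)$, linear, such that $Y(\mathbf 1,x)=1_V$, and for all $v\in V$, $Y(v,x)\mathbf 1\in V[[x]]$ and $\lim_{x\to0}Y(v,x)\mathbf 1=v$, and for all $u,v,w\in V$ there is $l\in\mathbb N$ with $(x_0+x_2)^lY(u,x_0+x_2)Y(v,x_2)w=(x_0+x_2)^lY(Y(u,x_0)v,x_2)w$. - A *weak quantum vertex algebra* is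 a triple $(V,Y,\mathbf 1)$ with $\mathbf 1\in V$ and $Y:V\to\mathcal E(V)$ linear, with the same vacuum and creation properties, such that for all $u,v\in V$ there are finitely many $v^{(i)},u^{(i)}\in V$, $f_i\in\mathbb C((x))$ with $$x_0^{-1}\delta\Big(\tfrac{x_1-x_2}{x_0}\Big)Y(u,x_1)Y(v,x_2)-x_0^{-1}\delta\Big(\tfrac{x_2-x_1}{-x_0}\Big)\sum_i f_i(-x_0)Y(v^{(i)},x_2)Y(u^{(i)},x_1)=x_2^{-1}\delta\Big(\tfrac{x_1-x_0}{x_2}\Big)Y(Y(u,x_0)v,x_2).$$ **Theorem.** Let $V$ be a vector space, $\mathbf 1\in V$, $L(-1)$ a linear operator on $V$, $U$ a subset of $V$, and $Y_0:U\to\mathcal E(V)$, $u\mapsto Y_0(u,x)=u(x)=\sum_{n\in\mathbb Z}u_nx^{-n-1}$, a map. Assume: 1. $L(-1)\mathbf 1=0$, and $[L(-1),u(x)]=\frac{d}{dx}u(x)$ for all $u\in U$; 2. $u(x)\mathbf 1\in V[[x]]$ and $\lim_{x\to0}u(x)\mathbf 1=u$ for all $u\in U$; 3. the subset $Y_0(U)=\{u(x)\mid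 u\in U\}$ of $\mathcal E(V)$ is quasi compatible; 4. $V$ is spanned by the vectors $u^1_{n_1}\cdots u^r_{n_r}\mathbf 1$ with $r\ge0$, $u^i\in U$, $n_i\in\mathbb Z$; 5. there is a linear map $\psi:V\to\langle Y_0(U)\rangle$ with $\psi(\mathbf 1)=1_V$ and $\psi(u_nv)=u(x)_n\psi(v)$ for all $u\in U$, $v\in V$, $n\in\mathbb Z$. Then there is exactly one linear map $Y:V\to\mathcal E(V)$ extending $Y_0$ such that $(V,Y,\mathbf 1)$ is a nonlocal vertex algebra. If moreover $Y_0(U)$ is $\mathcal S$-local, then $(V,Y,\mathbf 1)$ is a weak quantum vertex algebra. -/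

import Mathlib

/-!
Formal calculus over the complex numbers, quasi compatible sets of vertex operators, the products
`a(x)_n b(x)`, nonlocal vertex algebras and weak quantum vertex algebras.

All formal series are handled through their coefficients.  Every `∑ᶠ` below has only finitely many
nonzero terms, because vertex operators applied to a vector are lower truncated.
-/

namespace FormalVA

noncomputable section

/-- `𝓔(W) = Hom(W, W((x)))`. -/
abbrev E (W : Type*) [AddCommGroup W] [Module ℂ W] : Type _ := VertexOperator ℂ W

/-- The coefficient of `x ^ m` in `a(x)`. -/
def cf {W : Type*} [AddCommGroup W] [Module ℂ W] (a : E W) (m : ℤ) : Module.End ℂ W :=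
  HVertexOperator.coeff a m

/-- The mode `a_n` of `a(x) = ∑ a_n x ^ (-n-1)`. -/
def mode {W : Type*} [AddCommGroup W] [Module ℂ W] (a : E W) (n : ℤ) : Module.End ℂ W :=
  cf a (-n - 1)

/-- The identity operator `1_W`, as the constant series in `𝓔(W)`. -/
def idE (W : Type*) [AddCommGroup W] [Module ℂ W] : E W where
  toFun w := HahnModule.of ℂ (HahnSeries.single (0 : ℤ) w)
  map_add' v w := by rw [HahnSeries.single_add, HahnModule.of_add]
  map_smul' c w := by
    ext m
    change (HahnSeries.single (0 : ℤ) (c • w)).coeff m = c • (HahnSeries.single (0 : ℤ) w).coeff m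
    rw [HahnSeries.coeff_single, HahnSeries.coeff_single, smul_ite, smul_zero]

/-- `W[[x_1^{±1}, …, x_r^{±1}]]`: a formal series is the family of its coefficients. -/
abbrev FSeries (r : ℕ) (W : Type*) : Type _ := (Fin r → ℤ) → W

/-- The product of a polynomial in `x_1, …, x_r` and a formal series. -/
def polyMul {r : ℕ} {W : Type*} [AddCommGroup W] [Module ℂ W]
    (q : MvPolynomial (Fin r) ℂ) (F : FSeries r W) : FSeries r W :=
  fun m => ∑ e ∈ q.support, q.coeff e • F (fun i => m i - (e i : ℤ))

/-- Membership in `W((x_1, …, x_r)) = W[[x_1, …, x_r]][x_1⁻¹, …, x_r⁻¹]`. -/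
def IsLowerTruncated {r : ℕ} {W : Type*} [Zero W] (F : FSeries r W) : Prop :=
  ∃ N : ℤ, ∀ m : Fin r → ℤ, (∃ i, m i < N) → F m = 0

/-- The series `ψ_1(x_1) ⋯ ψ_r(x_r) w`. -/
def fieldProd {r : ℕ} {W : Type*} [AddCommGroup W] [Module ℂ W]
    (ψ : Fin r → E W) (w : W) : FSeries r W :=
  fun m => (List.ofFn fun i => cf (ψ i) (m i)).prod w

/-- A finite sequence is quasi compatible if for some nonzero polynomial `p(x, y)`,
`(∏_{i<j} p(x_i, x_j)) ψ_1(x_1) ⋯ ψ_r(x_r) ∈ Hom(W, W((x_1, …, x_r)))`. -/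
def QuasiCompatibleSeq {r : ℕ} {W : Type*} [AddCommGroup W] [Module ℂ W]
    (ψ : Fin r → E W) : Prop :=
  ∃ p : MvPolynomial (Fin 2) ℂ, p ≠ 0 ∧ ∀ w : W, IsLowerTruncated
    (polyMul (∏ i : Fin r, ∏ j ∈ Finset.Ioi i, MvPolynomial.rename ![i, j] p) (fieldProd ψ w))

/-- A set is quasi compatible if each finite sequence in it is. -/
def QuasiCompatible {W : Type*} [AddCommGroup W] [Module ℂ W] (S : Set (E W)) : Prop :=
  ∀ (r : ℕ) (ψ : Fin r → E W), (∀ i, ψ i ∈ S) → QuasiCompatibleSeq ψ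

/-- `p(x_1, x_2) a(x_1) b(x_2) ∈ Hom(W, W((x_1, x_2)))`. -/
abbrev ClearsPoles {W : Type*} [AddCommGroup W] [Module ℂ W]
    (p : MvPolynomial (Fin 2) ℂ) (a b : E W) : Prop :=
  ∀ w : W, IsLowerTruncated (polyMul p (fieldProd ![a, b] w))

/-- The coefficient of `x_0 ^ i x ^ j` in `F(x + x_0, x)`, for a series `F(x_1, x)` and with
`(x + x_0) ^ m` expanded in nonnegative powers of `x_0`. -/
def substCoeff {W : Type*} [AddCommGroup W] (F : FSeries 2 W) (i : ℕ) (j : ℤ) : W :=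
  ∑ᶠ m : ℤ, (Ring.choose m i : ℤ) • F ![m, j - m + i]

lemma substCoeff_support_finite {W : Type*} [AddCommGroup W] {F : FSeries 2 W}
    (hF : IsLowerTruncated F) (i : ℕ) (j : ℤ) :
    (Function.support fun m : ℤ => (Ring.choose m i : ℤ) • F ![m, j - m + i]).Finite := by
  obtain ⟨N, hN⟩ := hF
  refine (Set.finite_Icc N (j + i - N)).subset fun m hm => ?_
  by_contra h
  apply hm
  have : F ![m, j - m + i] = 0 := by
    apply hN
    by_cases h1 : m < N
    · exact ⟨0, by simpa using h1⟩
    · refine ⟨1, ?_⟩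
      simp only [Set.mem_Icc, not_and, not_le] at h
      have := h (by omega)
      simp
      omega
  simp [this]

lemma substCoeff_eq_zero {W : Type*} [AddCommGroup W] {F : FSeries 2 W} {N : ℤ}
    (hN : ∀ m : Fin 2 → ℤ, (∃ i, m i < N) → F m = 0) {i : ℕ} {j : ℤ} (h : j < 2 * N - i) :
    substCoeff F i j = 0 := by
  apply finsum_eq_zero_of_forall_eq_zero
  intro m
  rw [hN, smul_zero]
  by_cases h1 : m < N
  · exact ⟨0, by simpa using h1⟩
  · exact ⟨1, by simp; omega⟩

lemma substCoeff_add {W : Type*} [AddCommGroup W] {F G : FSeries 2 W}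
    (hF : IsLowerTruncated F) (hG : IsLowerTruncated G) (i : ℕ) (j : ℤ) :
    substCoeff (F + G) i j = substCoeff F i j + substCoeff G i j := by
  unfold substCoeff
  rw [← finsum_add_distrib (substCoeff_support_finite hF i j)
    (substCoeff_support_finite hG i j)]
  simp [smul_add]

lemma substCoeff_smul {W : Type*} [AddCommGroup W] [Module ℂ W] (c : ℂ) {F : FSeries 2 W}
    (hF : IsLowerTruncated F) (i : ℕ) (j : ℤ) :
    substCoeff (c • F) i j = c • substCoeff F i j := by
  unfold substCoeff
  rw [smul_finsum' c (substCoeff_support_finite hF i j)]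
  simp only [Pi.smul_apply]
  exact finsum_congr fun m => smul_comm _ _ _

/-- The coefficient of `x_0 ^ i` in `F(x_1, x)|_{x_1 = x + x_0} ∈ W((x))[[x_0]]`, an element of
`W((x))`, for `F ∈ W((x_1, x))`. -/
def subst {W : Type*} [AddCommGroup W] [Module ℂ W] (F : FSeries 2 W)
    (hF : IsLowerTruncated F) (i : ℕ) : HahnModule ℤ ℂ W :=
  HahnModule.of ℂ (HahnSeries.ofSuppBddBelow (fun j : ℤ => substCoeff F i j) (by
    obtain ⟨N, hN⟩ := hF
    refine ⟨2 * N - i, fun j hj => ?_⟩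
    by_contra h
    exact hj (substCoeff_eq_zero hN (not_le.mp h))))

/-- The ring homomorphism `p(x_1, x_2) ↦ p(x + x_0, x)` into the field `ℂ((x))((x_0))`. -/
def iotaPoly : MvPolynomial (Fin 2) ℂ →+* LaurentSeries (LaurentSeries ℂ) :=
  MvPolynomial.eval₂Hom (HahnSeries.C.comp HahnSeries.C)
    (![HahnSeries.C (HahnSeries.single (1 : ℤ) (1 : ℂ)) + HahnSeries.single (1 : ℤ) 1,
      HahnSeries.C (HahnSeries.single (1 : ℤ) (1 : ℂ))] :
      Fin 2 → LaurentSeries (LaurentSeries ℂ))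

/-- The coefficient of `x_0 ^ i`, an element of `W((x))`, in
`(Y_𝓔(a(x), x_0) b(x)) w = ι_{x,x_0}(p(x_0 + x, x)⁻¹) (p(x_1, x) a(x_1) b(x) w)|_{x_1 = x + x_0}`,
where the inverse is taken in the field `ℂ((x))((x_0))`. -/
def opeCoeff {W : Type*} [AddCommGroup W] [Module ℂ W] (p : MvPolynomial (Fin 2) ℂ) (a b : E W)
    (h : ClearsPoles p a b) (i : ℤ) (w : W) : HahnModule ℤ ℂ W :=
  ∑ᶠ t : ℕ, ((iotaPoly p)⁻¹.coeff (i - t) : LaurentSeries ℂ) •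
    subst (polyMul p (fieldProd ![a, b] w)) (h w) t

lemma coeff_sub_support_finite (c : LaurentSeries (LaurentSeries ℂ)) (i : ℤ) :
    {t : ℕ | c.coeff (i - t) ≠ 0}.Finite := by
  refine (Set.finite_Iic (i - c.order).toNat).subset fun t ht => ?_
  have h := HahnSeries.order_le_of_coeff_ne_zero ht
  simp only [Set.mem_Iic]
  omega

lemma opeCoeff_support_finite {W : Type*} [AddCommGroup W] [Module ℂ W]
    (p : MvPolynomial (Fin 2) ℂ) (a b : E W) (h : ClearsPoles p a b) (i : ℤ) (w : W) :
    (Function.support fun t : ℕ => ((iotaPoly p)⁻¹.coeff (i - t) : LaurentSeries ℂ) •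
      subst (polyMul p (fieldProd ![a, b] w)) (h w) t).Finite := by
  refine (coeff_sub_support_finite (iotaPoly p)⁻¹ i).subset fun t ht h0 => ht ?_
  simp only [h0]
  exact zero_smul (LaurentSeries ℂ) (A := HahnModule ℤ ℂ W) _

lemma polyMul_fieldProd_add {W : Type*} [AddCommGroup W] [Module ℂ W] {r : ℕ}
    (q : MvPolynomial (Fin r) ℂ) (ψ : Fin r → E W) (v w : W) :
    polyMul q (fieldProd ψ (v + w)) =
      polyMul q (fieldProd ψ v) + polyMul q (fieldProd ψ w) := by
  funext m
  simp [polyMul, fieldProd, Finset.sum_add_distrib]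

lemma polyMul_fieldProd_smul {W : Type*} [AddCommGroup W] [Module ℂ W] {r : ℕ}
    (q : MvPolynomial (Fin r) ℂ) (ψ : Fin r → E W) (c : ℂ) (w : W) :
    polyMul q (fieldProd ψ (c • w)) = c • polyMul q (fieldProd ψ w) := by
  funext m
  simp only [polyMul, fieldProd, map_smul, Pi.smul_apply, Finset.smul_sum]
  exact Finset.sum_congr rfl fun e _ => smul_comm _ _ _

lemma opeCoeff_add {W : Type*} [AddCommGroup W] [Module ℂ W] (p : MvPolynomial (Fin 2) ℂ)
    (a b : E W) (h : ClearsPoles p a b) (i : ℤ) (v w : W) :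
    opeCoeff p a b h i (v + w) = opeCoeff p a b h i v + opeCoeff p a b h i w := by
  unfold opeCoeff
  rw [← finsum_add_distrib (opeCoeff_support_finite p a b h i v)
    (opeCoeff_support_finite p a b h i w)]
  refine finsum_congr fun t => Eq.trans ?_ (HahnModule.smul_add _ _ _)
  congr 1
  ext j
  change substCoeff (W := W) _ t j = substCoeff (W := W) _ t j + substCoeff (W := W) _ t j
  rw [polyMul_fieldProd_add, substCoeff_add (h v) (h w)]

lemma opeCoeff_smul {W : Type*} [AddCommGroup W] [Module ℂ W] (p : MvPolynomial (Fin 2) ℂ)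
    (a b : E W) (h : ClearsPoles p a b) (i : ℤ) (c : ℂ) (w : W) :
    opeCoeff p a b h i (c • w) = c • opeCoeff p a b h i w := by
  unfold opeCoeff
  rw [smul_finsum' c (opeCoeff_support_finite p a b h i w)]
  refine finsum_congr fun t => ?_
  set d : LaurentSeries ℂ := (iotaPoly p)⁻¹.coeff (i - t)
  set G : HahnModule ℤ ℂ W := subst (polyMul p (fieldProd ![a, b] w)) (h w) t
  have hG : subst (polyMul p (fieldProd ![a, b] (c • w))) (h (c • w)) t =
      (HahnSeries.single (0 : ℤ) c : LaurentSeries ℂ) • G := by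
    refine Eq.trans ?_ (HahnModule.single_zero_smul_eq_smul ℤ).symm
    ext j
    change substCoeff (W := W) _ t j = c • substCoeff (W := W) _ t j
    rw [polyMul_fieldProd_smul, substCoeff_smul c (h w)]
  rw [hG]
  refine (mul_smul (α := LaurentSeries ℂ) (β := HahnModule ℤ ℂ W) d _ G).symm.trans ?_
  rw [mul_comm]
  refine (mul_smul (α := LaurentSeries ℂ) (β := HahnModule ℤ ℂ W) _ d G).trans ?_
  exact HahnModule.single_zero_smul_eq_smul ℤ

/-- `a(x)_n b(x)` computed with a given polynomial `p`: the coefficient of `x_0 ^ (-n-1)` in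
`Y_𝓔(a(x), x_0) b(x)`. -/
def nthProductWith {W : Type*} [AddCommGroup W] [Module ℂ W] (p : MvPolynomial (Fin 2) ℂ)
    (a b : E W) (h : ClearsPoles p a b) (n : ℤ) : E W where
  toFun w := opeCoeff p a b h (-n - 1) w
  map_add' v w := opeCoeff_add p a b h (-n - 1) v w
  map_smul' c w := opeCoeff_smul p a b h (-n - 1) c w

open scoped Classical in
/-- The product `a(x)_n b(x)` of a quasi compatible pair; by convention `0` for other pairs. -/
def nthProduct {W : Type*} [AddCommGroup W] [Module ℂ W] (a b : E W) (n : ℤ) : E W :=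
  if h : ∃ p : MvPolynomial (Fin 2) ℂ, p ≠ 0 ∧ ClearsPoles p a b then
    nthProductWith h.choose a b h.choose_spec.2 n
  else 0

/-- Closedness of a subspace under all products `a(x)_n b(x)`. -/
def IsClosedSubspace {W : Type*} [AddCommGroup W] [Module ℂ W] (U : Submodule ℂ (E W)) : Prop :=
  ∀ a ∈ U, ∀ b ∈ U, ∀ n : ℤ, nthProduct a b n ∈ U

/-- `⟨S⟩`: the smallest closed quasi compatible subspace containing `S ∪ {1_W}`. -/
def generated {W : Type*} [AddCommGroup W] [Module ℂ W] (S : Set (E W)) : Submodule ℂ (E W) :=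
  sInf {U : Submodule ℂ (E W) |
    QuasiCompatible (U : Set (E W)) ∧ IsClosedSubspace U ∧ S ⊆ U ∧ idE W ∈ U}

/-- The coefficient of `x_1 ^ m x_2 ^ n` in `ι_{x_2,x_1}(f(x_2 - x_1)) u(x_2) v(x_1) w`. -/
def exchangeCoeff {W : Type*} [AddCommGroup W] [Module ℂ W] (f : LaurentSeries ℂ) (u v : E W)
    (w : W) (m n : ℤ) : W :=
  ∑ᶠ q : ℤ × ℕ, (f.coeff q.1 * ((-1) ^ q.2 * (Ring.choose q.1 q.2 : ℤ))) •
    cf u (n - q.1 + q.2) (cf v (m - q.2) w)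

/-- `𝓢`-locality of a subset of `𝓔(W)`. -/
def SLocal {W : Type*} [AddCommGroup W] [Module ℂ W] (S : Set (E W)) : Prop :=
  ∀ a ∈ S, ∀ b ∈ S, ∃ (r : ℕ) (f : Fin r → LaurentSeries ℂ) (u v : Fin r → E W) (k : ℕ),
    (∀ i, u i ∈ S) ∧ (∀ i, v i ∈ S) ∧ ∀ w : W,
      polyMul ((MvPolynomial.X 0 - MvPolynomial.X 1) ^ k) (fieldProd ![a, b] w) =
        polyMul ((MvPolynomial.X 0 - MvPolynomial.X 1) ^ k)
          (fun e => ∑ i, exchangeCoeff (f i) (u i) (v i) w (e 0) (e 1))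

/-- `a(x) 1 ∈ V[[x]]` and `lim_{x → 0} a(x) 1 = v`. -/
def Creates {V : Type*} [AddCommGroup V] [Module ℂ V] (a : E V) (one v : V) : Prop :=
  (∀ m : ℤ, m < 0 → cf a m one = 0) ∧ cf a 0 one = v

/-- The series `a(x_0 + x_2) b(x_2) w` in the variables `x_0, x_2` (numbered `0, 1`), with
`(x_0 + x_2) ^ m` expanded in nonnegative powers of `x_2`. -/
def shiftedProd {V : Type*} [AddCommGroup V] [Module ℂ V] (a b : E V) (w : V) : FSeries 2 V :=
  fun e => ∑ᶠ k : ℕ, (Ring.choose (e 0 + k) k : ℤ) • cf a (e 0 + k) (cf b (e 1 - k) w)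

/-- The series `Y(Y(u, x_0) v, x_2) w` in the variables `x_0, x_2` (numbered `0, 1`). -/
def iterateSeries {V : Type*} [AddCommGroup V] [Module ℂ V] (Y : V →ₗ[ℂ] E V) (u v w : V) :
    FSeries 2 V :=
  fun e => cf (Y (cf (Y u) (e 0) v)) (e 1) w

/-- `(V, Y, 1)` is a nonlocal vertex algebra. -/
structure IsNonlocalVertexAlgebra {V : Type*} [AddCommGroup V] [Module ℂ V]
    (Y : V →ₗ[ℂ] E V) (one : V) : Prop where
  vacuum : Y one = idE V
  creation : ∀ v : V, Creates (Y v) one v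
  weak_assoc : ∀ u v w : V, ∃ l : ℕ,
    polyMul ((MvPolynomial.X 0 + MvPolynomial.X 1) ^ l) (shiftedProd (Y u) (Y v) w) =
      polyMul ((MvPolynomial.X 0 + MvPolynomial.X 1) ^ l) (iterateSeries Y u v w)

/-- The coefficient of `x_0 ^ p x_1 ^ m x_2 ^ n` in `x_0⁻¹ δ((x_1 - x_2) / x_0) a(x_1) b(x_2) w`,
with `(x_1 - x_2) ^ N` expanded in nonnegative powers of `x_2`. -/
def jacobiFirst {V : Type*} [AddCommGroup V] [Module ℂ V] (a b : E V) (w : V) (p m n : ℤ) : V :=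
  ∑ᶠ k : ℕ, ((-1) ^ k * Ring.choose (-p - 1) k : ℤ) • cf a (m + p + 1 + k) (cf b (n - k) w)

/-- The coefficient of `x_0 ^ p x_1 ^ m x_2 ^ n` in
`x_0⁻¹ δ((x_2 - x_1) / (-x_0)) f(-x_0) b(x_2) a(x_1) w`, with `(x_2 - x_1) ^ N` expanded in
nonnegative powers of `x_1`.  The pair `(s, k)` is the term `x_0 ^ s` of `f(-x_0)` and
the term `x_1 ^ k` of `(x_2 - x_1) ^ (s - p - 1)`. -/
def jacobiSecond {V : Type*} [AddCommGroup V] [Module ℂ V] (f : LaurentSeries ℂ) (b a : E V)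
    (w : V) (p m n : ℤ) : V :=
  ∑ᶠ q : ℤ × ℕ, (((-1) ^ q.1 * f.coeff q.1) * (-1) ^ (q.1 - p - 1) *
      ((-1) ^ q.2 * (Ring.choose (q.1 - p - 1) q.2 : ℤ)) : ℂ) •
    cf b (n - (q.1 - p - 1) + q.2) (cf a (m - q.2) w)

/-- The coefficient of `x_0 ^ p x_1 ^ m x_2 ^ n` in
`x_2⁻¹ δ((x_1 - x_0) / x_2) Y(Y(u, x_0) v, x_2) w`, with `(x_1 - x_0) ^ N` expanded in
nonnegative powers of `x_0`. -/
def jacobiThird {V : Type*} [AddCommGroup V] [Module ℂ V] (Y : V →ₗ[ℂ] E V) (u v w : V)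
    (p m n : ℤ) : V :=
  ∑ᶠ k : ℕ, ((-1) ^ k * Ring.choose (m + k) k : ℤ) •
    cf (Y (cf (Y u) (p - k) v)) (n + m + k + 1) w

/-- `(V, Y, 1)` is a weak quantum vertex algebra: vacuum, creation and the `𝓢`-Jacobi identity. -/
structure IsWeakQuantumVertexAlgebra {V : Type*} [AddCommGroup V] [Module ℂ V]
    (Y : V →ₗ[ℂ] E V) (one : V) : Prop where
  vacuum : Y one = idE V
  creation : ∀ v : V, Creates (Y v) one v
  jacobi : ∀ u v : V, ∃ (r : ℕ) (v' u' : Fin r → V) (f : Fin r → LaurentSeries ℂ),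
    ∀ (w : V) (p m n : ℤ),
      jacobiFirst (Y u) (Y v) w p m n
        - ∑ i, jacobiSecond (f i) (Y (v' i)) (Y (u' i)) w p m n
      = jacobiThird Y u v w p m n

end

end FormalVA

/-! The method is to clear denominators. A nonzero polynomial acts injectively on V((x_2))((x_0))
(`IsIterated.eq_zero`), so identities between expansions may be checked after multiplication by a
polynomial. `IsOPE B A` says that A(x_0, x_2) is B(x_1, x_2) re-expanded at x_1 = x_2 + x_0. Such an
A is unique, and the products a(x)_n b(x) are the coefficients of the A that belongs to B = a(x_1)
b(x_2) (`isOPE_nthProduct`).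

Rationality. The polynomials that clear the poles of u^1(x_1) ⋯ u^r(x_r) w for every w form an
ideal. Because [L(-1), u(x)] = u'(x), this ideal is stable under ∑ ∂/∂x_i. Differentiating often
enough turns a product of polynomials p(x_i, x_j) into a product of nonzero polynomials in the
differences x_i - x_j, and these commute with ∑ ∂/∂x_i. Since L(-1) 1 = 0, the cleared product
applied to 1 then satisfies DF = L(-1)F, which excludes negative powers
(`isRational_of_quasiCompatible`). This property survives insertion of the identity field and
replacement of neighbours a, b by a(x)_n b(x) (`IsRational.contract`), hence holds for all the
fields ψ(v).

Vertex algebra. Put Y = ψ. For u ∈ U, condition 5 says that Y(Y(u, x_0)v, x_2) is the re-expansion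
of Y(u, x_1)Y(v, x_2). Comparing the two ways of contracting a triple product
(`IsGenerated.isOPE_cf`) shows that the states u with this property for all v are closed under the
modes of U, so they fill V. A difference polynomial in two variables is (x_1 - x_2)^e times a factor
that is invertible as a power series. After the shift, the poles are therefore powers of x_0, x_2
and x_0 + x_2, and cancelling the first two gives weak associativity. Weak associativity determines
Y(u_n v, x) from Y(u, x) and Y(v, x), which gives uniqueness.

Weak quantum vertex algebra. Locality is recast as exchange relations with power series coefficients
in x_2 - x_1. These pass to the coefficients of operator products one power of x_0 at a time
(`isExchangeable_level`), hence to all pairs of states. Let J_p be the coefficient of x_0^p in the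
difference of the two sides of the Jacobi identity. Then J_{p-1} = (x_1 - x_2) J_p, and J_p = 0 for
p very negative by the exchange relation. Weak associativity bounds the powers of x_1 in J_p from
below, so x_1 - x_2 can be cancelled and every J_p vanishes. -/

namespace FormalVA

noncomputable section

set_option linter.unusedSectionVars false

open MvPolynomial

/-! ### The polynomial action on formal series -/

section Action

variable {ι : Type*} {V : Type*} [AddCommGroup V] [Module ℂ V]

/-- Multiplication of a formal series in variables indexed by `ι` by the monomial `x ^ e`. -/
def shiftBy (e : ι →₀ ℕ) : Module.End ℂ ((ι → ℤ) → V) where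
  toFun F m := F fun i => m i - e i
  map_add' _ _ := rfl
  map_smul' _ _ := rfl

/-- Polynomials act on formal series by multiplication. -/
def act : MvPolynomial ι ℂ →ₐ[ℂ] Module.End ℂ ((ι → ℤ) → V) :=
  AddMonoidAlgebra.lift ℂ _ _
    { toFun := fun e => shiftBy (Multiplicative.toAdd e)
      map_one' := by
        ext F m
        simp [shiftBy]
      map_mul' := fun a b => by
        ext F m
        simp [shiftBy, sub_sub] }

lemma act_eq_sum (p : MvPolynomial ι ℂ) (F : (ι → ℤ) → V) (m : ι → ℤ) :
    act p F m = ∑ e ∈ p.support, p.coeff e • F (fun i => m i - e i) := by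
  simp only [act, AddMonoidAlgebra.lift_apply']
  simp only [Finsupp.sum, LinearMap.sum_apply, Finset.sum_apply]
  rfl

lemma polyMul_eq_act {r : ℕ} (p : MvPolynomial (Fin r) ℂ) (F : FSeries r V) :
    polyMul p F = act p F := by
  funext m
  rw [act_eq_sum]
  rfl

lemma act_mul (p q : MvPolynomial ι ℂ) (F : (ι → ℤ) → V) :
    act (p * q) F = act p (act q F) := by
  rw [map_mul]; rfl

lemma act_add (p q : MvPolynomial ι ℂ) (F : (ι → ℤ) → V) :
    act (p + q) F = act p F + act q F := by
  rw [map_add]; rfl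

lemma act_sub (p q : MvPolynomial ι ℂ) (F : (ι → ℤ) → V) :
    act (p - q) F = act p F - act q F := by
  rw [map_sub]; rfl

lemma act_one (F : (ι → ℤ) → V) : act 1 F = F := by
  rw [map_one]; rfl

lemma act_C (c : ℂ) (F : (ι → ℤ) → V) : act (C c) F = c • F := by
  rw [← algebraMap_eq, AlgHom.commutes]; rfl

lemma act_comm (p q : MvPolynomial ι ℂ) (F : (ι → ℤ) → V) :
    act p (act q F) = act q (act p F) := by
  rw [← act_mul, mul_comm, act_mul]

lemma act_monomial (e : ι →₀ ℕ) (c : ℂ) (F : (ι → ℤ) → V) (m : ι → ℤ) :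
    act (monomial e c) F m = c • F (fun i => m i - e i) := by
  simp only [act]
  rw [show (monomial e c : MvPolynomial ι ℂ) = AddMonoidAlgebra.single e c from rfl,
    AddMonoidAlgebra.lift_single]
  rfl

lemma act_X [DecidableEq ι] (i : ι) (F : (ι → ℤ) → V) (m : ι → ℤ) :
    act (X i) F m = F (Function.update m i (m i - 1)) := by
  rw [X, act_monomial, one_smul]
  congr 1
  funext k
  by_cases h : k = i
  · subst h; simp
  · simp [h]

lemma act_X_pow [DecidableEq ι] (i : ι) (n : ℕ) (F : (ι → ℤ) → V) (m : ι → ℤ) :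
    act (X i ^ n) F m = F (Function.update m i (m i - n)) := by
  rw [X_pow_eq_monomial, act_monomial, one_smul]
  congr 1
  funext k
  by_cases h : k = i
  · subst h; simp
  · simp [h]

/-- A linear map applied to all coefficients. -/
lemma act_map {V' : Type*} [AddCommGroup V'] [Module ℂ V'] (f : V →ₗ[ℂ] V')
    (p : MvPolynomial ι ℂ) (F : (ι → ℤ) → V) :
    act p (fun m => f (F m)) = fun m => f (act p F m) := by
  funext m
  simp [act_eq_sum]

/-- `F` has no negative powers. -/
def IsPower (F : (ι → ℤ) → V) : Prop := ∀ m : ι → ℤ, (∃ i, m i < 0) → F m = 0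

lemma IsPower.act {F : (ι → ℤ) → V} (hF : IsPower F) (p : MvPolynomial ι ℂ) :
    IsPower (act p F) := by
  rintro m ⟨i, hi⟩
  rw [act_eq_sum]
  refine Finset.sum_eq_zero fun e _ => ?_
  rw [hF _ ⟨i, by omega⟩, smul_zero]

lemma IsPower.add {F G : (ι → ℤ) → V} (hF : IsPower F) (hG : IsPower G) : IsPower (F + G) :=
  fun m hm => by simp [hF m hm, hG m hm]

lemma IsPower.smul {F : (ι → ℤ) → V} (hF : IsPower F) (c : ℂ) : IsPower (c • F) :=
  fun m hm => by simp [hF m hm]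

lemma IsPower.zero : IsPower (0 : (ι → ℤ) → V) := fun _ _ => rfl

lemma IsPower.map {V' : Type*} [AddCommGroup V'] [Module ℂ V'] (f : V →ₗ[ℂ] V')
    {F : (ι → ℤ) → V} (hF : IsPower F) : IsPower fun m => f (F m) :=
  fun m hm => by simp [hF m hm]

lemma act_prod_X_pow [Fintype ι] (N : ℕ) (F : (ι → ℤ) → V) (m : ι → ℤ) :
    act ((∏ i, X i) ^ N) F m = F (fun i => m i - N) := by
  have : ((∏ i, X i) ^ N : MvPolynomial ι ℂ) = monomial (Finsupp.equivFunOnFinite.symm fun _ => N) 1 := by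
    rw [monomial_eq]
    simp [Finset.prod_pow, Finsupp.prod_fintype]
  rw [this, act_monomial, one_smul]
  rfl

lemma act_rename {κ : Type*} (f : ι ≃ κ) (p : MvPolynomial ι ℂ) (F : (ι → ℤ) → V) :
    act (rename f p) (fun m => F fun i => m (f i)) = fun m => act p F fun i => m (f i) := by
  induction p using MvPolynomial.induction_on' with
  | monomial e c =>
    funext m
    rw [rename_monomial, act_monomial, act_monomial]
    congr 2
    funext i
    simp only [Finsupp.mapDomain_apply f.injective]
  | add p q hp hq => rw [map_add, act_add, hp, hq, act_add]; rfl

end Action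

/-! ### Lower truncated series -/

section LowerTruncated

variable {r : ℕ} {V : Type*} [AddCommGroup V] [Module ℂ V]

/-- Poles along the coordinate hyperplanes are thus cleared by a monomial, and statements about
W((x_1, …, x_r)) reduce to power series. -/
lemma isLowerTruncated_iff {F : (Fin r → ℤ) → V} :
    IsLowerTruncated F ↔ ∃ N : ℕ, IsPower (act ((∏ i, X i) ^ N) F) := by
  constructor
  · rintro ⟨N, hN⟩
    refine ⟨(-N).toNat, fun m ⟨i, hi⟩ => ?_⟩
    rw [act_prod_X_pow]
    exact hN _ ⟨i, by omega⟩
  · rintro ⟨N, hN⟩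
    refine ⟨-N, fun m ⟨i, hi⟩ => ?_⟩
    have := hN (fun i => m i + N) ⟨i, by omega⟩
    rw [act_prod_X_pow] at this
    simpa using this

lemma IsPower.isLowerTruncated {F : (Fin r → ℤ) → V} (h : IsPower F) : IsLowerTruncated F :=
  ⟨0, h⟩

lemma IsLowerTruncated.act {F : (Fin r → ℤ) → V} (hF : IsLowerTruncated F)
    (p : MvPolynomial (Fin r) ℂ) : IsLowerTruncated (act p F) := by
  obtain ⟨N, hN⟩ := hF
  refine ⟨N, fun m ⟨i, hi⟩ => ?_⟩
  rw [act_eq_sum]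
  refine Finset.sum_eq_zero fun e _ => ?_
  rw [hN _ ⟨i, by omega⟩, smul_zero]

lemma IsLowerTruncated.add {F G : (Fin r → ℤ) → V} (hF : IsLowerTruncated F)
    (hG : IsLowerTruncated G) : IsLowerTruncated (F + G) := by
  obtain ⟨N, hN⟩ := hF
  obtain ⟨M, hM⟩ := hG
  refine ⟨min N M, fun m ⟨i, hi⟩ => ?_⟩
  simp [hN m ⟨i, by omega⟩, hM m ⟨i, by omega⟩]

lemma IsLowerTruncated.neg {F : (Fin r → ℤ) → V} (hF : IsLowerTruncated F) :
    IsLowerTruncated (-F) := by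
  obtain ⟨N, hN⟩ := hF
  exact ⟨N, fun m hm => by simp [hN m hm]⟩

lemma IsLowerTruncated.sub {F G : (Fin r → ℤ) → V} (hF : IsLowerTruncated F)
    (hG : IsLowerTruncated G) : IsLowerTruncated (F - G) := by
  rw [sub_eq_add_neg]
  exact hF.add hG.neg

lemma IsLowerTruncated.map {V' : Type*} [AddCommGroup V'] [Module ℂ V'] (f : V →ₗ[ℂ] V')
    {F : (Fin r → ℤ) → V} (hF : IsLowerTruncated F) : IsLowerTruncated fun m => f (F m) := by
  obtain ⟨N, hN⟩ := hF
  exact ⟨N, fun m hm => by simp [hN m hm]⟩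

lemma IsLowerTruncated.of_act_X {F : (Fin r → ℤ) → V} (i : Fin r)
    (hF : IsLowerTruncated (FormalVA.act (X i) F)) : IsLowerTruncated F := by
  obtain ⟨N, hN⟩ := hF
  refine ⟨N - 1, fun m ⟨k, hk⟩ => ?_⟩
  have := hN (Function.update m i (m i + 1)) ⟨k, by
    by_cases h : k = i
    · subst h; simp; omega
    · simp [h]; omega⟩
  rw [act_X] at this
  simpa using this

end LowerTruncated

/-! ### Iterated Laurent series and cancellation of polynomials -/

section Iterated

variable {V : Type*} [AddCommGroup V] [Module ℂ V]

/-- Series in two variables belonging to `V((x_j))((x_i))`. -/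
def IsIterated (i j : Fin 2) (A : (Fin 2 → ℤ) → V) : Prop :=
  (∃ N : ℤ, ∀ m : Fin 2 → ℤ, m i < N → A m = 0) ∧
    ∀ a : ℤ, ∃ M : ℤ, ∀ m : Fin 2 → ℤ, m i = a → m j < M → A m = 0

variable {i j : Fin 2}

lemma IsIterated.add {A B : (Fin 2 → ℤ) → V} (hA : IsIterated i j A) (hB : IsIterated i j B) :
    IsIterated i j (A + B) := by
  obtain ⟨⟨N, hN⟩, hA⟩ := hA
  obtain ⟨⟨N', hN'⟩, hB⟩ := hB
  refine ⟨⟨min N N', fun m hm => ?_⟩, fun a => ?_⟩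
  · simp [hN m (by omega), hN' m (by omega)]
  · obtain ⟨M, hM⟩ := hA a
    obtain ⟨M', hM'⟩ := hB a
    exact ⟨min M M', fun m h1 h2 => by simp [hM m h1 (by omega), hM' m h1 (by omega)]⟩

lemma IsIterated.smul {A : (Fin 2 → ℤ) → V} (hA : IsIterated i j A) (c : ℂ) :
    IsIterated i j (c • A) := by
  obtain ⟨⟨N, hN⟩, hA⟩ := hA
  refine ⟨⟨N, fun m hm => by simp [hN m hm]⟩, fun a => ?_⟩
  obtain ⟨M, hM⟩ := hA a
  exact ⟨M, fun m h1 h2 => by simp [hM m h1 h2]⟩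

lemma IsIterated.neg {A : (Fin 2 → ℤ) → V} (hA : IsIterated i j A) : IsIterated i j (-A) := by
  rw [← neg_one_smul ℂ A]; exact hA.smul _

lemma IsIterated.sub {A B : (Fin 2 → ℤ) → V} (hA : IsIterated i j A) (hB : IsIterated i j B) :
    IsIterated i j (A - B) := by
  rw [sub_eq_add_neg]; exact hA.add hB.neg

lemma IsIterated.zero : IsIterated i j (0 : (Fin 2 → ℤ) → V) :=
  ⟨⟨0, fun _ _ => rfl⟩, fun _ => ⟨0, fun _ _ _ => rfl⟩⟩

lemma IsIterated.sum {α : Type*} {s : Finset α} {A : α → (Fin 2 → ℤ) → V}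
    (h : ∀ a ∈ s, IsIterated i j (A a)) : IsIterated i j (∑ a ∈ s, A a) :=
  Finset.sum_induction _ _ (fun _ _ => IsIterated.add) IsIterated.zero h

lemma IsIterated.map {V' : Type*} [AddCommGroup V'] [Module ℂ V'] (f : V →ₗ[ℂ] V')
    {A : (Fin 2 → ℤ) → V} (hA : IsIterated i j A) : IsIterated i j fun m => f (A m) := by
  obtain ⟨⟨N, hN⟩, hA⟩ := hA
  refine ⟨⟨N, fun m hm => by simp [hN m hm]⟩, fun a => ?_⟩
  obtain ⟨M, hM⟩ := hA a
  exact ⟨M, fun m h1 h2 => by simp [hM m h1 h2]⟩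

lemma IsIterated.shiftBy {A : (Fin 2 → ℤ) → V} (hA : IsIterated i j A) (e : Fin 2 →₀ ℕ) :
    IsIterated i j fun m => A fun k => m k - e k := by
  obtain ⟨⟨N, hN⟩, hA⟩ := hA
  refine ⟨⟨N, fun m hm => hN _ (by omega)⟩, fun a => ?_⟩
  obtain ⟨M, hM⟩ := hA (a - e i)
  exact ⟨M, fun m h1 h2 => hM _ (by omega) (by omega)⟩

lemma IsIterated.act {A : (Fin 2 → ℤ) → V} (hA : IsIterated i j A)
    (p : MvPolynomial (Fin 2) ℂ) : IsIterated i j (act p A) := by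
  have : FormalVA.act p A = ∑ e ∈ p.support, p.coeff e • fun m => A fun k => m k - e k := by
    funext m
    simp [act_eq_sum]
  rw [this]
  exact IsIterated.sum fun e _ => (hA.shiftBy e).smul _

lemma _root_.FormalVA.IsLowerTruncated.isIterated {A : (Fin 2 → ℤ) → V}
    (hA : IsLowerTruncated A) : IsIterated i j A := by
  obtain ⟨N, hN⟩ := hA
  exact ⟨⟨N, fun m hm => hN m ⟨i, hm⟩⟩, fun a => ⟨N, fun m _ hm => hN m ⟨j, hm⟩⟩⟩

lemma IsPower.isIterated {A : (Fin 2 → ℤ) → V} (hA : IsPower A) : IsIterated i j A :=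
  hA.isLowerTruncated.isIterated

/-- Nonzero polynomials act injectively on `V((x_j))((x_i))`. -/
lemma IsIterated.eq_zero (hij : i ≠ j) {A : (Fin 2 → ℤ) → V} (hA : IsIterated i j A)
    {p : MvPolynomial (Fin 2) ℂ} (hp : p ≠ 0) (h : FormalVA.act p A = 0) : A = 0 := by
  have h2 : ∀ k : Fin 2, k = i ∨ k = j := by omega
  by_contra hne
  obtain ⟨⟨N, hN⟩, hA⟩ := hA
  obtain ⟨m', hm'⟩ := Function.ne_iff.mp hne
  -- The support of A has a lexicographically least element `m₂`: least exponent `a` of x_i, then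
  -- least exponent `b` of x_j at that level.
  obtain ⟨a, ⟨m₁, hm₁, hm₁'⟩, ha⟩ := Int.exists_least_of_bdd (P := fun a => ∃ m, A m ≠ 0 ∧ m i = a)
    ⟨N, fun a ⟨m, hm, hma⟩ => by
      by_contra hlt
      exact hm (hN m (by omega))⟩ ⟨_, m', hm', rfl⟩
  obtain ⟨M, hM⟩ := hA a
  obtain ⟨b, ⟨m₂, hm₂, hm₂i, hm₂j⟩, hb⟩ := Int.exists_least_of_bdd
    (P := fun b => ∃ m, A m ≠ 0 ∧ m i = a ∧ m j = b)
    ⟨M, fun b ⟨m, hm, hma, hmb⟩ => by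
      by_contra hlt
      exact hm (hM m hma (by omega))⟩ ⟨_, m₁, hm₁, hm₁', rfl⟩
  -- With `e` least for the same order in the support of p, only the product of the two lowest terms
  -- contributes at the exponent `m₂ + e`.
  obtain ⟨e, he, hmin⟩ := Finset.exists_min_image p.support (fun e => toLex (e i, e j))
    (Finset.nonempty_iff_ne_empty.mpr (by simpa using hp))
  have key : FormalVA.act p A (fun k => m₂ k + e k) = p.coeff e • A m₂ := by
    rw [act_eq_sum, Finset.sum_eq_single_of_mem e he]
    · simp
    · intro e' he' hne'
      by_cases hz : A (fun k => m₂ k + e k - e' k) = 0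
      · rw [hz, smul_zero]
      exfalso
      have h1 := ha _ ⟨_, hz, rfl⟩
      have h3 := hmin e' he'
      rw [Prod.Lex.le_iff] at h3
      simp only [ofLex_toLex] at h3
      have hi : e i = e' i := by omega
      have h4 := hb _ ⟨_, hz, by omega, rfl⟩
      have hj : e j = e' j := by omega
      apply hne'
      ext k
      rcases h2 k with rfl | rfl
      · exact hi.symm
      · exact hj.symm
  rw [h] at key
  rcases smul_eq_zero.mp key.symm with h0 | h0
  · exact (mem_support_iff.mp he) h0
  · exact hm₂ h0

lemma IsIterated.act_injective (hij : i ≠ j) {A B : (Fin 2 → ℤ) → V} (hA : IsIterated i j A)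
    (hB : IsIterated i j B) {p : MvPolynomial (Fin 2) ℂ} (hp : p ≠ 0)
    (h : FormalVA.act p A = FormalVA.act p B) : A = B := by
  rw [← sub_eq_zero]
  exact (hA.sub hB).eq_zero hij hp (by rw [map_sub, h, sub_self])

end Iterated

/-! ### The substitution x_i ↦ x_i + x_j -/

section Translation

variable {ι : Type*} [DecidableEq ι] {V : Type*} [AddCommGroup V] [Module ℂ V]

/-- The substitution `x_i ↦ x_i + x_j`. -/
def shiftHom (i j : ι) : MvPolynomial ι ℂ →ₐ[ℂ] MvPolynomial ι ℂ :=
  aeval (Function.update X i (X i + X j))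

lemma shiftHom_X_self (i j : ι) : shiftHom i j (X i) = X i + X j := by simp [shiftHom]

lemma shiftHom_X_of_ne {i k : ι} (j : ι) (h : k ≠ i) : shiftHom i j (X k) = X k := by
  simp [shiftHom, h]

lemma shiftHom_injective {i j : ι} (h : i ≠ j) : Function.Injective (shiftHom i j) := by
  have : (aeval (Function.update X i (X i - X j)) : MvPolynomial ι ℂ →ₐ[ℂ] _).comp
      (shiftHom i j) = AlgHom.id ℂ _ := by
    ext k : 1
    by_cases hk : k = i
    · subst hk; simp [shiftHom, h.symm]
    · simp [shiftHom, hk]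
  intro p q hpq
  rw [← AlgHom.id_apply (R := ℂ) p, ← AlgHom.id_apply (R := ℂ) q, ← this]
  simp [hpq]

lemma shiftHom_ne_zero {i j : ι} (h : i ≠ j) {p : MvPolynomial ι ℂ} (hp : p ≠ 0) :
    shiftHom i j p ≠ 0 := by
  rwa [Ne, map_eq_zero_iff _ (shiftHom_injective h)]

/-- `F ↦ F(x_i + x_j, x_j)`, expanded in nonnegative powers of `x_j`, for series `F` whose powers
of `x_j` are at least `N`. -/
def translate (i j : ι) (N : ℤ) : Module.End ℂ ((ι → ℤ) → V) where
  toFun F m := ∑ k ∈ Finset.range ((m j - N).toNat + 1), (Ring.choose (m i + k) k : ℤ) •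
    F (Function.update (Function.update m i (m i + k)) j (m j - k))
  map_add' F G := by
    funext m
    simp [Finset.sum_add_distrib]
  map_smul' c F := by
    funext m
    simp only [Pi.smul_apply, RingHom.id_apply, Finset.smul_sum]
    exact Finset.sum_congr rfl fun k _ => smul_comm _ _ _

lemma translate_def (i j : ι) (N : ℤ) (F : (ι → ℤ) → V) (m : ι → ℤ) :
    translate i j N F m = ∑ k ∈ Finset.range ((m j - N).toNat + 1),
      (Ring.choose (m i + k) k : ℤ) •
        F (Function.update (Function.update m i (m i + k)) j (m j - k)) := rfl

/-- Terms with k > m j - N vanish, so any larger cutoff gives the same sum. This allows translates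
to be compared with a common number of terms. -/
lemma translate_apply {i j : ι} {N : ℤ} {F : (ι → ℤ) → V}
    (hF : ∀ m : ι → ℤ, m j < N → F m = 0) {m : ι → ℤ} {K : ℕ} (hK : m j - N < K) :
    translate i j N F m = ∑ k ∈ Finset.range K, (Ring.choose (m i + k) k : ℤ) •
      F (Function.update (Function.update m i (m i + k)) j (m j - k)) := by
  rw [translate_def]
  by_cases h : m j < N
  · trans 0
    · exact Finset.sum_eq_zero fun k _ => by rw [hF _ (by simp; omega), smul_zero]
    · exact (Finset.sum_eq_zero fun k _ => by rw [hF _ (by simp; omega), smul_zero]).symm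
  · refine Finset.sum_subset (fun k hk => ?_) fun k _ hk => ?_
    · simp at hk ⊢; omega
    · rw [hF _ (by simp at hk ⊢; omega), smul_zero]

lemma act_eq_zero_of_lt {j : ι} {N : ℤ} {F : (ι → ℤ) → V}
    (hF : ∀ m : ι → ℤ, m j < N → F m = 0) (p : MvPolynomial ι ℂ) :
    ∀ m : ι → ℤ, m j < N → act p F m = 0 := by
  intro m hm
  rw [act_eq_sum]
  refine Finset.sum_eq_zero fun e _ => ?_
  rw [hF _ (by omega), smul_zero]

/-- Pascal's rule for the binomial coefficients of (x_i + x_j)^m, after splitting off the term k =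
0. -/
lemma translate_act_X_self {i j : ι} (hij : i ≠ j) {N : ℤ} {F : (ι → ℤ) → V}
    (hF : ∀ m : ι → ℤ, m j < N → F m = 0) :
    translate i j N (act (X i) F) = act (X i + X j) (translate i j N F) := by
  funext m
  obtain ⟨K, hK⟩ : ∃ K : ℕ, m j - N < K := ⟨(m j - N).toNat + 1, by omega⟩
  rw [act_add, Pi.add_apply, act_X, act_X, translate_apply (act_eq_zero_of_lt hF _) (K := K + 1)
    (by push_cast; omega), translate_apply hF (K := K + 1) (by simp [hij.symm]; omega),
    translate_apply hF (K := K) (by simp; omega)]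
  rw [Finset.sum_range_succ', Finset.sum_range_succ' (n := K)]
  rw [add_right_comm, ← Finset.sum_add_distrib]
  congr 1
  · refine Finset.sum_congr rfl fun k _ => ?_
    rw [act_X]
    have h1 : Function.update (Function.update (Function.update m i (m i + ↑(k + 1))) j
        (m j - ↑(k + 1))) i (Function.update (Function.update m i (m i + ↑(k + 1))) j
        (m j - ↑(k + 1)) i - 1) =
        Function.update (Function.update m i (m i + k)) j (m j - (k + 1)) := by
      funext l
      rcases eq_or_ne l i with rfl | hl <;> rcases eq_or_ne l j with rfl | hl' <;>
        (simp_all; try omega)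
    have h2 : Function.update (Function.update (Function.update m i (m i - 1)) i
        (Function.update m i (m i - 1) i + ↑(k + 1))) j
          (Function.update m i (m i - 1) j - ↑(k + 1)) =
        Function.update (Function.update m i (m i + k)) j (m j - (k + 1)) := by
      funext l
      rcases eq_or_ne l i with rfl | hl <;> rcases eq_or_ne l j with rfl | hl' <;>
        simp_all [Function.update_apply]
    have h3 : Function.update (Function.update (Function.update m j (m j - 1)) i
        (Function.update m j (m j - 1) i + k)) j
          (Function.update m j (m j - 1) j - k) =
        Function.update (Function.update m i (m i + k)) j (m j - (k + 1)) := by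
      funext l
      by_cases hl : l = i
      · subst hl; simp [hij]
      · by_cases hl' : l = j
        · subst hl'; simp; ring
        · simp [hl, hl']
    rw [h1, h2, h3, ← add_smul]
    congr 1
    have := Ring.choose_succ_succ (m i + k) k
    simp only [Function.update_self, Function.update_of_ne hij]
    rw [show m i + ((k + 1 : ℕ) : ℤ) = m i + k + 1 by push_cast; ring, this,
      show m i - 1 + ((k + 1 : ℕ) : ℤ) = m i + k by push_cast; ring]
    ring
  · simp [act_X, hij.symm, Function.update_comm hij]

lemma translate_act_X_base {i j : ι} (hij : i ≠ j) {N : ℤ} {F : (ι → ℤ) → V}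
    (hF : ∀ m : ι → ℤ, m j < N → F m = 0) :
    translate i j N (act (X j) F) = act (X j) (translate i j N F) := by
  funext m
  obtain ⟨K, hK⟩ : ∃ K : ℕ, m j - N < K := ⟨(m j - N).toNat + 1, by omega⟩
  rw [act_X, translate_apply (act_eq_zero_of_lt hF _) hK,
    translate_apply hF (K := K) (by simp; omega)]
  refine Finset.sum_congr rfl fun k _ => ?_
  rw [act_X]
  simp only [Function.update_self, Function.update_of_ne hij]
  congr 2
  funext l
  by_cases hl : l = i
  · subst hl; simp [hij]
  · by_cases hl' : l = j
    · subst hl'; simp; ring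
    · simp [hl, hl']

lemma translate_act_X_of_ne {i j k : ι} (hi : k ≠ i) (hj : k ≠ j) (N : ℤ) (F : (ι → ℤ) → V) :
    translate i j N (act (X k) F) = act (X k) (translate i j N F) := by
  funext m
  rw [act_X]
  simp only [translate, LinearMap.coe_mk, AddHom.coe_mk, act_X, Function.update_of_ne hi.symm,
    Function.update_of_ne hj.symm]
  refine Finset.sum_congr rfl fun s _ => ?_
  congr 2
  funext l
  rcases eq_or_ne l i with rfl | hl <;> rcases eq_or_ne l j with rfl | hl' <;>
    rcases eq_or_ne l k with rfl | hl'' <;> simp_all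

/-- Substitution is multiplicative, so translation is semilinear along `shiftHom`. It suffices to
treat constants and variables. -/
lemma translate_act {i j : ι} (hij : i ≠ j) {N : ℤ} (p : MvPolynomial ι ℂ) {F : (ι → ℤ) → V}
    (hF : ∀ m : ι → ℤ, m j < N → F m = 0) :
    translate i j N (act p F) = act (shiftHom i j p) (translate i j N F) := by
  induction p using MvPolynomial.induction_on generalizing F with
  | C c => rw [act_C, ← algebraMap_eq, AlgHom.commutes, algebraMap_eq, act_C, map_smul]
  | add p q hp hq => rw [act_add, map_add, map_add, act_add, hp hF, hq hF]
  | mul_X p k hp =>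
    rw [act_mul, hp (act_eq_zero_of_lt hF _), map_mul, act_mul]
    congr 1
    by_cases hi : k = i
    · subst hi; rw [translate_act_X_self hij hF, shiftHom_X_self]
    · rw [shiftHom_X_of_ne j hi]
      by_cases hj : k = j
      · subst hj; rw [translate_act_X_base hij hF]
      · rw [translate_act_X_of_ne hi hj]

lemma translate_map {V' : Type*} [AddCommGroup V'] [Module ℂ V'] (f : V →ₗ[ℂ] V')
    (i j : ι) (N : ℤ) (F : (ι → ℤ) → V) :
    translate i j N (fun m => f (F m)) = fun m => f (translate i j N F m) := by
  funext m
  simp [translate]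

lemma IsPower.eq_zero_of_lt {F : (ι → ℤ) → V} (hF : IsPower F) (j : ι) :
    ∀ m : ι → ℤ, m j < 0 → F m = 0 := fun m hm => hF m ⟨j, hm⟩

lemma choose_eq_zero_of_nonneg_of_lt {a : ℤ} {k : ℕ} (h0 : 0 ≤ a) (h : a < k) :
    Ring.choose a k = 0 := by
  lift a to ℕ using h0
  rw [Ring.choose_natCast, Nat.choose_eq_zero_of_lt (by exact_mod_cast h), Nat.cast_zero]

/-- If the exponent a of x_i is negative, then either a + k < 0 and the coefficient of F vanishes,
or 0 ≤ a + k < k and the binomial coefficient does. -/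
lemma IsPower.translate {i j : ι} (hij : i ≠ j) {F : (ι → ℤ) → V} (hF : IsPower F) :
    IsPower (translate i j 0 F) := by
  rintro m ⟨l, hl⟩
  rw [translate_def]
  refine Finset.sum_eq_zero fun k _ => ?_
  by_cases hlj : l = j
  · subst hlj
    rw [hF _ ⟨l, by simp; omega⟩, smul_zero]
  by_cases hli : l = i
  · subst hli
    by_cases h : m l + k < 0
    · rw [hF _ ⟨l, by simp [hij]; omega⟩, smul_zero]
    · rw [choose_eq_zero_of_nonneg_of_lt (by omega) (by omega), zero_smul]
  · rw [hF _ ⟨l, by simp [hlj, hli, hl]⟩, smul_zero]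

lemma translate_base_of_eq_zero {i j : ι} {N : ℤ} {F : (ι → ℤ) → V}
    (hF : ∀ m : ι → ℤ, m j < N → F m = 0) {m : ι → ℤ} (hm : m j = N) :
    translate i j N F m = F m := by
  rw [translate_apply hF (K := 1) (by simp; omega)]
  simp

end Translation

/-! ### Restriction to two variables -/

section Slice

variable {ι : Type*} [DecidableEq ι] {V : Type*} [AddCommGroup V] [Module ℂ V]

/-- The series in `x_i, x_j` obtained by fixing the powers of all other variables. -/
def slice (i j : ι) (t : ι → ℤ) : ((ι → ℤ) → V) →ₗ[ℂ] ((Fin 2 → ℤ) → V) where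
  toFun F e := F (Function.update (Function.update t i (e 0)) j (e 1))
  map_add' _ _ := rfl
  map_smul' _ _ := rfl

lemma slice_apply (i j : ι) (t : ι → ℤ) (F : (ι → ℤ) → V) (e : Fin 2 → ℤ) :
    slice i j t F e = F (Function.update (Function.update t i (e 0)) j (e 1)) := rfl

lemma ext_slice {i j : ι} {F G : (ι → ℤ) → V} (h : ∀ t, slice i j t F = slice i j t G) :
    F = G := by
  funext m
  have := congrFun (h m) ![m i, m j]
  simpa [slice_apply] using this

lemma slice_act_X_fst {i j : ι} (hij : i ≠ j) (t : ι → ℤ) (F : (ι → ℤ) → V) :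
    slice i j t (act (X i) F) = act (X 0) (slice i j t F) := by
  funext e
  rw [slice_apply, act_X, act_X, slice_apply]
  congr 1
  funext l
  rcases eq_or_ne l i with rfl | hl <;> rcases eq_or_ne l j with rfl | hl' <;> simp_all

lemma slice_act_X_snd {i j : ι} (hij : i ≠ j) (t : ι → ℤ) (F : (ι → ℤ) → V) :
    slice i j t (act (X j) F) = act (X 1) (slice i j t F) := by
  funext e
  rw [slice_apply, act_X, act_X, slice_apply]
  congr 1
  funext l
  rcases eq_or_ne l i with rfl | hl <;> rcases eq_or_ne l j with rfl | hl' <;> simp_all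

lemma slice_act_X_of_ne {i j k : ι} (hi : k ≠ i) (hj : k ≠ j) (t : ι → ℤ) (F : (ι → ℤ) → V) :
    slice i j t (act (X k) F) = slice i j (Function.update t k (t k - 1)) F := by
  funext e
  rw [slice_apply, act_X, slice_apply]
  congr 1
  funext l
  rcases eq_or_ne l i with rfl | hl <;> rcases eq_or_ne l j with rfl | hl' <;>
    rcases eq_or_ne l k with rfl | hl'' <;> simp_all

lemma slice_translate {i j : ι} (hij : i ≠ j) (t : ι → ℤ) (N : ℤ) (F : (ι → ℤ) → V) :
    slice i j t (translate i j N F) = translate 0 1 N (slice i j t F) := by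
  funext e
  rw [slice_apply, translate_def, translate_def]
  simp only [Function.update_self, Function.update_of_ne hij]
  refine Finset.sum_congr rfl fun k _ => ?_
  rw [slice_apply]
  congr 2
  funext l
  rcases eq_or_ne l i with rfl | hl <;> rcases eq_or_ne l j with rfl | hl' <;> simp_all

lemma IsPower.slice {i j : ι} (hij : i ≠ j) {F : (ι → ℤ) → V} (hF : IsPower F) (t : ι → ℤ) :
    IsPower (slice i j t F) := by
  rintro m ⟨l, hl⟩
  rw [slice_apply]
  obtain rfl | rfl : l = 0 ∨ l = 1 := by omega
  · exact hF _ ⟨i, by simpa [hij] using hl⟩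
  · exact hF _ ⟨j, by simpa using hl⟩

end Slice

/-! ### Operator product expansions in two variables -/

section OperatorProduct

variable {V : Type*} [AddCommGroup V] [Module ℂ V]

/-- `B(x_1, x_2)` and `A(x_0, x_2)` are expansions of one rational function of `x_1` and `x_2`, the
second one being taken at `x_1 = x_2 + x_0` and expanded in `V((x_2))((x_0))`. -/
structure IsOPE (B A : (Fin 2 → ℤ) → V) : Prop where
  isIterated : IsIterated 0 1 A
  exists_poly : ∃ q : MvPolynomial (Fin 2) ℂ, q ≠ 0 ∧ IsPower (act q B) ∧
    act (shiftHom 0 1 q) A = translate 0 1 0 (act q B)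

namespace IsOPE

variable {A B A' B' : (Fin 2 → ℤ) → V}

lemma zero_ne_one : (0 : Fin 2) ≠ 1 := by decide

/-- A clearing polynomial may be replaced by any multiple, so that two expansions can be given a
common one. -/
lemma mul_poly {q : MvPolynomial (Fin 2) ℂ} (h1 : IsPower (FormalVA.act q B))
    (h2 : FormalVA.act (shiftHom 0 1 q) A = translate 0 1 0 (FormalVA.act q B))
    (p : MvPolynomial (Fin 2) ℂ) :
    IsPower (FormalVA.act (p * q) B) ∧
      FormalVA.act (shiftHom 0 1 (p * q)) A = translate 0 1 0 (FormalVA.act (p * q) B) := by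
  rw [act_mul]
  refine ⟨h1.act p, ?_⟩
  rw [map_mul, act_mul, h2, translate_act zero_ne_one _ (h1.eq_zero_of_lt 1)]

lemma add (h : IsOPE B A) (h' : IsOPE B' A') : IsOPE (B + B') (A + A') := by
  obtain ⟨hA, q, hq, h1, h2⟩ := h
  obtain ⟨hA', q', hq', h1', h2'⟩ := h'
  obtain ⟨h3, h4⟩ := mul_poly h1 h2 q'
  obtain ⟨h3', h4'⟩ := mul_poly h1' h2' q
  rw [mul_comm] at h3' h4'
  refine ⟨hA.add hA', q' * q, mul_ne_zero hq' hq, ?_, ?_⟩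
  · rw [map_add]; exact h3.add h3'
  · rw [map_add, map_add, map_add, h4, h4']

lemma map {V' : Type*} [AddCommGroup V'] [Module ℂ V'] (f : V →ₗ[ℂ] V') (h : IsOPE B A) :
    IsOPE (fun m => f (B m)) (fun m => f (A m)) := by
  obtain ⟨hA, q, hq, h1, h2⟩ := h
  refine ⟨hA.map f, q, hq, ?_, ?_⟩
  · rw [act_map]; exact h1.map f
  · rw [act_map, act_map, translate_map, h2]

lemma smul (h : IsOPE B A) (c : ℂ) : IsOPE (c • B) (c • A) :=
  h.map (c • (LinearMap.id : V →ₗ[ℂ] V))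

lemma neg (h : IsOPE B A) : IsOPE (-B) (-A) :=
  h.map (-(LinearMap.id : V →ₗ[ℂ] V))

lemma sub (h : IsOPE B A) (h' : IsOPE B' A') : IsOPE (B - B') (A - A') := by
  rw [sub_eq_add_neg, sub_eq_add_neg]
  exact h.add h'.neg

lemma of_isPower (h : IsPower B) : IsOPE B (translate 0 1 0 B) :=
  ⟨(h.translate zero_ne_one).isIterated, 1, one_ne_zero, by rwa [act_one],
    by rw [map_one, act_one, act_one]⟩

lemma zero : IsOPE (0 : (Fin 2 → ℤ) → V) 0 := by
  simpa using of_isPower (IsPower.zero (V := V) (ι := Fin 2))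

lemma act (h : IsOPE B A) (p : MvPolynomial (Fin 2) ℂ) :
    IsOPE (FormalVA.act p B) (FormalVA.act (shiftHom 0 1 p) A) := by
  obtain ⟨hA, q, hq, h1, h2⟩ := h
  obtain ⟨h3, h4⟩ := mul_poly h1 h2 p
  refine ⟨hA.act _, q, hq, ?_, ?_⟩
  · rwa [← act_mul, mul_comm]
  · rwa [← act_mul, ← map_mul, ← act_mul, mul_comm]

lemma of_act {p : MvPolynomial (Fin 2) ℂ} (hp : p ≠ 0) (hA : IsIterated 0 1 A)
    (h : IsOPE (FormalVA.act p B) (FormalVA.act (shiftHom 0 1 p) A)) : IsOPE B A := by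
  obtain ⟨_, q, hq, h1, h2⟩ := h
  rw [← act_mul] at h1
  rw [← act_mul, ← map_mul, ← act_mul] at h2
  exact ⟨hA, q * p, mul_ne_zero hq hp, h1, h2⟩

/-- Where B has no poles, re-expansion is plain substitution: the two candidates agree after
multiplication by the shifted clearing polynomial, which can be cancelled in V((x_2))((x_0)). -/
lemma eq_translate (h : IsOPE B A) (hB : IsPower B) : A = translate 0 1 0 B := by
  obtain ⟨hA, q, hq, h1, h2⟩ := h
  refine hA.act_injective zero_ne_one (hB.translate zero_ne_one).isIterated
    (shiftHom_ne_zero zero_ne_one hq) ?_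
  rw [h2, translate_act zero_ne_one _ (hB.eq_zero_of_lt 1)]

lemma unique (h : IsOPE B A) (h' : IsOPE B A') : A = A' := by
  have := (h.sub h').eq_translate (by rw [sub_self]; exact IsPower.zero)
  rwa [sub_self, map_zero, sub_eq_zero] at this

end IsOPE

end OperatorProduct

/-! ### Operator product expansions inside series in many variables -/

section Transfer

variable {ι : Type*} [DecidableEq ι] {V : Type*} [AddCommGroup V] [Module ℂ V]
  {i j : ι} {A B : (ι → ℤ) → V}

/-- The variables x_i and x_j act within a slice, while any other variable carries one slice to a
neighbouring one. Hence the hypothesis is needed for all slices at once. -/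
lemma IsOPE.slice_act (hij : i ≠ j) (h : ∀ t, IsOPE (slice i j t B) (slice i j t A))
    (Q : MvPolynomial ι ℂ) (t : ι → ℤ) :
    IsOPE (slice i j t (FormalVA.act Q B)) (slice i j t (FormalVA.act (shiftHom i j Q) A)) := by
  induction Q using MvPolynomial.induction_on generalizing A B t with
  | C c =>
    rw [act_C, ← algebraMap_eq, AlgHom.commutes, algebraMap_eq, act_C, map_smul, map_smul]
    exact (h t).smul c
  | add p q hp hq =>
    rw [act_add, map_add (shiftHom i j), act_add, map_add, map_add]
    exact (hp h t).add (hq h t)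
  | mul_X p k hp =>
    rw [act_mul, map_mul, act_mul]
    refine hp (fun s => ?_) t
    by_cases hi : k = i
    · subst hi
      rw [shiftHom_X_self, act_add, map_add, slice_act_X_fst hij, slice_act_X_fst hij,
        slice_act_X_snd hij, ← act_add, ← shiftHom_X_self]
      exact (h s).act _
    · rw [shiftHom_X_of_ne j hi]
      by_cases hj : k = j
      · subst hj
        rw [slice_act_X_snd hij, slice_act_X_snd hij]
        have := (h s).act (X 1)
        rwa [shiftHom_X_of_ne _ (by decide)] at this
      · rw [slice_act_X_of_ne hi hj, slice_act_X_of_ne hi hj]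
        exact h _

/-- If `B` and `A` are operator product expansions of each other in the variables `x_i, x_j`, then
clearing the poles of `B` in all variables clears those of `A`. -/
lemma IsOPE.transfer (hij : i ≠ j) (h : ∀ t, IsOPE (slice i j t B) (slice i j t A))
    {Q : MvPolynomial ι ℂ} (hQ : IsPower (FormalVA.act Q B)) :
    FormalVA.act (shiftHom i j Q) A = translate i j 0 (FormalVA.act Q B) := by
  refine ext_slice (i := i) (j := j) fun t => ?_
  rw [slice_translate hij]
  exact (IsOPE.slice_act hij h Q t).eq_translate (hQ.slice hij t)

end Transfer

/-! ### The substitution x_1 = x + x_0 in lower truncated series -/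

section Substitution

variable {W : Type*} [AddCommGroup W] [Module ℂ W]

/-- The series `F(x + x_0, x)` in `x_0, x`, expanded in nonnegative powers of `x_0`. -/
def substSeries (F : (Fin 2 → ℤ) → W) : (Fin 2 → ℤ) → W :=
  fun e => if 0 ≤ e 0 then substCoeff F (e 0).toNat (e 1) else 0

lemma substSeries_natCast (F : (Fin 2 → ℤ) → W) (s : ℕ) (j : ℤ) :
    substSeries F ![(s : ℤ), j] = substCoeff F s j := by
  simp [substSeries]

lemma vec_eta (e : Fin 2 → ℤ) : e = ![e 0, e 1] := by
  funext k; fin_cases k <;> rfl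

lemma act_X_zero_vec (F : (Fin 2 → ℤ) → W) (a b : ℤ) : act (X 0) F ![a, b] = F ![a - 1, b] := by
  rw [act_X]; congr 1; funext k; fin_cases k <;> simp

lemma act_X_one_vec (F : (Fin 2 → ℤ) → W) (a b : ℤ) : act (X 1) F ![a, b] = F ![a, b - 1] := by
  rw [act_X]; congr 1; funext k; fin_cases k <;> simp

/-- Pascal's rule; here the binomials are expanded in nonnegative powers of x_0. -/
lemma substSeries_act_X_zero {F : (Fin 2 → ℤ) → W} (hF : IsLowerTruncated F) :
    substSeries (act (X 0) F) = act (X 0 + X 1) (substSeries F) := by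
  funext e
  rw [vec_eta e, act_add, Pi.add_apply, act_X_zero_vec, act_X_one_vec]
  rcases lt_or_ge (e 0) 0 with h | h
  · have h1 : ¬ 0 ≤ e 0 - 1 := by omega
    show ite _ _ _ = ite _ _ _ + ite _ _ _
    rw [if_neg (by exact h.not_ge), if_neg (by exact h1), if_neg (by exact h.not_ge), add_zero]
  generalize e 1 = j
  lift e 0 to ℕ using h with i
  rw [substSeries_natCast, substSeries_natCast]
  unfold substCoeff
  rw [← finsum_comp_equiv (Equiv.addRight (1 : ℤ))]
  simp only [Equiv.coe_addRight, act_X_zero_vec, add_sub_cancel_right]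
  rcases i with _ | s
  · simp only [Ring.choose_zero_right, CharP.cast_eq_zero, add_zero]
    rw [show substSeries F ![0 - 1, j] = 0 by simp [substSeries], zero_add]
    exact finsum_congr fun m => by rw [show j - (m + 1) = j - 1 - m by omega]
  · rw [show (((s + 1 : ℕ) : ℤ) - 1) = s by push_cast; ring, substSeries_natCast]
    unfold substCoeff
    rw [← finsum_add_distrib (substCoeff_support_finite hF _ _)
      (substCoeff_support_finite hF _ _)]
    refine finsum_congr fun m => ?_
    rw [Ring.choose_succ_succ, add_smul]
    rw [show j - (m + 1) + ((s + 1 : ℕ) : ℤ) = j - m + s by push_cast; ring,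
      show j - 1 - m + ((s + 1 : ℕ) : ℤ) = j - m + s by push_cast; ring]

lemma substSeries_act_X_one (F : (Fin 2 → ℤ) → W) :
    substSeries (act (X 1) F) = act (X 1) (substSeries F) := by
  funext e
  rw [vec_eta e, act_X_one_vec]
  rcases lt_or_ge (e 0) 0 with h | h
  · simp [substSeries, h.not_ge]
  generalize e 1 = j
  lift e 0 to ℕ using h with i
  rw [substSeries_natCast, substSeries_natCast]
  unfold substCoeff
  refine finsum_congr fun m => ?_
  rw [act_X_one_vec]
  rw [show j - m + (i : ℤ) - 1 = j - 1 - m + i by omega]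

lemma substSeries_act {F : (Fin 2 → ℤ) → W} (hF : IsLowerTruncated F) (n k : ℕ) :
    substSeries (act (X 0 ^ n * X 1 ^ k) F) =
      act (shiftHom 0 1 (X 0 ^ n * X 1 ^ k)) (substSeries F) := by
  induction n with
  | zero =>
    induction k with
    | zero => simp
    | succ k ih =>
      rw [pow_succ' (X 1), mul_left_comm, act_mul, substSeries_act_X_one, ih,
        _root_.map_mul (shiftHom 0 1) (X 1), act_mul, shiftHom_X_of_ne _ (by decide)]
  | succ n ih =>
    rw [pow_succ' (X 0), mul_assoc, act_mul, substSeries_act_X_zero (hF.act _), ih,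
      _root_.map_mul (shiftHom 0 1) (X 0), act_mul, shiftHom_X_self]

/-- Expanding in powers of x_0 or in powers of x makes no difference for nonnegative exponents. This
is where the definition of the products meets `translate`. -/
lemma substSeries_of_isPower {H : (Fin 2 → ℤ) → W} (hH : IsPower H) :
    substSeries H = translate 0 1 0 H := by
  funext e
  rcases lt_or_ge (e 0) 0 with h | h
  · rw [hH.translate zero_ne_one e ⟨0, h⟩]
    simp [substSeries, h.not_ge]
  rw [vec_eta e]
  generalize e 1 = j
  lift e 0 to ℕ using h with i
  rw [substSeries_natCast, translate_def]
  unfold substCoeff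
  -- The summation index is the exponent m = i + k of x_1 with 0 ≤ k ≤ j. Terms with m < i vanish by
  -- H or by the binomial coefficient, those with k > j by H.
  rw [finsum_eq_sum_of_support_subset (s := (Finset.range ((j - 0).toNat + 1)).map
    ⟨fun k : ℕ => (i : ℤ) + k, fun a b h => by simpa using h⟩)]
  · rw [Finset.sum_map]
    refine Finset.sum_congr (by simp) fun k _ => ?_
    show (Ring.choose ((i : ℤ) + k) i : ℤ) • H ![(i : ℤ) + k, j - (i + k) + i] =
      (Ring.choose ((i : ℤ) + k) k : ℤ) • _
    congr 1
    · have h1 : ((i : ℤ) + k) = ((i + k : ℕ) : ℤ) := by push_cast; ring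
      rw [h1, Ring.choose_natCast, Ring.choose_natCast, Nat.choose_symm_add]
    · congr 1
      funext l
      fin_cases l <;> (simp; try omega)
  · intro m hm
    simp only [Finset.coe_map, Set.mem_image, Finset.coe_range,
      Set.mem_Iio]
    by_contra hcon
    apply hm
    rcases lt_or_ge m 0 with h0 | h0
    · show _ • _ = _
      rw [hH _ ⟨0, by simpa using h0⟩, smul_zero]
    rcases lt_or_ge m i with h1 | h1
    · show _ • _ = _
      rw [choose_eq_zero_of_nonneg_of_lt h0 h1, zero_smul]
    · show _ • _ = _
      rw [hH _ ⟨1, ?_⟩, smul_zero]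
      by_contra h2
      refine hcon ⟨(m - i).toNat, ?_, ?_⟩
      · simp at h2 ⊢
        omega
      · show (i : ℤ) + ((m - i).toNat : ℤ) = m
        omega

end Substitution

/-! ### Comparison with the field ℂ((x))((x_0)) -/

section Hahn

variable {W : Type*} [AddCommGroup W] [Module ℂ W]

/-- The coefficients of an element of `W((x))((x_0))`. -/
def hahnCoeff (O : HahnModule ℤ (LaurentSeries ℂ) (HahnModule ℤ ℂ W)) : (Fin 2 → ℤ) → W :=
  fun e => ((HahnModule.of ℂ).symm (((HahnModule.of (LaurentSeries ℂ)).symm O).coeff (e 0))).coeff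
    (e 1)

lemma hahnCoeff_add (O O' : HahnModule ℤ (LaurentSeries ℂ) (HahnModule ℤ ℂ W)) :
    hahnCoeff (O + O') = hahnCoeff O + hahnCoeff O' := rfl

lemma HahnModule.coeff_single_smul' {R M : Type*} [Semiring R] [AddCommMonoid M] [Module R M]
    (b a : ℤ) (r : R) (x : HahnModule ℤ R M) :
    ((HahnModule.of R).symm (HahnSeries.single b r • x)).coeff a =
      r • ((HahnModule.of R).symm x).coeff (a - b) := by
  have := HahnModule.coeff_single_smul_vadd (Γ := ℤ) (r := r) (x := x) (a := a - b) (b := b)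
  rwa [vadd_eq_add, add_sub_cancel] at this

lemma mul_smul_hahn (a b : LaurentSeries (LaurentSeries ℂ))
    (O : HahnModule ℤ (LaurentSeries ℂ) (HahnModule ℤ ℂ W)) : (a * b) • O = a • (b • O) :=
  (HahnModule.instModule (Γ := ℤ) (Γ' := ℤ) (R := LaurentSeries ℂ)
    (V := HahnModule ℤ ℂ W)).mul_smul a b O

lemma hahnCoeff_C_smul (f : LaurentSeries ℂ)
    (O : HahnModule ℤ (LaurentSeries ℂ) (HahnModule ℤ ℂ W)) (e : Fin 2 → ℤ) :
    hahnCoeff ((HahnSeries.C f : LaurentSeries (LaurentSeries ℂ)) • O) e =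
      ((HahnModule.of ℂ).symm ((f • ((HahnModule.of (LaurentSeries ℂ)).symm O).coeff (e 0) :
        HahnModule ℤ ℂ W))).coeff (e 1) := by
  have := HahnModule.coeff_single_smul' (R := LaurentSeries ℂ) (M := HahnModule ℤ ℂ W) 0 (e 0) f O
  rw [sub_zero] at this
  exact congrArg (fun z => ((HahnModule.of ℂ).symm z).coeff (e 1)) this

/-- Both sides are multiplicative in q, so it is enough to compare constants and the two variables.
The result allows inverses taken in the field to be undone by polynomials. -/
lemma hahnCoeff_iotaPoly_smul (q : MvPolynomial (Fin 2) ℂ)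
    (O : HahnModule ℤ (LaurentSeries ℂ) (HahnModule ℤ ℂ W)) :
    hahnCoeff (iotaPoly q • O) = act (shiftHom 0 1 q) (hahnCoeff O) := by
  have hx : ∀ O : HahnModule ℤ (LaurentSeries ℂ) (HahnModule ℤ ℂ W),
      hahnCoeff ((HahnSeries.C (HahnSeries.single (1 : ℤ) (1 : ℂ)) :
        LaurentSeries (LaurentSeries ℂ)) • O) = act (X 1) (hahnCoeff O) := by
    intro O
    funext e
    rw [hahnCoeff_C_smul, act_X]
    refine (HahnModule.coeff_single_smul' (R := ℂ) (M := W) 1 (e 1) 1 _).trans ?_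
    simp [hahnCoeff]
  have hx0 : ∀ O : HahnModule ℤ (LaurentSeries ℂ) (HahnModule ℤ ℂ W),
      hahnCoeff ((HahnSeries.single (1 : ℤ) 1 : LaurentSeries (LaurentSeries ℂ)) • O) =
        act (X 0) (hahnCoeff O) := by
    intro O
    funext e
    have := HahnModule.coeff_single_smul' (R := LaurentSeries ℂ) (M := HahnModule ℤ ℂ W) 1 (e 0)
      1 O
    refine (congrArg (fun z => ((HahnModule.of ℂ).symm z).coeff (e 1)) (this.trans
      (one_smul (LaurentSeries ℂ) (((HahnModule.of (LaurentSeries ℂ)).symm O).coeff (e 0 - 1) : HahnModule ℤ ℂ W)))).trans ?_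
    rw [act_X]
    simp [hahnCoeff]
  induction q using MvPolynomial.induction_on generalizing O with
  | C c =>
    rw [← algebraMap_eq, AlgHom.commutes, algebraMap_eq, act_C]
    funext e
    simp only [iotaPoly, coe_eval₂Hom, eval₂_C, RingHom.comp_apply]
    rw [hahnCoeff_C_smul, HahnSeries.C_apply]
    refine (HahnModule.coeff_single_smul' (R := ℂ) (M := W) 0 (e 1) c _).trans ?_
    rw [sub_zero]
    rfl
  | add p q hp hq =>
    rw [_root_.map_add iotaPoly, _root_.map_add (shiftHom 0 1), act_add, ← hp, ← hq,
      ← hahnCoeff_add]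
    exact congrArg hahnCoeff (add_smul (R := LaurentSeries (LaurentSeries ℂ)) _ _ O)
  | mul_X p k hp =>
    rw [_root_.map_mul iotaPoly, _root_.map_mul (shiftHom 0 1), act_mul]
    refine (congrArg hahnCoeff (mul_smul_hahn (iotaPoly p) (iotaPoly (X k)) O)).trans ?_
    refine (hp _).trans ?_
    congr 1
    simp only [iotaPoly, coe_eval₂Hom, eval₂_X]
    fin_cases k
    · simp only [Fin.zero_eta, Matrix.cons_val_zero]
      refine (congrArg hahnCoeff (add_smul (R := LaurentSeries (LaurentSeries ℂ)) _ _ O)).trans ?_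
      rw [hahnCoeff_add, hx, hx0, shiftHom_X_self, act_add, add_comm]
    · refine (hx O).trans ?_
      rw [Fin.mk_one, shiftHom_X_of_ne _ (by decide)]

lemma hahnSeries_bddBelow {M : Type*} [Zero M] (x : HahnSeries ℤ M) :
    ∃ N : ℤ, ∀ n < N, x.coeff n = 0 :=
  ⟨x.order, fun _ hn => HahnSeries.coeff_eq_zero_of_lt_order hn⟩

lemma isIterated_hahnCoeff (O : HahnModule ℤ (LaurentSeries ℂ) (HahnModule ℤ ℂ W)) :
    IsIterated 0 1 (hahnCoeff O) := by
  constructor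
  · obtain ⟨N, hN⟩ := hahnSeries_bddBelow ((HahnModule.of (LaurentSeries ℂ)).symm O)
    refine ⟨N, fun m hm => ?_⟩
    unfold hahnCoeff
    rw [hN _ hm]
    rfl
  · intro a
    obtain ⟨M, hM⟩ := hahnSeries_bddBelow
      ((HahnModule.of ℂ).symm (((HahnModule.of (LaurentSeries ℂ)).symm O).coeff a))
    refine ⟨M, fun m h1 h2 => ?_⟩
    unfold hahnCoeff
    rw [h1, hM _ h2]

/-- Otherwise the shifted polynomial, which is nonzero, would annihilate the constant series 1,
against `IsIterated.eq_zero`. -/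
lemma iotaPoly_ne_zero {p : MvPolynomial (Fin 2) ℂ} (hp : p ≠ 0) : iotaPoly p ≠ 0 := by
  intro h
  set O : HahnModule ℤ (LaurentSeries ℂ) (HahnModule ℤ ℂ ℂ) :=
    HahnModule.of _ (HahnSeries.single 0 (HahnModule.of _ (HahnSeries.single 0 1)))
  have h1 := hahnCoeff_iotaPoly_smul p O
  rw [h] at h1
  have h0 : hahnCoeff ((0 : LaurentSeries (LaurentSeries ℂ)) • O) = 0 :=
    (congrArg hahnCoeff (HahnModule.zero_smul' (R := LaurentSeries ℂ) (x := O))).trans rfl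
  rw [h0] at h1
  have h2 := (isIterated_hahnCoeff O).eq_zero zero_ne_one (shiftHom_ne_zero zero_ne_one hp)
    h1.symm
  have h3 := congrFun h2 0
  simp [hahnCoeff, O] at h3

/-- The element `(p a b w)(x + x_0, x)` of `W((x))[[x_0]]`. -/
def substHahn (F : (Fin 2 → ℤ) → W) (hF : IsLowerTruncated F) :
    HahnModule ℤ (LaurentSeries ℂ) (HahnModule ℤ ℂ W) :=
  HahnModule.of _ (HahnSeries.ofSuppBddBelow
    (fun i : ℤ => if 0 ≤ i then subst F hF i.toNat else 0) ⟨0, fun i hi => by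
      by_contra h
      exact hi (if_neg h)⟩)

lemma hahnCoeff_substHahn {F : (Fin 2 → ℤ) → W} (hF : IsLowerTruncated F) :
    hahnCoeff (substHahn F hF) = substSeries F := by
  funext e
  unfold hahnCoeff substHahn substSeries
  change ((HahnModule.of ℂ).symm (ite _ _ _)).coeff (e 1) = _
  split_ifs with h
  · rfl
  · rfl

/-- The Hahn series product runs over an antidiagonal. As the second factor has no negative powers
of x_0, that antidiagonal is indexed by t ∈ ℕ, which is the sum defining `opeCoeff`. -/
lemma coeff_smul_substHahn (c : LaurentSeries (LaurentSeries ℂ)) {F : (Fin 2 → ℤ) → W}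
    (hF : IsLowerTruncated F) (i : ℤ) :
    ((HahnModule.of (LaurentSeries ℂ)).symm (c • substHahn F hF)).coeff i =
      ∑ᶠ t : ℕ, (c.coeff (i - t) : LaurentSeries ℂ) • subst F hF t := by
  refine (HahnModule.coeff_smul (R := LaurentSeries ℂ) (V := HahnModule ℤ ℂ W) c _ i).trans ?_
  set S := ((HahnModule.of (LaurentSeries ℂ)).symm (substHahn F hF)) with hS
  have hS' : ∀ n : ℤ, S.coeff n = if 0 ≤ n then subst F hF n.toNat else 0 := fun n => rfl
  set D := Finset.VAddAntidiagonal i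
    (Set.VAddAntidiagonal.finite_of_isPWO c.isPWO_support S.isPWO_support i) with hD
  have hmem : ∀ q ∈ D, 0 ≤ q.2 ∧ q.1 + q.2 = i := by
    intro q hq
    rw [hD, Finset.mem_vaddAntidiagonal] at hq
    refine ⟨?_, hq.2.2⟩
    by_contra h
    exact hq.2.1 ((hS' _).trans (if_neg h))
  rw [finsum_eq_sum_of_support_subset (s := D.image fun q => q.2.toNat)]
  · rw [Finset.sum_image]
    · refine Finset.sum_congr rfl fun q hq => ?_
      obtain ⟨h1, h2⟩ := hmem q hq
      rw [hS', if_pos h1, show i - (q.2.toNat : ℤ) = q.1 by omega]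
    · intro q hq q' hq' h
      obtain ⟨h1, h2⟩ := hmem q hq
      obtain ⟨h1', h2'⟩ := hmem q' hq'
      simp only at h
      ext <;> omega
  · intro t ht
    simp only [Finset.coe_image, Set.mem_image, Finset.mem_coe]
    refine ⟨(i - t, t), ?_, by simp⟩
    rw [hD, Finset.mem_vaddAntidiagonal]
    refine ⟨fun h => ht ?_, fun h => ht ?_, by simp⟩
    · show _ • _ = _
      simp only at h
      rw [h]
      exact zero_smul (LaurentSeries ℂ) (A := HahnModule ℤ ℂ W) _
    · show _ • _ = _
      simp only [hS', Nat.cast_nonneg, if_true, Int.toNat_natCast] at h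
      rw [h]
      exact smul_zero (M := LaurentSeries ℂ) (A := HahnModule ℤ ℂ W) _

end Hahn

/-! ### The products a(x)_n b(x) as operator product coefficients -/

section Product

variable {W : Type*} [AddCommGroup W] [Module ℂ W]

/-- The products `a(x)_n b(x)` are the coefficients of the operator product of `a(x_1) b(x)`. -/
theorem isOPE_nthProduct {a b : E W} (h : ∃ p : MvPolynomial (Fin 2) ℂ, p ≠ 0 ∧ ClearsPoles p a b)
    (w : W) :
    IsOPE (fieldProd ![a, b] w) (fun e => cf (nthProduct a b (-e 0 - 1)) (e 1) w) := by
  set p := h.choose with hp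
  obtain ⟨hp0, hc⟩ : p ≠ 0 ∧ ClearsPoles p a b := h.choose_spec
  set B := fieldProd ![a, b] w
  set O := (iotaPoly p)⁻¹ • substHahn (polyMul p B) (hc w) with hO
  have hA : (fun e => cf (nthProduct a b (-e 0 - 1)) (e 1) w) = hahnCoeff O := by
    funext e
    unfold nthProduct
    rw [dif_pos h]
    have := coeff_smul_substHahn (iotaPoly p)⁻¹ (hc w) (e 0)
    unfold hahnCoeff
    rw [hO, this]
    show ((HahnModule.of ℂ).symm (opeCoeff p a b hc (-(-e 0 - 1) - 1) w)).coeff (e 1) = _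
    rw [show -(-e 0 - 1) - 1 = e 0 by ring]
    rfl
  -- Multiplying by p(x + x_0, x) cancels the inverse in the definition of the products.
  have hpO : act (shiftHom 0 1 p) (hahnCoeff O) = substSeries (act p B) := by
    rw [← hahnCoeff_iotaPoly_smul, hO, ← polyMul_eq_act, ← hahnCoeff_substHahn (hc w)]
    refine congrArg hahnCoeff ?_
    refine (mul_smul_hahn _ _ _).symm.trans ?_
    refine (congrArg (fun c : LaurentSeries (LaurentSeries ℂ) => c • substHahn (polyMul p B) (hc w))
      (Field.mul_inv_cancel _ (iotaPoly_ne_zero hp0))).trans ?_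
    exact one_smul (LaurentSeries (LaurentSeries ℂ)) (substHahn (polyMul p B) (hc w))
  have hlt : IsLowerTruncated (act p B) := by
    rw [← polyMul_eq_act]
    exact hc w
  -- A further monomial turns p B into a power series, for which `substSeries` and `translate`
  -- agree.
  obtain ⟨N, hN⟩ := isLowerTruncated_iff.mp hlt
  rw [Fin.prod_univ_two, mul_pow] at hN
  refine ⟨hA ▸ isIterated_hahnCoeff O, X 0 ^ N * X 1 ^ N * p, ?_, ?_, ?_⟩
  · exact mul_ne_zero (mul_ne_zero (pow_ne_zero _ (X_ne_zero _)) (pow_ne_zero _ (X_ne_zero _))) hp0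
  · rwa [act_mul]
  · rw [hA, act_mul, ← substSeries_of_isPower hN, substSeries_act hlt, ← hpO, ← act_mul,
      ← _root_.map_mul (shiftHom 0 1)]

end Product

/-! ### The total derivative -/

/-- The derivation `∑ ∂/∂x_i` of polynomials. -/
def totalDeriv {ι : Type*} : Derivation ℂ (MvPolynomial ι ℂ) (MvPolynomial ι ℂ) :=
  mkDerivation ℂ fun _ => 1

lemma totalDeriv_X {ι : Type*} (i : ι) : totalDeriv (X i : MvPolynomial ι ℂ) = 1 :=
  mkDerivation_X _ _ _

section Derivation

variable {ι V : Type*} [Fintype ι] [DecidableEq ι] [AddCommGroup V] [Module ℂ V]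

/-- The operator `∑ ∂/∂x_i` on formal series. -/
def seriesDeriv : Module.End ℂ ((ι → ℤ) → V) where
  toFun F m := ∑ k, ((m k + 1 : ℤ) : ℂ) • F (Function.update m k (m k + 1))
  map_add' F G := by
    funext m
    simp [Finset.sum_add_distrib]
  map_smul' c F := by
    funext m
    simp [Finset.smul_sum, smul_comm c]

lemma seriesDeriv_apply (F : (ι → ℤ) → V) (m : ι → ℤ) :
    seriesDeriv F m = ∑ k, ((m k + 1 : ℤ) : ℂ) • F (Function.update m k (m k + 1)) := rfl

lemma seriesDeriv_act_X (i : ι) (F : (ι → ℤ) → V) :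
    seriesDeriv (act (X i) F) = F + act (X i) (seriesDeriv F) := by
  funext m
  rw [Pi.add_apply, act_X, seriesDeriv_apply, seriesDeriv_apply,
    ← Finset.add_sum_erase _ _ (Finset.mem_univ i), ← Finset.add_sum_erase _ _ (Finset.mem_univ i),
    ← add_assoc]
  congr 1
  · rw [act_X]
    have h1 : Function.update (Function.update m i (m i + 1)) i
        (Function.update m i (m i + 1) i - 1) = m := by simp
    have h2 : Function.update (Function.update m i (m i - 1)) i
        (Function.update m i (m i - 1) i + 1) = m := by simp
    rw [h1, h2]
    simp only [Function.update_self, sub_add_cancel]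
    push_cast
    rw [add_smul, one_smul, add_comm]
  · refine Finset.sum_congr rfl fun k hk => ?_
    have hki := Finset.ne_of_mem_erase hk
    rw [act_X, Function.update_of_ne hki, Function.update_of_ne hki.symm,
      Function.update_comm hki.symm]

lemma seriesDeriv_act (p : MvPolynomial ι ℂ) (F : (ι → ℤ) → V) :
    seriesDeriv (act p F) = act (totalDeriv p) F + act p (seriesDeriv F) := by
  induction p using MvPolynomial.induction_on generalizing F with
  | C c =>
    rw [act_C, act_C, ← algebraMap_eq, Derivation.map_algebraMap, map_smul]
    simp
  | add p q hp hq =>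
    rw [act_add, map_add, map_add totalDeriv, act_add, act_add, hp, hq]
    abel
  | mul_X p k hp =>
    rw [act_mul, hp, Derivation.leibniz, totalDeriv_X, seriesDeriv_act_X, act_add, map_add,
      smul_eq_mul, mul_one, smul_eq_mul, act_mul, act_mul, act_comm (X k)]
    abel

lemma IsLowerTruncated.seriesDeriv {r : ℕ} {F : (Fin r → ℤ) → V} (hF : IsLowerTruncated F) :
    IsLowerTruncated (seriesDeriv F) := by
  obtain ⟨N, hN⟩ := hF
  refine ⟨N - 1, fun m ⟨i, hi⟩ => ?_⟩
  rw [seriesDeriv_apply]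
  refine Finset.sum_eq_zero fun k _ => ?_
  rw [hN _ ⟨i, ?_⟩, smul_zero]
  rcases eq_or_ne i k with rfl | h
  · simp; omega
  · simp [h]; omega

/-- A lower truncated series whose total derivative is computed by a linear operator on the
coefficients has no negative powers. -/
lemma IsLowerTruncated.isPower_of_seriesDeriv {r : ℕ} {F : (Fin r → ℤ) → V}
    (hF : IsLowerTruncated F) (L : Module.End ℂ V)
    (h : FormalVA.seriesDeriv F = fun m => L (F m)) : IsPower F := by
  obtain ⟨N, hN⟩ := hF
  rintro m ⟨i, hi⟩
  -- Induction on the exponent of x_i. The equation at exponent m i - 1 involves, besides (m i) • F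
  -- m, only coefficients whose x_i-exponent is m i - 1, and these vanish by induction. As m i < 0,
  -- the scalar is invertible.
  have key : ∀ t : ℕ, N + t ≤ 0 → ∀ m : Fin r → ℤ, m i < N + t → F m = 0 := by
    intro t
    induction t with
    | zero => exact fun _ m hm => hN m ⟨i, by simpa using hm⟩
    | succ t ih =>
      intro ht m hm
      push_cast at ht hm
      rcases lt_or_ge (m i) (N + t) with h1 | h1
      · exact ih (by omega) m h1
      have h2 := congrFun h (Function.update m i (m i - 1))
      rw [ih (by omega) (Function.update m i (m i - 1)) (by simp; omega), map_zero,
        seriesDeriv_apply, Finset.sum_eq_single i] at h2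
      · simp only [Function.update_self, sub_add_cancel, Function.update_idem,
          Function.update_eq_self] at h2
        exact (smul_eq_zero.mp h2).resolve_left (by exact_mod_cast (by omega : m i ≠ 0))
      · intro k _ hk
        rw [ih (by omega), smul_zero]
        simp [hk.symm]
        omega
      · simp
  rcases le_or_gt N 0 with hN0 | hN0
  · exact key (-N).toNat (by omega) m (by omega)
  · exact hN m ⟨i, by omega⟩

end Derivation

/-! ### Polynomials in differences of variables -/

section DifferencePolynomials

variable {ι : Type*}

/-- The monoid of products of nonzero constants and nonzero polynomials in differences of
variables. -/
def diffMonoid (ι : Type*) : Submonoid (MvPolynomial ι ℂ) :=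
  Submonoid.closure {P | (∃ c : ℂ, c ≠ 0 ∧ P = C c) ∨
    ∃ (i j : ι) (g : Polynomial ℂ), i ≠ j ∧ g ≠ 0 ∧ P = Polynomial.aeval (X i - X j) g}

lemma C_mem_diffMonoid {c : ℂ} (hc : c ≠ 0) : (C c : MvPolynomial ι ℂ) ∈ diffMonoid ι :=
  Submonoid.subset_closure (Or.inl ⟨c, hc, rfl⟩)

lemma aeval_mem_diffMonoid {i j : ι} (hij : i ≠ j) {g : Polynomial ℂ} (hg : g ≠ 0) :
    Polynomial.aeval (X i - X j : MvPolynomial ι ℂ) g ∈ diffMonoid ι :=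
  Submonoid.subset_closure (Or.inr ⟨i, j, g, hij, hg, rfl⟩)

lemma diffMonoid_induction {motive : MvPolynomial ι ℂ → Prop}
    (hC : ∀ c : ℂ, c ≠ 0 → motive (C c))
    (hX : ∀ (i j : ι) (g : Polynomial ℂ), i ≠ j → g ≠ 0 →
      motive (Polynomial.aeval (X i - X j : MvPolynomial ι ℂ) g))
    (hmul : ∀ P Q, motive P → motive Q → motive (P * Q)) {P : MvPolynomial ι ℂ}
    (hP : P ∈ diffMonoid ι) : motive P := by
  refine Submonoid.closure_induction (fun P hP => ?_) ?_ (fun P Q _ _ h h' => hmul P Q h h') hP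
  · rcases hP with ⟨c, hc, rfl⟩ | ⟨i, j, g, hij, hg, rfl⟩
    · exact hC c hc
    · exact hX i j g hij hg
  · rw [← C_1]
    exact hC 1 one_ne_zero

lemma aeval_X_sub_X_ne_zero {i j : ι} (hij : i ≠ j) {g : Polynomial ℂ} (hg : g ≠ 0) :
    Polynomial.aeval (X i - X j : MvPolynomial ι ℂ) g ≠ 0 := by
  classical
  intro h
  have := congrArg (MvPolynomial.aeval fun k => if k = i then (Polynomial.X : Polynomial ℂ) else 0)
    h
  rw [← Polynomial.aeval_algHom_apply] at this
  simp [hij.symm, hg] at this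

lemma ne_zero_of_mem_diffMonoid {P : MvPolynomial ι ℂ} (hP : P ∈ diffMonoid ι) : P ≠ 0 :=
  diffMonoid_induction (motive := fun P => P ≠ 0) (fun _ hc => by simpa using hc)
    (fun _ _ _ hij hg => aeval_X_sub_X_ne_zero hij hg) (fun _ _ => mul_ne_zero) hP

lemma rename_mem_diffMonoid {κ : Type*} {f : ι → κ} (hf : Function.Injective f)
    {P : MvPolynomial ι ℂ} (hP : P ∈ diffMonoid ι) : rename f P ∈ diffMonoid κ := by
  refine diffMonoid_induction (motive := fun P => rename f P ∈ diffMonoid κ) (fun c hc => ?_)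
    (fun i j g hij hg => ?_) (fun P Q h h' => ?_) hP
  · rw [rename_C]
    exact C_mem_diffMonoid hc
  · rw [← Polynomial.aeval_algHom_apply, map_sub, rename_X, rename_X]
    exact aeval_mem_diffMonoid (hf.ne hij) hg
  · rw [map_mul]
    exact mul_mem h h'

lemma totalDeriv_of_mem_diffMonoid {P : MvPolynomial ι ℂ} (hP : P ∈ diffMonoid ι) :
    totalDeriv P = 0 := by
  refine diffMonoid_induction (motive := fun P => totalDeriv P = 0) (fun c _ => ?_)
    (fun i j g _ _ => ?_) (fun P Q h h' => ?_) hP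
  · rw [← algebraMap_eq, Derivation.map_algebraMap]
  · rw [Derivation.map_aeval, map_sub, totalDeriv_X, totalDeriv_X, sub_self, smul_zero]
  · rw [Derivation.leibniz, h, h', smul_zero, smul_zero, add_zero]

lemma totalDeriv_rename {κ : Type*} (f : ι → κ) (p : MvPolynomial ι ℂ) :
    totalDeriv (rename f p) = rename f (totalDeriv p) := by
  induction p using MvPolynomial.induction_on with
  | C c =>
    rw [rename_C, ← algebraMap_eq, Derivation.map_algebraMap, ← algebraMap_eq,
      Derivation.map_algebraMap, map_zero]
  | add p q hp hq => simp only [map_add, hp, hq]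
  | mul_X p k hp =>
    rw [map_mul, Derivation.leibniz, Derivation.leibniz, hp, rename_X, totalDeriv_X, totalDeriv_X]
    simp [mul_comm]

/-- `ℂ[s][y] → ℂ[x_0, x_1]`, `s ↦ x_0 - x_1`, `y ↦ x_1`. -/
def diffHom : Polynomial (Polynomial ℂ) →+* MvPolynomial (Fin 2) ℂ :=
  Polynomial.eval₂RingHom (Polynomial.aeval (X 0 - X 1 : MvPolynomial (Fin 2) ℂ)).toRingHom (X 1)

lemma diffHom_C (g : Polynomial ℂ) :
    diffHom (Polynomial.C g) = Polynomial.aeval (X 0 - X 1 : MvPolynomial (Fin 2) ℂ) g := by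
  simp [diffHom]

lemma diffHom_X : diffHom Polynomial.X = X 1 := by simp [diffHom]

lemma diffHom_surjective : Function.Surjective diffHom := by
  intro p
  induction p using MvPolynomial.induction_on with
  | C c => exact ⟨Polynomial.C (Polynomial.C c), by rw [diffHom_C, Polynomial.aeval_C]; rfl⟩
  | add p q hp hq =>
    obtain ⟨a, rfl⟩ := hp
    obtain ⟨b, rfl⟩ := hq
    exact ⟨a + b, map_add _ _ _⟩
  | mul_X p k hp =>
    obtain ⟨a, rfl⟩ := hp
    obtain rfl | rfl : k = 0 ∨ k = 1 := by omega
    · refine ⟨a * (Polynomial.C Polynomial.X + Polynomial.X), ?_⟩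
      rw [map_mul, map_add, diffHom_C, diffHom_X, Polynomial.aeval_X, sub_add_cancel]
    · exact ⟨a * Polynomial.X, by rw [map_mul, diffHom_X]⟩

lemma totalDeriv_diffHom (P : Polynomial (Polynomial ℂ)) :
    totalDeriv (diffHom P) = diffHom (Polynomial.derivative P) := by
  induction P using Polynomial.induction_on' with
  | add p q hp hq => simp only [map_add, hp, hq]
  | monomial n g =>
    rw [← Polynomial.C_mul_X_pow_eq_monomial, map_mul, map_pow, diffHom_C, diffHom_X,
      Derivation.leibniz, Derivation.leibniz_pow, totalDeriv_X, Derivation.map_aeval, map_sub,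
      totalDeriv_X, totalDeriv_X, Polynomial.derivative_C_mul_X_pow, map_mul, diffHom_C, map_pow,
      diffHom_X]
    simp
    ring

/-- In the coordinates s = x_0 - x_1 and y = x_1 the derivation is ∂/∂y. Applied as often as the
degree n in y, it leaves n! times the leading coefficient, a nonzero polynomial in s. -/
lemma exists_iterate_totalDeriv {p : MvPolynomial (Fin 2) ℂ} (hp : p ≠ 0) :
    ∃ (n : ℕ) (g : Polynomial ℂ), g ≠ 0 ∧
      totalDeriv^[n] p = Polynomial.aeval (X 0 - X 1 : MvPolynomial (Fin 2) ℂ) g := by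
  obtain ⟨P, rfl⟩ := diffHom_surjective p
  have hP : P ≠ 0 := fun h => hp (by rw [h, map_zero])
  have hit : ∀ n, totalDeriv^[n] (diffHom P) = diffHom (Polynomial.derivative^[n] P) := by
    intro n
    induction n with
    | zero => rfl
    | succ n ih => rw [Function.iterate_succ_apply', ih, totalDeriv_diffHom,
        Function.iterate_succ_apply']
  have hdeg : (Polynomial.derivative^[P.natDegree] P).natDegree = 0 := by
    have := Polynomial.natDegree_iterate_derivative P P.natDegree
    omega
  refine ⟨P.natDegree, (Polynomial.derivative^[P.natDegree] P).coeff 0, ?_, ?_⟩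
  · rw [Polynomial.coeff_iterate_derivative, zero_add, Polynomial.coeff_natDegree]
    refine smul_ne_zero ?_ (by simpa using hP)
    exact fun h => absurd h (by simp [Nat.descFactorial_self, Nat.factorial_ne_zero])
  · rw [hit, ← diffHom_C, ← Polynomial.eq_C_of_natDegree_eq_zero hdeg]

lemma exists_iterate_totalDeriv_rename {i j : ι} (hij : i ≠ j) {p : MvPolynomial (Fin 2) ℂ}
    (hp : p ≠ 0) : ∃ n : ℕ, totalDeriv^[n] (rename ![i, j] p) ∈ diffMonoid ι := by
  obtain ⟨n, g, hg, h⟩ := exists_iterate_totalDeriv hp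
  have hit : ∀ n, totalDeriv^[n] (rename ![i, j] p) = rename ![i, j] (totalDeriv^[n] p) := by
    intro n
    induction n with
    | zero => rfl
    | succ n ih => rw [Function.iterate_succ_apply', ih, totalDeriv_rename,
        Function.iterate_succ_apply']
  refine ⟨n, ?_⟩
  rw [hit, h, ← Polynomial.aeval_algHom_apply, map_sub, rename_X, rename_X]
  exact aeval_mem_diffMonoid hij hg

/-- An ideal stable under `∑ ∂/∂x_i` which contains a product of polynomials in two variables
contains a product of polynomials in differences of variables. -/
lemma exists_mem_diffMonoid {I : Ideal (MvPolynomial ι ℂ)} (hI : ∀ P ∈ I, totalDeriv P ∈ I)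
    {p : MvPolynomial (Fin 2) ℂ} (hp : p ≠ 0) {α : Type*} (s : Finset α) (f : α → ι × ι)
    (hf : ∀ a ∈ s, (f a).1 ≠ (f a).2)
    (h : ∏ a ∈ s, rename ![(f a).1, (f a).2] p ∈ I) : ∃ G ∈ diffMonoid ι, G ∈ I := by
  classical
  -- Writing P', Q' for the current factors, (DP') Q'^2 = Q' D(P'Q') - (DQ') P'Q' lies in I. The
  -- exponent of Q doubles each time.
  have hstep : ∀ (n : ℕ) (P Q : MvPolynomial ι ℂ), P * Q ∈ I →
      totalDeriv^[n] P * Q ^ 2 ^ n ∈ I := by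
    intro n P Q hPQ
    induction n with
    | zero => simpa using hPQ
    | succ n ih =>
      rw [Function.iterate_succ_apply', pow_succ 2, pow_mul]
      set P' := totalDeriv^[n] P
      set Q' := Q ^ 2 ^ n
      have h1 := I.mul_mem_left Q' (hI _ ih)
      have h2 := I.mul_mem_left (totalDeriv Q') ih
      rw [Derivation.leibniz, smul_eq_mul, smul_eq_mul] at h1
      convert I.sub_mem h1 h2 using 1
      ring
  -- The factors are treated one at a time. G collects the difference polynomials already obtained,
  -- and M absorbs the growing power of the factors still untreated.
  have main : ∀ (s : Finset α), (∀ a ∈ s, (f a).1 ≠ (f a).2) → ∀ (G : MvPolynomial ι ℂ),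
      G ∈ diffMonoid ι → ∀ M : ℕ, G * (∏ a ∈ s, rename ![(f a).1, (f a).2] p) ^ M ∈ I →
      ∃ G ∈ diffMonoid ι, G ∈ I := by
    intro s
    induction s using Finset.induction_on with
    | empty => exact fun _ G hG M h => ⟨G, hG, by simpa using h⟩
    | insert a s ha ih =>
      intro hs G hG M h
      rw [Finset.prod_insert ha, mul_pow, mul_left_comm, ← map_pow] at h
      obtain ⟨n, hn⟩ := exists_iterate_totalDeriv_rename (hs a (Finset.mem_insert_self a s))
        (pow_ne_zero M hp)
      have := hstep n _ _ h
      rw [mul_pow, ← mul_assoc, ← pow_mul] at this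
      exact ih (fun b hb => hs b (Finset.mem_insert_of_mem hb)) _ (mul_mem hn (pow_mem hG _)) _ this
  exact main s hf 1 (one_mem _) 1 (by simpa using h)

end DifferencePolynomials

/-! ### Products of fields with named variables -/

section NamedProducts

variable {ι V : Type*} [AddCommGroup V] [Module ℂ V]

/-- The product `a_1(x_{i_1}) ⋯ a_r(x_{i_r}) w` for a list of pairs `(i_k, a_k)`. -/
def namedProd (l : List (ι × E V)) (w : V) : (ι → ℤ) → V :=
  fun m => (l.map fun p => cf p.2 (m p.1)).prod w

lemma namedProd_cons (p : ι × E V) (l : List (ι × E V)) (w : V) (m : ι → ℤ) :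
    namedProd (p :: l) w m = cf p.2 (m p.1) (namedProd l w m) := by
  simp [namedProd]

lemma namedProd_append (l l' : List (ι × E V)) (w : V) (m : ι → ℤ) :
    namedProd (l ++ l') w m = (l.map fun p => cf p.2 (m p.1)).prod (namedProd l' w m) := by
  simp [namedProd]

/-- Every variable occurs exactly once. -/
structure IsNaming (l : List (ι × E V)) : Prop where
  nodup : (l.map Prod.fst).Nodup
  mem : ∀ i, i ∈ l.map Prod.fst

lemma namedProd_update_of_notMem [DecidableEq ι] {l : List (ι × E V)} {i : ι}
    (hi : i ∉ l.map Prod.fst) (w : V) (m : ι → ℤ) (a : ℤ) :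
    namedProd l w (Function.update m i a) = namedProd l w m := by
  unfold namedProd
  congr 2
  refine List.map_congr_left fun p hp => ?_
  rw [Function.update_of_ne]
  rintro rfl
  exact hi (List.mem_map_of_mem hp)

/-- The list `l` read in other variables. -/
def renameList {κ : Type*} (f : ι → κ) (l : List (ι × E V)) : List (κ × E V) :=
  l.map (Prod.map f id)

lemma namedProd_renameList {κ : Type*} (f : ι → κ) (l : List (ι × E V)) (w : V) (m : κ → ℤ) :
    namedProd (renameList f l) w m = namedProd l w (m ∘ f) := by
  simp [namedProd, renameList, Function.comp_def]

lemma map_snd_renameList {κ : Type*} (f : ι → κ) (l : List (ι × E V)) :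
    (renameList f l).map Prod.snd = l.map Prod.snd := by
  simp [renameList]

lemma map_fst_renameList {κ : Type*} (f : ι → κ) (l : List (ι × E V)) :
    (renameList f l).map Prod.fst = (l.map Prod.fst).map f := by
  simp [renameList]

/-- Two namings of one list of fields differ by a bijection of variables, matched through positions
in the list. Rationality therefore does not depend on the naming. -/
lemma IsNaming.exists_equiv [DecidableEq ι] {κ : Type*} [DecidableEq κ] {l : List (ι × E V)}
    {l' : List (κ × E V)} (hl : IsNaming l) (hl' : IsNaming l')
    (h : l.map Prod.snd = l'.map Prod.snd) : ∃ σ : ι ≃ κ, l' = renameList σ l := by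
  have hlen : l.length = l'.length := by simpa using congrArg List.length h
  let e1 := hl.nodup.getEquivOfForallMemList _ hl.mem
  let e2 := hl'.nodup.getEquivOfForallMemList _ hl'.mem
  refine ⟨(e1.symm.trans (finCongr (by simpa using hlen))).trans e2, ?_⟩
  refine List.ext_getElem (by simp [renameList, hlen]) fun n h1 h2 => ?_
  have hn : n < l.length := by omega
  have h3 : e1.symm l[n].1 = ⟨n, by simpa using hn⟩ := by
    rw [Equiv.symm_apply_eq]
    simp [e1]
  have h4 : l[n].2 = l'[n].2 := by
    have := List.getElem_of_eq h (i := n) (by simpa using hn)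
    simpa using this
  ext
  · simp [renameList, h3, e2]
  · simp [renameList, h4]

section Bracket

variable [DecidableEq ι] {one : V} {L : Module.End ℂ V}

/-- The Leibniz rule for the commutator with L along the product. Distinctness of the variables
ensures that shifting one exponent affects one factor only. -/
lemma translation_namedProd {l : List (ι × E V)} (hnd : (l.map Prod.fst).Nodup)
    (hl : ∀ p ∈ l, ∀ m : ℤ, ⁅L, cf p.2 m⁆ = ((m + 1 : ℤ) : ℂ) • cf p.2 (m + 1)) (w : V)
    (m : ι → ℤ) :
    L (namedProd l w m) = namedProd l (L w) m + ((l.map Prod.fst).map fun k =>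
      ((m k + 1 : ℤ) : ℂ) • namedProd l w (Function.update m k (m k + 1))).sum := by
  induction l with
  | nil => simp [namedProd]
  | cons p l ih =>
    simp only [List.map_cons, List.nodup_cons] at hnd
    have h1 := LinearMap.congr_fun (hl p List.mem_cons_self (m p.1)) (namedProd l w m)
    rw [Ring.lie_def, LinearMap.sub_apply, Module.End.mul_apply, Module.End.mul_apply,
      sub_eq_iff_eq_add] at h1
    rw [namedProd_cons, h1, ih hnd.2 fun q hq => hl q (List.mem_cons_of_mem _ hq), map_add,
      List.map_cons, List.map_cons, List.sum_cons, namedProd_cons, namedProd_cons,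
      Function.update_self, namedProd_update_of_notMem hnd.1, LinearMap.smul_apply,
      map_list_sum, List.map_map]
    have h2 : (l.map Prod.fst).map (⇑(cf p.2 (m p.1)) ∘ fun k =>
        ((m k + 1 : ℤ) : ℂ) • namedProd l w (Function.update m k (m k + 1))) =
        (l.map Prod.fst).map fun k => ((m k + 1 : ℤ) : ℂ) •
          namedProd (p :: l) w (Function.update m k (m k + 1)) := by
      refine List.map_congr_left fun k hk => ?_
      have hpk : p.1 ≠ k := fun h => hnd.1 (h ▸ hk)
      simp only [Function.comp_apply, map_smul, namedProd_cons, Function.update_of_ne hpk]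
    rw [h2]
    abel

lemma IsNaming.seriesDeriv_namedProd [Fintype ι] {l : List (ι × E V)} (hl : IsNaming l)
    (hL : ∀ p ∈ l, ∀ m : ℤ, ⁅L, cf p.2 m⁆ = ((m + 1 : ℤ) : ℂ) • cf p.2 (m + 1)) (w : V) :
    seriesDeriv (namedProd l w) = (fun m => L (namedProd l w m)) - namedProd l (L w) := by
  funext m
  rw [Pi.sub_apply, translation_namedProd hl.nodup hL, add_sub_cancel_left,
    ← List.sum_toFinset _ hl.nodup, Finset.eq_univ_of_forall (fun i => List.mem_toFinset.mpr
      (hl.mem i)), seriesDeriv_apply]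

end Bracket

end NamedProducts

/-! ### Rationality of quasi compatible products -/

section GloballyRational

variable {V : Type*} [AddCommGroup V] [Module ℂ V]

/-- The product of `l` becomes lower truncated, and a power series at the vacuum, after
multiplication with a product of polynomials in differences of the variables. -/
def IsRationalNamed (one : V) {n : ℕ} (l : List (Fin n × E V)) : Prop :=
  ∃ P ∈ diffMonoid (Fin n), (∀ w, IsLowerTruncated (act P (namedProd l w))) ∧
    IsPower (act P (namedProd l one))

lemma IsRationalNamed.rename {one : V} {n : ℕ} {l : List (Fin n × E V)}
    (h : IsRationalNamed one l) {n' : ℕ} (σ : Fin n ≃ Fin n') :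
    IsRationalNamed one (renameList σ l) := by
  obtain rfl : n = n' := by simpa using Fintype.card_congr σ
  obtain ⟨P, hP, h1, h2⟩ := h
  have key : ∀ w, act (MvPolynomial.rename σ P) (namedProd (renameList σ l) w) =
      fun m => act P (namedProd l w) fun i => m (σ i) := by
    intro w
    rw [← act_rename]
    congr 1
    funext m
    exact namedProd_renameList _ _ _ _
  refine ⟨MvPolynomial.rename σ P, rename_mem_diffMonoid σ.injective hP, fun w => ?_, ?_⟩
  · obtain ⟨N, hN⟩ := h1 w
    rw [key]
    exact ⟨N, fun m ⟨i, hi⟩ => hN _ ⟨σ.symm i, by simpa using hi⟩⟩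
  · rw [key]
    exact fun m ⟨i, hi⟩ => h2 _ ⟨σ.symm i, by simpa using hi⟩

/-- The product of the fields in the list is rational, in some naming of its variables. -/
def IsRational (one : V) (l : List (E V)) : Prop :=
  ∃ (n : ℕ) (l' : List (Fin n × E V)), IsNaming l' ∧ l'.map Prod.snd = l ∧ IsRationalNamed one l'

lemma IsRational.named {one : V} {n : ℕ} {l : List (Fin n × E V)} (hl : IsNaming l)
    (h : IsRational one (l.map Prod.snd)) : IsRationalNamed one l := by
  obtain ⟨n', l', h1, h2, h3⟩ := h
  obtain ⟨σ, rfl⟩ := h1.exists_equiv hl h2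
  exact h3.rename σ

/-- The standard naming of a list. -/
def stdNaming (l : List (E V)) : List (Fin l.length × E V) := List.ofFn fun i => (i, l.get i)

lemma isNaming_stdNaming (l : List (E V)) : IsNaming (stdNaming l) := by
  constructor
  · rw [stdNaming, List.map_ofFn]
    exact List.nodup_ofFn.mpr fun _ _ h => h
  · intro i
    rw [stdNaming, List.map_ofFn, List.mem_ofFn]
    exact ⟨i, rfl⟩

lemma map_snd_stdNaming (l : List (E V)) : (stdNaming l).map Prod.snd = l := by
  rw [stdNaming, List.map_ofFn]
  exact List.ofFn_get l

lemma exists_naming (l : List (E V)) :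
    ∃ (n : ℕ) (l' : List (Fin n × E V)), IsNaming l' ∧ l'.map Prod.snd = l :=
  ⟨_, _, isNaming_stdNaming l, map_snd_stdNaming l⟩

/-- Translation covariance reduces the given poles to poles in differences of variables; invariance
of the vacuum then removes the poles along the coordinate hyperplanes at `one`. -/
theorem isRational_of_quasiCompatible {one : V} {L : Module.End ℂ V} (hL_one : L one = 0)
    {S : Set (E V)} (hL : ∀ a ∈ S, ∀ m : ℤ, ⁅L, cf a m⁆ = ((m + 1 : ℤ) : ℂ) • cf a (m + 1))
    (hS : QuasiCompatible S) {l : List (E V)} (hl : ∀ a ∈ l, a ∈ S) : IsRational one l := by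
  refine ⟨_, _, isNaming_stdNaming l, map_snd_stdNaming l, ?_⟩
  obtain ⟨p, hp, hpl⟩ := hS l.length l.get fun i => hl _ (List.get_mem l i)
  have hT : ∀ w, fieldProd l.get w = namedProd (stdNaming l) w := by
    intro w
    funext m
    rw [stdNaming, namedProd, List.map_ofFn]
    rfl
  have hLl : ∀ q ∈ stdNaming l, ∀ m : ℤ, ⁅L, cf q.2 m⁆ = ((m + 1 : ℤ) : ℂ) • cf q.2 (m + 1) := by
    intro q hq
    have := List.mem_map_of_mem (f := Prod.snd) hq
    rw [map_snd_stdNaming] at this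
    exact hL _ (hl _ this)
  -- Truncation is asked for all w together, because the derivative of the product at w involves the
  -- product at L w.
  let I : Ideal (MvPolynomial (Fin l.length) ℂ) :=
    { carrier := {P | ∀ w, IsLowerTruncated (act P (namedProd (stdNaming l) w))}
      add_mem' := fun ha hb w => by
        rw [act_add]
        exact (ha w).add (hb w)
      zero_mem' := fun w => by
        rw [map_zero]
        exact IsPower.zero.isLowerTruncated
      smul_mem' := fun c P hP w => by
        rw [smul_eq_mul, act_mul]
        exact (hP w).act c }
  have hderiv := fun w => (isNaming_stdNaming l).seriesDeriv_namedProd hLl w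
  have hI : ∀ P ∈ I, totalDeriv P ∈ I := by
    intro P hP w
    have h1 := seriesDeriv_act P (namedProd (stdNaming l) w)
    rw [← sub_eq_iff_eq_add] at h1
    rw [← h1, hderiv, map_sub, act_map]
    exact (hP w).seriesDeriv.sub (((hP w).map L).sub (hP (L w)))
  obtain ⟨G, hG, hGI⟩ := exists_mem_diffMonoid (I := I) hI hp
    (Finset.univ.sigma fun i : Fin l.length => Finset.Ioi i) (fun a => (a.1, a.2))
    (fun a ha => by
      simp only [Finset.mem_sigma, Finset.mem_Ioi] at ha
      exact ha.2.ne)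
    (by
      rw [Finset.prod_sigma]
      intro w
      rw [← hT, ← polyMul_eq_act]
      exact hpl w)
  -- Since DG = 0 and L one = 0, the derivative of G times the product at `one` is L applied to it.
  refine ⟨G, hG, hGI, (hGI one).isPower_of_seriesDeriv L ?_⟩
  rw [seriesDeriv_act, totalDeriv_of_mem_diffMonoid hG, hderiv, hL_one]
  have h0 : namedProd (stdNaming l) (0 : V) = 0 := by
    funext m
    exact map_zero _
  rw [h0, sub_zero, act_map, map_zero]
  exact zero_add _

end GloballyRational

/-! ### Inserting the identity field -/

section Insertion

variable {V : Type*} [AddCommGroup V] [Module ℂ V]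

lemma act_rename_succ {n : ℕ} (p : MvPolynomial (Fin n) ℂ) (F : (Fin (n + 1) → ℤ) → V) (a : ℤ)
    (m : Fin n → ℤ) :
    act (rename Fin.succ p) F (Fin.cons a m : Fin (n + 1) → ℤ) =
      act p (fun t => F (Fin.cons a t : Fin (n + 1) → ℤ)) m := by
  induction p using MvPolynomial.induction_on generalizing m with
  | C c => simp
  | add p q hp hq => rw [map_add, act_add, act_add, Pi.add_apply, Pi.add_apply, hp, hq]
  | mul_X p k hp =>
    rw [map_mul, rename_X, mul_comm, act_mul, mul_comm, act_mul, act_X, act_X, Fin.cons_succ,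
      ← Fin.cons_update, hp]

lemma IsNaming.insert_zero {n : ℕ} {l₁ l₂ : List (Fin n × E V)} (h : IsNaming (l₁ ++ l₂)) (c : E V) :
    IsNaming (renameList Fin.succ l₁ ++ (0, c) :: renameList Fin.succ l₂) := by
  obtain ⟨h1, h2⟩ := h
  constructor
  · rw [List.map_append, List.map_cons, List.nodup_middle, map_fst_renameList, map_fst_renameList,
      ← List.map_append, ← List.map_append, List.nodup_cons]
    exact ⟨by simp, h1.map (Fin.succ_injective n)⟩
  · intro i
    simp only [List.map_append, List.map_cons, List.mem_append, List.mem_cons, map_fst_renameList]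
    induction i using Fin.cases with
    | zero => simp
    | succ i =>
      have := h2 i
      rw [List.map_append, List.mem_append] at this
      rcases this with h | h
      · exact Or.inl (List.mem_map_of_mem h)
      · exact Or.inr (Or.inr (List.mem_map_of_mem h))

lemma cf_idE (m : ℤ) (w : V) : cf (idE V) m w = if m = 0 then w else 0 := by
  change (HahnSeries.single (0 : ℤ) w).coeff m = _
  rw [HahnSeries.coeff_single]
  simp

/-- The new factor contributes only the power 0 of its variable, so the old polynomial, read in the
other variables, still works. -/
lemma IsRational.insert_idE {one : V} {L₁ L₂ : List (E V)} (h : IsRational one (L₁ ++ L₂)) :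
    IsRational one (L₁ ++ idE V :: L₂) := by
  obtain ⟨n, l, hl, hmap, P, hP, h1, h2⟩ := h
  obtain ⟨l₁, l₂, rfl, rfl, rfl⟩ := List.map_eq_append_iff.mp hmap
  refine ⟨n + 1, _, hl.insert_zero (idE V), by simp [map_snd_renameList], ?_⟩
  have key : ∀ w a m, act (rename Fin.succ P) (namedProd (renameList Fin.succ l₁ ++ (0, idE V) ::
      renameList Fin.succ l₂) w) (Fin.cons a m : Fin (n + 1) → ℤ) =
      if a = 0 then act P (namedProd (l₁ ++ l₂) w) m else 0 := by
    intro w a m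
    rw [act_rename_succ]
    have : (fun t : Fin n → ℤ => namedProd (renameList Fin.succ l₁ ++ (0, idE V) ::
        renameList Fin.succ l₂) w (Fin.cons a t : Fin (n + 1) → ℤ)) =
        if a = 0 then namedProd (l₁ ++ l₂) w else 0 := by
      funext t
      rw [namedProd_append, namedProd_cons, cf_idE, namedProd_renameList]
      simp only [Fin.cons_zero]
      split_ifs
      · rw [namedProd_append]
        simp [renameList, Function.comp_def]
      · exact map_zero _
    rw [this]
    split_ifs
    · rfl
    · rw [map_zero]
      rfl
  refine ⟨rename Fin.succ P, rename_mem_diffMonoid (Fin.succ_injective n) hP, fun w => ?_, ?_⟩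
  · obtain ⟨N, hN⟩ := h1 w
    refine ⟨min N 0, fun m ⟨i, hi⟩ => ?_⟩
    rw [← Fin.cons_self_tail m, key]
    split_ifs with h0
    · induction i using Fin.cases with
      | zero => omega
      | succ i => exact hN _ ⟨i, by simp only [Fin.tail]; omega⟩
    · rfl
  · rintro m ⟨i, hi⟩
    rw [← Fin.cons_self_tail m, key]
    split_ifs with h0
    · induction i using Fin.cases with
      | zero => omega
      | succ i => exact h2 _ ⟨i, hi⟩
    · rfl

end Insertion

/-! ### Leading coefficients along x_0 = 0 after x_0 ↦ x_0 + x_j -/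

section Lead

lemma exists_aeval_eq_pow_mul {g : Polynomial ℂ} (hg : g ≠ 0) :
    ∃ (e : ℕ) (c : ℂ) (h : Polynomial ℂ), c ≠ 0 ∧
      g = Polynomial.X ^ e * (Polynomial.C c + Polynomial.X * h) := by
  obtain ⟨q, hq, hq'⟩ := Polynomial.exists_eq_pow_rootMultiplicity_mul_and_not_dvd g hg 0
  rw [Polynomial.C_0, sub_zero] at hq hq'
  refine ⟨g.rootMultiplicity 0, q.coeff 0, q.divX, fun h => hq' (Polynomial.X_dvd_iff.mpr h), ?_⟩
  rw [mul_comm Polynomial.X q.divX, add_comm, Polynomial.divX_mul_X_add]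
  exact hq

lemma sub_dvd_aeval_sub {R : Type*} [CommRing R] [Algebra ℂ R] (x y : R) (g : Polynomial ℂ) :
    x - y ∣ Polynomial.aeval x g - Polynomial.aeval y g := by
  rw [← Polynomial.eval_map_algebraMap, ← Polynomial.eval_map_algebraMap]
  exact Polynomial.sub_dvd_eval_sub _ _ _

variable {n : ℕ}

/-- After the substitution `x_0 ↦ x_0 + x_j`, the coefficient of `x_0 ^ e` in `P` is `R`, and lower
powers of `x_0` do not occur. -/
def HasLead (j : Fin n) (e : ℕ) (P : MvPolynomial (Fin (n + 1)) ℂ) (R : MvPolynomial (Fin n) ℂ) : Prop :=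
  ∃ R' : MvPolynomial (Fin (n + 1)) ℂ,
    shiftHom 0 j.succ P = X 0 ^ e * (rename Fin.succ R + X 0 * R')

variable {j : Fin n}

lemma HasLead.mul {P Q : MvPolynomial (Fin (n + 1)) ℂ} {R S : MvPolynomial (Fin n) ℂ}
    {e e' : ℕ} (hP : HasLead j e P R) (hQ : HasLead j e' Q S) :
    HasLead j (e + e') (P * Q) (R * S) := by
  obtain ⟨R', h⟩ := hP
  obtain ⟨S', h'⟩ := hQ
  refine ⟨R' * rename Fin.succ S + rename Fin.succ R * S' + X 0 * R' * S', ?_⟩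
  rw [map_mul, h, h', map_mul]
  ring

lemma HasLead.of_dvd {P : MvPolynomial (Fin (n + 1)) ℂ} {R : MvPolynomial (Fin n) ℂ}
    (h : X 0 ∣ shiftHom 0 j.succ P - rename Fin.succ R) : HasLead j 0 P R := by
  obtain ⟨R', hR'⟩ := h
  exact ⟨R', by rw [← hR']; ring⟩

lemma HasLead.one : HasLead j 0 1 1 := .of_dvd (by simp)

lemma HasLead.pow {P : MvPolynomial (Fin (n + 1)) ℂ} {R : MvPolynomial (Fin n) ℂ}
    (h : HasLead j 0 P R) (N : ℕ) : HasLead j 0 (P ^ N) (R ^ N) := by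
  induction N with
  | zero => simpa using HasLead.one
  | succ N ih =>
    rw [pow_succ, pow_succ]
    have := ih.mul h
    rwa [add_zero] at this

lemma hasLead_prod_X : HasLead j 0 (∏ i, X i) (X j * ∏ i, X i) := by
  refine .of_dvd ?_
  rw [Fin.prod_univ_succ, map_mul, shiftHom_X_self, map_prod, map_mul, map_prod, rename_X,
    Finset.prod_congr rfl fun i _ => shiftHom_X_of_ne j.succ (Fin.succ_ne_zero i)]
  simp only [rename_X]
  exact ⟨∏ i : Fin n, X i.succ, by ring⟩

lemma exists_hasLead_aeval {g : Polynomial ℂ} (hg : g ≠ 0) {P : MvPolynomial (Fin (n + 1)) ℂ}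
    (h : shiftHom 0 j.succ P = Polynomial.aeval (X 0) g) : ∃ e, ∃ R ∈ diffMonoid (Fin n),
      HasLead j e P R := by
  obtain ⟨e, c, g', hc, rfl⟩ := exists_aeval_eq_pow_mul hg
  refine ⟨e, C c, C_mem_diffMonoid hc, Polynomial.aeval (X 0) g', ?_⟩
  rw [h, map_mul, map_pow, Polynomial.aeval_X, map_add, Polynomial.aeval_C, map_mul,
    Polynomial.aeval_X, rename_C]
  rfl

/-- A factor g(x_0 - x_j) becomes g(x_0), whose lowest coefficient is a nonzero constant; the
opposite sign is similar. Any other difference remains, at x_0 = 0, a difference of two distinct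
remaining variables. Thus the lead is again a product of difference polynomials. -/
lemma exists_hasLead (j : Fin n) {P : MvPolynomial (Fin (n + 1)) ℂ}
    (hP : P ∈ diffMonoid (Fin (n + 1))) : ∃ e, ∃ R ∈ diffMonoid (Fin n), HasLead j e P R := by
  refine diffMonoid_induction (motive := fun P => ∃ e, ∃ R ∈ diffMonoid (Fin n), HasLead j e P R)
    (fun c hc => ?_) (fun a b g hab hg => ?_) (fun P Q h h' => ?_) hP
  · refine ⟨0, C c, C_mem_diffMonoid hc, .of_dvd ?_⟩
    rw [rename_C, ← algebraMap_eq, AlgHom.commutes, algebraMap_eq, sub_self]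
    exact dvd_zero _
  · have hs : ∀ k : Fin n, shiftHom 0 j.succ (X k.succ : MvPolynomial (Fin (n + 1)) ℂ) = X k.succ :=
      fun k => shiftHom_X_of_ne _ (Fin.succ_ne_zero k)
    have hlead : ∀ k l : Fin n, k ≠ l →
        X 0 ∣ shiftHom 0 j.succ (X a - X b) - (X k.succ - X l.succ) →
        ∃ e, ∃ R ∈ diffMonoid (Fin n), HasLead j e (Polynomial.aeval (X a - X b) g) R := by
      intro k l hkl hdvd
      refine ⟨0, _, aeval_mem_diffMonoid hkl hg, .of_dvd ?_⟩
      rw [← Polynomial.aeval_algHom_apply, ← Polynomial.aeval_algHom_apply, map_sub (rename (R := ℂ) Fin.succ),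
        rename_X, rename_X]
      exact hdvd.trans (sub_dvd_aeval_sub _ _ g)
    induction a using Fin.cases with
    | zero =>
      induction b using Fin.cases with
      | zero => exact absurd rfl hab
      | succ k =>
        rcases eq_or_ne j k with rfl | hjk
        · refine exists_hasLead_aeval hg ?_
          rw [← Polynomial.aeval_algHom_apply, map_sub, shiftHom_X_self, hs, add_sub_cancel_right]
        · refine hlead j k hjk ?_
          rw [map_sub, shiftHom_X_self, hs]
          exact ⟨1, by ring⟩
    | succ k =>
      induction b using Fin.cases with
      | zero =>
        rcases eq_or_ne k j with rfl | hjk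
        · refine exists_hasLead_aeval (g := g.comp (-Polynomial.X)) ?_ ?_
          · rwa [Ne, Polynomial.comp_neg_X_eq_zero_iff]
          · rw [← Polynomial.aeval_algHom_apply, map_sub, shiftHom_X_self, hs, Polynomial.aeval_comp]
            simp
        · refine hlead k j hjk ?_
          rw [map_sub, shiftHom_X_self, hs]
          exact ⟨-1, by ring⟩
      | succ l =>
        refine hlead k l (fun h => hab (by rw [h])) ?_
        rw [map_sub, hs, hs, sub_self]
        exact dvd_zero _
  · obtain ⟨e, R, hR, h1⟩ := h
    obtain ⟨e', S, hS, h2⟩ := h'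
    exact ⟨e + e', R * S, mul_mem hR hS, h1.mul h2⟩

variable {V : Type*} [AddCommGroup V] [Module ℂ V]

lemma act_eq_zero_of_mem {ι : Type*} {Z : Set (ι → ℤ)} {F : (ι → ℤ) → V}
    (hZ : ∀ m ∈ Z, ∀ e : ι →₀ ℕ, (fun i => m i - (e i : ℤ)) ∈ Z) (hF : ∀ m ∈ Z, F m = 0)
    (p : MvPolynomial ι ℂ) : ∀ m ∈ Z, act p F m = 0 := by
  intro m hm
  rw [act_eq_sum]
  exact Finset.sum_eq_zero fun e _ => by rw [hF _ (hZ m hm e), smul_zero]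

/-- Modulo x_0 the polynomial is R up to the factor x_0^e, so R applied to the lowest
x_0-coefficient of A vanishes on Z, and each further power of x_0 costs one more factor R. The set
Z, stable under lowering exponents, records where vanishing is known. -/
lemma act_pow_lead_eq_zero {R : MvPolynomial (Fin n) ℂ} {R' : MvPolynomial (Fin (n + 1)) ℂ}
    {e : ℕ} {A : (Fin (n + 1) → ℤ) → V} {Z : Set (Fin (n + 1) → ℤ)}
    (hZ : ∀ m ∈ Z, ∀ e : Fin (n + 1) →₀ ℕ, (fun i => m i - (e i : ℤ)) ∈ Z)
    (hR : ∀ m : Fin (n + 1) → ℤ, Function.update m 0 (m 0 - e) ∈ Z →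
      act (X 0 ^ e * (rename Fin.succ R + X 0 * R')) A m = 0)
    {a : ℤ} (hA : ∀ m : Fin (n + 1) → ℤ, m 0 < a → A m = 0) (k : ℕ) :
    ∀ m ∈ Z, m 0 < a + k → act (rename Fin.succ R ^ k) A m = 0 := by
  induction k with
  | zero =>
    intro m _ hm
    rw [pow_zero, act_one]
    exact hA m (by simpa using hm)
  | succ k ih =>
    intro m hm hmk
    set ρ := rename Fin.succ R
    -- The identity ρ^{k+1} = ρ^k (ρ + x_0 R') - x_0 R' ρ^k is used. The first term vanishes by
    -- hypothesis, with the exponent of x_0 raised by e to undo x_0^e.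
    have h1 : act (ρ ^ k) (act (X 0 ^ e * (ρ + X 0 * R')) A) (Function.update m 0 (m 0 + e)) = 0 := by
      refine act_eq_zero_of_mem (Z := {m | Function.update m 0 (m 0 - e) ∈ Z}) ?_ hR _ _ ?_
      · intro m hm e'
        show Function.update _ _ _ ∈ Z
        convert hZ _ hm e' using 1
        funext i
        rcases eq_or_ne i 0 with rfl | h
        · simp; omega
        · simp [h]
      · simpa using hm
    -- The factor x_0 lowers the exponent by one, which puts the term in the range of the induction
    -- hypothesis.
    have h2 : act (X 0 * (R' * ρ ^ k)) A m = 0 := by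
      rw [act_mul, act_mul, act_X]
      refine act_eq_zero_of_mem (Z := {m | m ∈ Z ∧ m 0 < a + k}) ?_ (fun m hm => ih m hm.1 hm.2) _ _
        ?_
      · rintro m ⟨hm, hm'⟩ e'
        exact ⟨hZ m hm e', by simp only; omega⟩
      · refine ⟨?_, by simp; push_cast at hmk; omega⟩
        convert hZ m hm (Finsupp.single 0 1) using 1
        funext i
        rcases eq_or_ne i 0 with rfl | h
        · simp
        · simp [h]
    rw [← act_mul, show ρ ^ k * (X 0 ^ e * (ρ + X 0 * R')) =
      X 0 ^ e * (ρ ^ (k + 1) + X 0 * (R' * ρ ^ k)) by ring, act_mul, act_X_pow, act_add,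
      Pi.add_apply] at h1
    simp only [Function.update_self, add_sub_cancel_right, Function.update_idem,
      Function.update_eq_self] at h1
    rwa [h2, add_zero] at h1

end Lead

/-! ### Replacing neighbouring fields by their products -/

section Contraction

variable {V : Type*} [AddCommGroup V] [Module ℂ V]

lemma IsLowerTruncated.of_act_prod_X {r : ℕ} {F : (Fin r → ℤ) → V} (s : Finset (Fin r))
    (hF : IsLowerTruncated (FormalVA.act (∏ i ∈ s, X i) F)) : IsLowerTruncated F := by
  induction s using Finset.induction_on generalizing F with
  | empty => simpa using hF
  | insert i s hi ih =>
    rw [Finset.prod_insert hi, mul_comm, act_mul] at hF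
    exact IsLowerTruncated.of_act_X i (ih hF)

lemma IsLowerTruncated.of_act_pow {r : ℕ} {F : (Fin r → ℤ) → V} {j : Fin r} (N : ℕ)
    (hF : IsLowerTruncated (FormalVA.act ((X j * ∏ i, X i) ^ N) F)) : IsLowerTruncated F := by
  induction N with
  | zero => simpa using hF
  | succ N ih =>
    rw [pow_succ', act_mul, act_mul] at hF
    exact ih (IsLowerTruncated.of_act_prod_X _ (IsLowerTruncated.of_act_X j hF))

lemma fieldProd_pair (c d : E V) (w : V) :
    fieldProd ![c, d] w = fun m => cf c (m 0) (cf d (m 1) w) := by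
  funext m
  simp [fieldProd]

lemma IsRational.exists_pair {one : V} {c d : E V} (h : IsRational one [c, d]) :
    ∃ P ∈ diffMonoid (Fin 2), ClearsPoles P c d := by
  have hl : IsNaming [((0 : Fin 2), c), (1, d)] := by
    constructor
    · simp
    · intro i
      fin_cases i <;> simp
  obtain ⟨P, hP, h1, _⟩ := IsRational.named hl h
  refine ⟨P, hP, fun w => ?_⟩
  rw [polyMul_eq_act, fieldProd_pair]
  have : (fun m : Fin 2 → ℤ => cf c (m 0) (cf d (m 1) w)) = namedProd [(0, c), (1, d)] w := by
    funext m
    simp [namedProd]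
  rw [this]
  exact h1 w

lemma IsRational.isOPE {one : V} {c d : E V} (h : IsRational one [c, d]) (w : V) :
    IsOPE (fun m => cf c (m 0) (cf d (m 1) w)) (fun e => cf (nthProduct c d (-e 0 - 1)) (e 1) w) := by
  obtain ⟨P, hP, h1⟩ := h.exists_pair
  rw [← fieldProd_pair]
  exact isOPE_nthProduct ⟨P, ne_zero_of_mem_diffMonoid hP, h1⟩ w

/-- The series `c(x)_n d(x)` vanish for large `n`. -/
lemma IsRational.exists_nthProduct_eq_zero {one : V} {c d : E V} (h : IsRational one [c, d]) :
    ∃ a : ℤ, ∀ i < a, nthProduct c d (-i - 1) = 0 := by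
  obtain ⟨P, hP, h1⟩ := h.exists_pair
  obtain ⟨e, R, hR, hlead⟩ := exists_hasLead (0 : Fin 1) hP
  -- The bound is the order of x_0 in the shifted P. It is the same for all w, unlike the order
  -- obtained from lower truncation of the expansion at a single w.
  refine ⟨-e, fun i hi => ?_⟩
  suffices hz : ∀ w (m : ℤ), cf (nthProduct c d (-i - 1)) m w = 0 by
    refine LinearMap.ext fun w => ?_
    ext m
    exact hz w m
  intro w m
  have hlt := h1 w
  rw [polyMul_eq_act, isLowerTruncated_iff, fieldProd_pair] at hlt
  obtain ⟨N, hN⟩ := hlt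
  rw [← act_mul] at hN
  set A : (Fin 2 → ℤ) → V := fun e => cf (nthProduct c d (-e 0 - 1)) (e 1) w
  obtain ⟨a, ha⟩ := (h.isOPE w).isIterated.1
  obtain ⟨S', hl⟩ := ((hasLead_prod_X (j := (0 : Fin 1))).pow N).mul hlead
  rw [zero_add] at hl
  have htr : IsPower (act (shiftHom 0 (Fin.succ 0) ((∏ i, X i) ^ N * P)) A) := by
    rw [IsOPE.transfer (by decide) (fun t => ?_) hN]
    · exact hN.translate (by decide)
    · have hs : ∀ F : (Fin 2 → ℤ) → V, slice 0 (Fin.succ (0 : Fin 1)) t F = F := by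
        intro F
        funext e
        rw [slice_apply]
        congr 1
        funext k
        fin_cases k <;> simp
      rw [hs, hs]
      exact h.isOPE w
  rw [hl] at htr
  obtain ⟨k, hk⟩ : ∃ k : ℕ, i < a + k := ⟨(i - a).toNat + 1, by omega⟩
  -- The cleared series has no negative powers of x_0. Removing x_0^e leaves vanishing at exponents
  -- below -e.
  have hzero := act_pow_lead_eq_zero (Z := {m : Fin 2 → ℤ | m 0 < -(e : ℤ)})
    (fun m hm e' => by simp only [Set.mem_ofPred_eq] at hm ⊢; omega)
    (fun m hm => htr m ⟨0, by simp at hm; omega⟩) ha k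
  set Q := (X 0 * ∏ i, X i : MvPolynomial (Fin 1) ℂ) ^ N * R
  have h2 : act (Q ^ k) (fun t : Fin 1 → ℤ => A (Fin.cons i t : Fin 2 → ℤ)) = 0 := by
    funext t
    have := hzero (Fin.cons i t : Fin 2 → ℤ) (by simpa using hi) (by simpa using hk)
    rwa [← map_pow, act_rename_succ] at this
  -- A single power of x_0 is viewed as a series in two variables, so that `IsIterated.eq_zero`
  -- cancels the polynomial in the remaining variable.
  have h3 : (fun e => if e 0 = i then A e else 0 : (Fin 2 → ℤ) → V) = 0 := by
    refine IsIterated.eq_zero (i := 0) (j := 1) (by decide) (p := rename Fin.succ (Q ^ k)) ⟨?_, ?_⟩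
      ?_ ?_
    · exact ⟨i, fun m hm => if_neg (by omega)⟩
    · intro b
      obtain ⟨M, hM⟩ := (h.isOPE w).isIterated.2 b
      refine ⟨M, fun m h1 h2 => ?_⟩
      simp only [A, hM m h1 h2, ite_self]
    · rw [Ne, rename_eq_zero_iff_of_injective _ (Fin.succ_injective 1)]
      refine pow_ne_zero _ (mul_ne_zero (pow_ne_zero _ (mul_ne_zero (X_ne_zero _) ?_))
        (ne_zero_of_mem_diffMonoid hR))
      exact Finset.prod_ne_zero_iff.mpr fun i _ => X_ne_zero i
    · funext t
      rw [← Fin.cons_self_tail t, act_rename_succ]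
      simp only [Fin.cons_zero]
      split_ifs with h0
      · rw [h0, h2]
        rfl
      · exact congrFun (map_zero (act (Q ^ k))) _
  simpa [A] using congrFun h3 ![i, m]

/-- The operator product of c and d inherits cleared poles from the longer product by
`IsOPE.transfer`. Passing to one coefficient of x_0 replaces the clearing polynomial by a power of
its lead, which is still a difference polynomial. -/
theorem IsRational.contract {one : V} {c d : E V} (hcd : IsRational one [c, d]) {L₁ L₂ : List (E V)}
    (h : IsRational one (L₁ ++ c :: d :: L₂)) (k : ℤ) :
    IsRational one (L₁ ++ nthProduct c d k :: L₂) := by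
  -- The contracted product is named first. In the longer product d keeps the variable x_j of the
  -- contracted field, and c receives a new variable x_0.
  obtain ⟨n, l, hl, hmap⟩ := exists_naming (L₁ ++ nthProduct c d k :: L₂)
  obtain ⟨l₁, l', rfl, rfl, hmap'⟩ := List.map_eq_append_iff.mp hmap
  obtain ⟨⟨j, f⟩, l₂, rfl, hf, rfl⟩ := List.map_eq_cons_iff.mp hmap'
  simp only at hf
  subst hf
  have hl' : IsNaming (l₁ ++ (j, d) :: l₂) :=
    ⟨by simpa using hl.nodup, fun i => by simpa using hl.mem i⟩
  have hl'' := hl'.insert_zero c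
  have hj : j ∉ l₁.map Prod.fst ∧ j ∉ l₂.map Prod.fst := by
    have := hl'.nodup
    rw [List.map_append, List.map_cons, List.nodup_middle, List.nodup_cons, List.mem_append] at this
    exact not_or.mp this.1
  obtain ⟨P, hP, h1, h2⟩ := IsRational.named hl'' (one := one) (by
    rw [List.map_append, List.map_cons, map_snd_renameList, map_snd_renameList]
    exact h)
  obtain ⟨e, R, hR, hlead⟩ := exists_hasLead j hP
  obtain ⟨a, ha⟩ := hcd.exists_nthProduct_eq_zero
  set M : MvPolynomial (Fin n) ℂ := X j * ∏ i, X i with hM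
  -- The number K of leads needed to reach the coefficient x_0^(-k-1) comes from the bound `a`,
  -- hence is independent of w.
  obtain ⟨K, hK⟩ : ∃ K : ℕ, -k - 1 < a + K := ⟨(-k - 1 - a).toNat + 1, by omega⟩
  -- Only N depends on w, and it enters through monomials alone. For lower truncation these can be
  -- removed afterwards; at the vacuum N = 0.
  have key : ∀ w (N : ℕ), IsPower (act ((∏ i, X i) ^ N * P) (namedProd
      (renameList Fin.succ l₁ ++ (0, c) :: renameList Fin.succ ((j, d) :: l₂)) w)) →
      IsPower (act ((M ^ N * R) ^ K) (namedProd (l₁ ++ (j, nthProduct c d k) :: l₂) w)) := by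
    intro w N hN
    set B := namedProd
      (renameList Fin.succ l₁ ++ (0, c) :: renameList Fin.succ ((j, d) :: l₂)) w with hB
    set A : (Fin (n + 1) → ℤ) → V := fun m =>
      namedProd (l₁ ++ (j, nthProduct c d (-m 0 - 1)) :: l₂) w (Fin.tail m) with hA
    obtain ⟨S', hS'⟩ := ((hasLead_prod_X (j := j)).pow N).mul hlead
    rw [zero_add, ← hM] at hS'
    have htr : IsPower (act (shiftHom 0 j.succ ((∏ i, X i) ^ N * P)) A) := by
      have h0j : (0 : Fin (n + 1)) ≠ j.succ := (Fin.succ_ne_zero j).symm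
      rw [IsOPE.transfer h0j (fun t => ?_) hN]
      · exact hN.translate h0j
      · have h3 := ((hcd.isOPE (namedProd l₂ w (Fin.tail t))).map
          (l₁.map fun p => cf p.2 (Fin.tail t p.1)).prod)
        have htail : ∀ e : Fin 2 → ℤ, Fin.tail (Function.update (Function.update t 0 (e 0)) j.succ
            (e 1)) = Function.update (Fin.tail t) j (e 1) := by
          intro e
          funext i
          simp [Fin.tail, Function.update_apply]
        have hl1 : ∀ e : Fin 2 → ℤ, (l₁.map fun p => cf p.2
            (Function.update (Fin.tail t) j (e 1) p.1)) =
            l₁.map fun p => cf p.2 (Fin.tail t p.1) := by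
          intro e
          refine List.map_congr_left fun p hp => ?_
          rw [Function.update_of_ne]
          rintro h
          exact hj.1 (h ▸ List.mem_map_of_mem hp)
        convert h3 using 1
        · funext e
          rw [slice_apply, hB]
          change namedProd (renameList Fin.succ l₁ ++ (0, c) :: (j.succ, d) ::
            renameList Fin.succ l₂) w _ = _
          rw [namedProd_append, namedProd_cons, namedProd_cons, namedProd_renameList]
          have h4 := hl1 e
          rw [← htail] at h4
          have h5 : (Function.update (Function.update t 0 (e 0)) j.succ (e 1)) ∘ Fin.succ =
            Function.update (Fin.tail t) j (e 1) := htail e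
          rw [h5, namedProd_update_of_notMem hj.2, Function.update_self,
            Function.update_of_ne h0j, Function.update_self, ← h4]
          simp [renameList, Function.comp_def, Fin.tail]
        · funext e
          rw [slice_apply, hA]
          simp only
          rw [htail, namedProd_append, namedProd_cons, hl1, Function.update_self,
            namedProd_update_of_notMem hj.2, Function.update_of_ne h0j, Function.update_self]
    rw [hS'] at htr
    have hzero := act_pow_lead_eq_zero (Z := {m : Fin (n + 1) → ℤ | ∃ i : Fin n, m i.succ < 0})
      (fun m ⟨i, hi⟩ e' => ⟨i, by simp only; omega⟩)
      (fun m ⟨i, hi⟩ => htr m ⟨i.succ, by simpa using hi⟩) (a := a) (A := A) (fun m hm => by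
        simp only [hA]
        rw [ha _ hm, namedProd_append, namedProd_cons]
        exact map_zero _) K
    rintro m ⟨i, hi⟩
    have := hzero (Fin.cons (-k - 1) m : Fin (n + 1) → ℤ) ⟨i, by simpa using hi⟩ (by simpa using hK)
    rw [← map_pow, act_rename_succ] at this
    have hAk : (fun t : Fin n → ℤ => A (Fin.cons (-k - 1) t : Fin (n + 1) → ℤ)) =
        namedProd (l₁ ++ (j, nthProduct c d k) :: l₂) w := by
      funext t
      simp [hA]
    rwa [hAk] at this
  refine ⟨n, _, hl, hmap, R ^ K, pow_mem hR K, fun w => ?_, ?_⟩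
  · obtain ⟨N, hN⟩ := isLowerTruncated_iff.mp (h1 w)
    rw [← act_mul] at hN
    have := (key w N hN).isLowerTruncated
    rw [mul_pow, ← pow_mul, act_mul] at this
    exact this.of_act_pow _
  · have := key one 0 (by simpa using h2)
    simpa using this

end Contraction

/-! ### Rationality is linear in each field -/

section Linearity

variable {V : Type*} [AddCommGroup V] [Module ℂ V]

lemma cf_add (a b : E V) (m : ℤ) : cf (a + b) m = cf a m + cf b m := rfl

lemma cf_smul (c : ℂ) (a : E V) (m : ℤ) : cf (c • a) m = c • cf a m := rfl

lemma cf_zero (m : ℤ) : cf (0 : E V) m = 0 := rfl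

lemma exists_cf_eq_zero (a : E V) (w : V) : ∃ N : ℤ, ∀ m < N, cf a m w = 0 :=
  hahnSeries_bddBelow ((HahnModule.of ℂ).symm (a w))

/-- The product of two clearing polynomials clears both summands. -/
lemma IsRational.add {one : V} {a b : E V} {L₁ L₂ : List (E V)}
    (ha : IsRational one (L₁ ++ a :: L₂)) (hb : IsRational one (L₁ ++ b :: L₂)) :
    IsRational one (L₁ ++ (a + b) :: L₂) := by
  obtain ⟨n, l, hl, hmap⟩ := exists_naming (L₁ ++ (a + b) :: L₂)
  obtain ⟨l₁, l', rfl, rfl, hmap'⟩ := List.map_eq_append_iff.mp hmap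
  obtain ⟨⟨j, f⟩, l₂, rfl, hf, rfl⟩ := List.map_eq_cons_iff.mp hmap'
  simp only at hf
  subst hf
  have hnam : ∀ x : E V, IsNaming (l₁ ++ (j, x) :: l₂) := fun x =>
    ⟨by simpa using hl.nodup, fun i => by simpa using hl.mem i⟩
  obtain ⟨P, hP, h1, h2⟩ := IsRational.named (hnam a) (by simpa using ha)
  obtain ⟨Q, hQ, h1', h2'⟩ := IsRational.named (hnam b) (by simpa using hb)
  have key : ∀ w, act (P * Q) (namedProd (l₁ ++ (j, a + b) :: l₂) w) =
      act Q (act P (namedProd (l₁ ++ (j, a) :: l₂) w)) +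
        act P (act Q (namedProd (l₁ ++ (j, b) :: l₂) w)) := by
    intro w
    rw [← act_mul, ← act_mul, mul_comm Q P, ← map_add]
    congr 1
    funext m
    simp [namedProd_append, namedProd_cons, cf_add]
  refine ⟨n, _, hl, hmap, P * Q, mul_mem hP hQ, fun w => ?_, ?_⟩
  · rw [key]
    exact ((h1 w).act Q).add ((h1' w).act P)
  · rw [key]
    exact (h2.act Q).add (h2'.act P)

lemma IsRational.smul {one : V} {a : E V} {L₁ L₂ : List (E V)} (c : ℂ)
    (ha : IsRational one (L₁ ++ a :: L₂)) : IsRational one (L₁ ++ (c • a) :: L₂) := by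
  obtain ⟨n, l, hl, hmap⟩ := exists_naming (L₁ ++ (c • a) :: L₂)
  obtain ⟨l₁, l', rfl, rfl, hmap'⟩ := List.map_eq_append_iff.mp hmap
  obtain ⟨⟨j, f⟩, l₂, rfl, hf, rfl⟩ := List.map_eq_cons_iff.mp hmap'
  simp only at hf
  subst hf
  have hnam : IsNaming (l₁ ++ (j, a) :: l₂) :=
    ⟨by simpa using hl.nodup, fun i => by simpa using hl.mem i⟩
  obtain ⟨P, hP, h1, h2⟩ := IsRational.named hnam (by simpa using ha)
  have key : ∀ w, act P (namedProd (l₁ ++ (j, c • a) :: l₂) w) =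
      fun m => (c • LinearMap.id : Module.End ℂ V) (act P (namedProd (l₁ ++ (j, a) :: l₂) w) m) := by
    intro w
    rw [← act_map]
    congr 1
    funext m
    simp [namedProd_append, namedProd_cons, cf_smul]
  refine ⟨n, _, hl, hmap, P, hP, fun w => ?_, ?_⟩
  · rw [key]
    exact (h1 w).map _
  · rw [key]
    exact h2.map _

lemma IsRational.of_zero {one : V} (L₁ L₂ : List (E V)) : IsRational one (L₁ ++ (0 : E V) :: L₂) := by
  obtain ⟨n, l, hl, hmap⟩ := exists_naming (L₁ ++ (0 : E V) :: L₂)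
  obtain ⟨l₁, l', rfl, rfl, hmap'⟩ := List.map_eq_append_iff.mp hmap
  obtain ⟨⟨j, f⟩, l₂, rfl, hf, rfl⟩ := List.map_eq_cons_iff.mp hmap'
  simp only at hf
  subst hf
  have key : ∀ w : V, namedProd (l₁ ++ (j, (0 : E V)) :: l₂) w = 0 := by
    intro w
    funext m
    simp [namedProd_append, namedProd_cons, cf_zero]
  exact ⟨n, _, hl, hmap, 1, one_mem _, fun w => by
    rw [key, map_zero]; exact IsPower.zero.isLowerTruncated, by
    rw [key, map_zero]; exact IsPower.zero⟩

end Linearity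

/-! ### Products with the identity field -/

section Identity

variable {V : Type*} [AddCommGroup V] [Module ℂ V]

/-- The series `h(x_0) 1`. -/
def constSnd (h : ℤ → V) : (Fin 2 → ℤ) → V := fun m => if m 1 = 0 then h (m 0) else 0

/-- The series `h(x_1 + x_0)`, expanded in nonnegative powers of `x_0`. -/
def taylor (h : ℤ → V) : (Fin 2 → ℤ) → V :=
  fun m => if 0 ≤ m 0 then (Ring.choose (m 0 + m 1) (m 0).toNat : ℤ) • h (m 0 + m 1) else 0

lemma act_X_constSnd (h : ℤ → V) : act (X 0) (constSnd h) = constSnd fun j => h (j - 1) := by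
  funext m
  simp [act_X, constSnd]

lemma act_X_taylor (h : ℤ → V) : act (X 0 + X 1) (taylor h) = taylor fun j => h (j - 1) := by
  funext m
  rw [act_add, Pi.add_apply, act_X, act_X]
  simp only [taylor, Function.update_self, ne_eq, one_ne_zero, not_false_eq_true,
    Function.update_of_ne, _root_.zero_ne_one]
  rcases lt_trichotomy (m 0) 0 with h0 | h0 | h0
  · rw [if_neg (by omega), if_neg (by omega), if_neg (by omega), add_zero]
  · simp [h0]
  · obtain ⟨s, hs⟩ : ∃ s : ℕ, m 0 = s + 1 := ⟨(m 0 - 1).toNat, by omega⟩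
    rw [if_pos (by omega), if_pos (by omega), if_pos (by omega), hs,
      show ((s : ℤ) + 1).toNat = s + 1 by omega, show ((s : ℤ) + 1 - 1).toNat = s by omega,
      show (s : ℤ) + 1 + m 1 = (s + m 1) + 1 by ring, Ring.choose_succ_succ, add_smul]
    rw [show (s : ℤ) + 1 - 1 + m 1 = s + m 1 by ring, show (s : ℤ) + 1 + (m 1 - 1) = s + m 1 by ring,
      add_sub_cancel_right]

lemma isIterated_taylor {h : ℤ → V} {N : ℤ} (hN : ∀ j < N, h j = 0) : IsIterated 0 1 (taylor h) :=
  ⟨⟨0, fun m hm => if_neg (by omega)⟩, fun a => ⟨N - a, fun m h1 h2 => by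
    unfold taylor
    rw [hN _ (by omega), smul_zero, ite_self]⟩⟩

/-- Multiplication by x_0 on the left corresponds to x_0 + x_1 on the right, so induction on the
pole order reduces to power series, where Taylor expansion is translation. The coefficient of x_0^0
gives a(x)_{-1} 1 = a(x). -/
lemma isOPE_constSnd {h : ℤ → V} {N : ℤ} (hN : ∀ j < N, h j = 0) :
    IsOPE (constSnd h) (taylor h) := by
  have key : ∀ (n : ℕ) (h : ℤ → V), (∀ j : ℤ, j < -n → h j = 0) → IsOPE (constSnd h) (taylor h) := by
    intro n
    induction n with
    | zero =>
      intro h hh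
      have hB : IsPower (constSnd h) := by
        rintro m ⟨i, hi⟩
        unfold constSnd
        obtain rfl | rfl : i = 0 ∨ i = 1 := by omega
        · rw [hh _ (by simpa using hi), ite_self]
        · exact if_neg (by omega)
      convert IsOPE.of_isPower hB using 1
      funext m
      unfold taylor
      split_ifs with h0
      · rcases lt_or_ge (m 1) 0 with h1 | h1
        · rw [(hB.translate IsOPE.zero_ne_one) m ⟨1, h1⟩]
          rcases lt_or_ge (m 0 + m 1) 0 with h2 | h2
          · rw [hh _ (by simpa using h2), smul_zero]
          · rw [choose_eq_zero_of_nonneg_of_lt h2 (by omega), zero_smul]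
        · rw [translate_def, Finset.sum_eq_single (m 1).toNat]
          · simp only [constSnd, Function.update_self, Int.toNat_of_nonneg h1, sub_self, if_true]
            rw [Function.update_of_ne IsOPE.zero_ne_one, Function.update_self]
            congr 1
            obtain ⟨a, ha⟩ := Int.eq_ofNat_of_zero_le h0
            obtain ⟨b, hb⟩ := Int.eq_ofNat_of_zero_le h1
            rw [ha, hb, Int.toNat_natCast, Int.toNat_natCast, ← Nat.cast_add, Ring.choose_natCast,
              Ring.choose_natCast, Nat.choose_symm_add]
          · intro k _ hk
            rw [constSnd, if_neg, smul_zero]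
            simp only [Function.update_self]
            omega
          · intro hk
            simp only [Finset.mem_range] at hk
            omega
      · exact ((hB.translate IsOPE.zero_ne_one) m ⟨0, by omega⟩).symm
    | succ n ih =>
      intro h hh
      refine IsOPE.of_act (p := X 0) (X_ne_zero _) (isIterated_taylor hh) ?_
      rw [shiftHom_X_self, act_X_constSnd, act_X_taylor]
      exact ih _ fun j hj => hh _ (by push_cast; omega)
  exact key (-N).toNat h fun j hj => hN j (by omega)

end Identity

/-! ### Vacuum properties in one and two variables -/

section Generators

variable {V : Type*} [AddCommGroup V] [Module ℂ V] {one : V}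

lemma exists_eq_C_of_mem_diffMonoid {P : MvPolynomial (Fin 1) ℂ} (hP : P ∈ diffMonoid (Fin 1)) :
    ∃ c : ℂ, c ≠ 0 ∧ P = C c := by
  refine diffMonoid_induction (motive := fun P => ∃ c : ℂ, c ≠ 0 ∧ P = C c)
    (fun c hc => ⟨c, hc, rfl⟩) (fun i j g hij _ => absurd (Subsingleton.elim i j) hij) ?_ hP
  rintro P Q ⟨c, hc, rfl⟩ ⟨d, hd, rfl⟩
  exact ⟨c * d, mul_ne_zero hc hd, by rw [C_mul]⟩

/-- With one variable there are no differences: the clearing polynomial is a nonzero constant, and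
a(x) applied to the vacuum is itself a power series. -/
lemma IsRational.cf_eq_zero_of_neg {a : E V} (h : IsRational one [a]) {m : ℤ} (hm : m < 0) :
    cf a m one = 0 := by
  have hl : IsNaming [((0 : Fin 1), a)] :=
    ⟨by simp, fun i => by rw [Subsingleton.elim i 0]; simp⟩
  obtain ⟨P, hP, _, h2⟩ := IsRational.named hl h
  obtain ⟨c, hc, rfl⟩ := exists_eq_C_of_mem_diffMonoid hP
  rw [act_C] at h2
  have := h2 (fun _ => m) ⟨0, hm⟩
  simpa [namedProd, hc] using this

lemma exists_eq_aeval_of_mem_diffMonoid {P : MvPolynomial (Fin 2) ℂ}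
    (hP : P ∈ diffMonoid (Fin 2)) : ∃ g : Polynomial ℂ, g ≠ 0 ∧
      P = Polynomial.aeval (X 0 - X 1 : MvPolynomial (Fin 2) ℂ) g := by
  refine diffMonoid_induction (motive := fun P => ∃ g : Polynomial ℂ, g ≠ 0 ∧
      P = Polynomial.aeval (X 0 - X 1 : MvPolynomial (Fin 2) ℂ) g)
    (fun c hc => ⟨Polynomial.C c, by simpa using hc, by rw [Polynomial.aeval_C]; rfl⟩)
    (fun i j g hij hg => ?_) ?_ hP
  · obtain ⟨rfl, rfl⟩ | ⟨rfl, rfl⟩ : (i = 0 ∧ j = 1) ∨ (i = 1 ∧ j = 0) := by omega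
    · exact ⟨g, hg, rfl⟩
    · refine ⟨g.comp (-Polynomial.X), by rwa [Ne, Polynomial.comp_neg_X_eq_zero_iff], ?_⟩
      rw [Polynomial.aeval_comp]
      simp
  · rintro P Q ⟨g, hg, rfl⟩ ⟨h, hh, rfl⟩
    exact ⟨g * h, mul_ne_zero hg hh, by rw [map_mul]⟩

lemma act_aeval_X_zero_level (g : Polynomial ℂ) (F : (Fin 2 → ℤ) → V) (t : ℤ) :
    act (Polynomial.aeval (X 0) g) (fun m => if m 1 = t then F m else 0) =
      fun m => if m 1 = t then act (Polynomial.aeval (X 0) g) F m else 0 := by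
  induction g using Polynomial.induction_on' with
  | add p q hp hq =>
    funext m
    rw [map_add, act_add, act_add, hp, hq]
    by_cases h : m 1 = t <;> simp [h]
  | monomial n c =>
    funext m
    rw [Polynomial.aeval_monomial, algebraMap_eq, act_mul, act_mul, act_C, act_C,
      Pi.smul_apply, Pi.smul_apply, act_X_pow, act_X_pow]
    simp

/-- If a product has no negative powers of the second variable, then its constant term in the second
variable agrees with that of its operator product expansion. -/
lemma IsOPE.eq_of_snd_eq_zero {B A : (Fin 2 → ℤ) → V} {P : MvPolynomial (Fin 2) ℂ}
    (hP : P ∈ diffMonoid (Fin 2)) (hPB : IsPower (FormalVA.act P B)) (h : IsOPE B A)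
    (hB : ∀ m, m 1 < 0 → B m = 0)
    (hB0 : ∃ N : ℤ, ∀ m, m 1 = 0 → m 0 < N → B m = 0) {m : Fin 2 → ℤ} (hm : m 1 = 0) :
    A m = B m := by
  obtain ⟨g, hg, rfl⟩ := exists_eq_aeval_of_mem_diffMonoid hP
  -- Under the shift x_0 - x_1 becomes x_0, so the polynomial acting on A is g(x_0) and preserves
  -- each power of x_1.
  have htr : FormalVA.act (shiftHom 0 1 (Polynomial.aeval (X 0 - X 1) g)) A =
      translate 0 1 0 (FormalVA.act (Polynomial.aeval (X 0 - X 1) g) B) := by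
    refine IsOPE.transfer (by decide) (fun t => ?_) hPB
    have hs : ∀ F : (Fin 2 → ℤ) → V, slice 0 1 t F = F := by
      intro F
      funext e
      rw [slice_apply]
      congr 1
      funext k
      fin_cases k <;> simp
    rw [hs, hs]
    exact h
  rw [← Polynomial.aeval_algHom_apply, map_sub, shiftHom_X_self, shiftHom_X_of_ne _ (by decide),
    add_sub_cancel_right] at htr
  -- It remains to cancel g(x_0) on the part of A - B of degree 0 in x_1.
  have h0 : (fun m => if m 1 = 0 then (A - B) m else 0 : (Fin 2 → ℤ) → V) = 0 := by
    refine IsIterated.eq_zero (i := 0) (j := 1) (by decide) (p := Polynomial.aeval (X 0) g)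
      ⟨?_, ?_⟩ ?_ ?_
    · obtain ⟨N, hN⟩ := hB0
      obtain ⟨M, hM⟩ := h.isIterated.1
      refine ⟨min N M, fun m hm => ?_⟩
      show ite _ _ _ = (0 : V)
      split_ifs with h1
      · simp [hM m (by omega), hN m h1 (by omega)]
      · rfl
    · exact fun a => ⟨0, fun m _ hm => if_neg (by omega)⟩
    · have := aeval_X_sub_X_ne_zero (ι := Fin 2) IsOPE.zero_ne_one hg
      intro h1
      refine shiftHom_ne_zero IsOPE.zero_ne_one this ?_
      rw [← Polynomial.aeval_algHom_apply, map_sub, shiftHom_X_self,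
        shiftHom_X_of_ne _ (by decide), add_sub_cancel_right, h1]
    · rw [act_aeval_X_zero_level]
      funext m
      split_ifs with h1
      · rw [map_sub, Pi.sub_apply, htr, translate_base_of_eq_zero (hPB.eq_zero_of_lt 1) h1]
        -- The polynomials g(x_0 - x_1) and g(x_0) differ by a multiple of x_1, which contributes
        -- nothing at x_1^0 because B has no negative powers of x_1.
        obtain ⟨R, hR⟩ := sub_dvd_aeval_sub (X 0 - X 1 : MvPolynomial (Fin 2) ℂ) (X 0) g
        rw [← Pi.sub_apply, ← act_sub, hR, show X 0 - X 1 - X 0 = -(X 1 : MvPolynomial (Fin 2) ℂ) by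
          ring, neg_mul, map_neg, LinearMap.neg_apply, Pi.neg_apply, act_mul, act_X,
          act_eq_zero_of_lt hB _ _ (by simp; omega), neg_zero]
        rfl
      · rfl
  have := congrFun h0 m
  simp only [hm, if_true] at this
  exact sub_eq_zero.mp this

end Generators

/-! ### The state-field map given by ψ -/

section Generated

variable {V : Type*} [AddCommGroup V] [Module ℂ V]

/-- The series `a(x_0) b(x_1) w`. -/
def prodSeries (a b : E V) (w : V) : (Fin 2 → ℤ) → V := fun m => cf a (m 0) (cf b (m 1) w)

/-- A state-field map whose fields are jointly rational, generated by the fields of `U` through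
operator product expansions. -/
structure IsGenerated (Y : V →ₗ[ℂ] E V) (one : V) (U : Set V) : Prop where
  vacuum : Y one = idE V
  creation : ∀ v, Creates (Y v) one v
  rational : ∀ l : List V, IsRational one (l.map Y)
  isOPE : ∀ u ∈ U, ∀ v w, IsOPE (prodSeries (Y u) (Y v) w) (iterateSeries Y u v w)
  span : ∀ S : Submodule ℂ V, one ∈ S → (∀ u ∈ U, ∀ m, ∀ v ∈ S, cf (Y u) m v ∈ S) → S = ⊤

/-- The products `a^1(x)_{n_1} ⋯ a^r(x)_{n_r} 1` of fields in `S`. -/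
inductive IsMonomialField (S : Set (E V)) : E V → Prop
  | one : IsMonomialField S (idE V)
  | prod (a : E V) (ha : a ∈ S) (b : E V) (hb : IsMonomialField S b) (n : ℤ) :
      IsMonomialField S (nthProduct a b n)

/-- Each iterated product is unfolded into its factors from S, to which the hypothesis applies, and
then contracted again one product at a time. -/
lemma isRational_of_isMonomialField {one : V} {S : Set (E V)}
    (hS : ∀ l : List (E V), (∀ a ∈ l, a ∈ S) → IsRational one l) {l : List (E V)}
    (hl : ∀ a ∈ l, IsMonomialField S a) : IsRational one l := by
  -- An arbitrary list from S is kept on the left, so that unfolding a(x)_n b(x) can move `a` into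
  -- it.
  have key : ∀ f, IsMonomialField S f → ∀ L₂ : List (E V),
      (∀ l₁ : List (E V), (∀ a ∈ l₁, a ∈ S) → IsRational one (l₁ ++ L₂)) →
      ∀ l₁ : List (E V), (∀ a ∈ l₁, a ∈ S) → IsRational one (l₁ ++ f :: L₂) := by
    intro f hf
    induction hf with
    | one => exact fun L₂ h l₁ hl₁ => (h l₁ hl₁).insert_idE
    | prod a ha b hb n ih =>
      intro L₂ h l₁ hl₁
      refine IsRational.contract ?_ ?_ n
      · exact ih [] (fun l₁ hl₁ => by simpa using hS l₁ hl₁) [a] (by simpa using ha)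
      · have := ih L₂ h (l₁ ++ [a]) (by
          intro x hx
          rcases List.mem_append.mp hx with hx | hx
          · exact hl₁ x hx
          · rwa [List.mem_singleton.mp hx])
        simpa using this
  have main : ∀ l : List (E V), (∀ a ∈ l, IsMonomialField S a) → ∀ l₁ : List (E V),
      (∀ a ∈ l₁, a ∈ S) → IsRational one (l₁ ++ l) := by
    intro l
    induction l with
    | nil => exact fun _ l₁ hl₁ => by simpa using hS l₁ hl₁
    | cons f l ih =>
      exact fun hl => key f (hl f List.mem_cons_self) l (ih fun a ha => hl a (List.mem_cons_of_mem _ ha))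
  exact main l hl [] (by simp)

/-- Spanning reduces rationality to iterated products of generators. The compatibility of ψ with the
modes says precisely that iterates are operator product coefficients. -/
theorem isGenerated_of_map {one : V} {L : Module.End ℂ V} {U : Set V} {Y₀ : U → E V}
    (hL_one : L one = 0)
    (hL_bracket : ∀ (u : U) (m : ℤ),
      ⁅L, cf (Y₀ u) m⁆ = ((m + 1 : ℤ) : ℂ) • cf (Y₀ u) (m + 1))
    (hcreate : ∀ u : U, Creates (Y₀ u) one u)
    (hqc : QuasiCompatible (Set.range Y₀))
    (hspan : Submodule.span ℂ {v : V | ∃ l : List (U × ℤ),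
      v = (l.map fun q => mode (Y₀ q.1) q.2).prod one} = ⊤)
    {ψ : V →ₗ[ℂ] E V} (hψ_one : ψ one = idE V)
    (hψ : ∀ (u : U) (n : ℤ) (v : V), ψ (mode (Y₀ u) n v) = nthProduct (Y₀ u) (ψ v) n) :
    (∀ u : U, ψ u = Y₀ u) ∧ IsGenerated ψ one U := by
  have hS : ∀ l : List (E V), (∀ a ∈ l, a ∈ Set.range Y₀) → IsRational one l := fun l hl =>
    isRational_of_quasiCompatible hL_one (by rintro _ ⟨u, rfl⟩; exact hL_bracket u) hqc hl
  have hfull : ∀ (S : Submodule ℂ V), one ∈ S → (∀ (u : U) (n : ℤ), ∀ v ∈ S,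
      mode (Y₀ u) n v ∈ S) → S = ⊤ := by
    intro S h1 h2
    rw [eq_top_iff, ← hspan, Submodule.span_le]
    rintro _ ⟨l, rfl⟩
    induction l with
    | nil => exact h1
    | cons q l ih => exact h2 q.1 q.2 _ ih
  have hmono : ∀ l : List (U × ℤ), IsMonomialField (Set.range Y₀)
      (ψ ((l.map fun q => mode (Y₀ q.1) q.2).prod one)) := by
    intro l
    induction l with
    | nil =>
      have : ψ (([].map fun q : U × ℤ => mode (Y₀ q.1) q.2).prod one) = idE V := hψ_one
      rw [this]
      exact .one
    | cons q l ih =>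
      have : ψ (((q :: l).map fun q : U × ℤ => mode (Y₀ q.1) q.2).prod one) = _ :=
        hψ q.1 q.2 ((l.map fun q => mode (Y₀ q.1) q.2).prod one)
      rw [this]
      exact .prod _ (Set.mem_range_self q.1) _ ih _
  -- By creation u = u_{-1} 1, hence ψ(u) = u(x)_{-1} 1_V. This is the x_0^0 coefficient of the
  -- Taylor expansion u(x + x_0), namely u(x).
  have hrange : ∀ u : U, ψ u = Y₀ u := by
    intro u
    refine LinearMap.ext fun w => ?_
    ext m
    have h1 := (IsRational.insert_idE (L₁ := [Y₀ u]) (L₂ := [])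
      (hS [Y₀ u] fun a ha => ⟨u, (List.mem_singleton.mp ha).symm⟩)).isOPE w
    obtain ⟨N, hN⟩ := exists_cf_eq_zero (Y₀ u) w
    have h2 := isOPE_constSnd (h := fun j => cf (Y₀ u) j w) hN
    have hB : constSnd (fun j => cf (Y₀ u) j w) =
        fun m => cf (Y₀ u) (m 0) (cf (idE V) (m 1) w) := by
      funext m
      rw [cf_idE, constSnd]
      split_ifs
      · rfl
      · exact (map_zero _).symm
    rw [hB] at h2
    have h3 := congrFun (h1.unique h2) ![0, m]
    have h4 := hψ u (-0 - 1) one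
    rw [hψ_one, mode, show (-(-0 - 1) - 1 : ℤ) = 0 by ring, (hcreate u).2] at h4
    simp only [Matrix.cons_val_zero, Matrix.cons_val_one, taylor] at h3
    rw [← h4] at h3
    simp at h3
    exact h3
  -- By linearity in each entry the states may be replaced, one after another, by spanning
  -- monomials, whose fields are iterated products.
  have hrat : ∀ l : List V, IsRational one (l.map ψ) := by
    have main : ∀ (l : List V) (L₁ : List (E V)),
        (∀ a ∈ L₁, IsMonomialField (Set.range Y₀) a) → IsRational one (L₁ ++ l.map ψ) := by
      intro l
      induction l with
      | nil =>
        intro L₁ hL₁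
        simpa using isRational_of_isMonomialField hS hL₁
      | cons v l ih =>
        intro L₁ hL₁
        have hv : v ∈ Submodule.span ℂ {v : V | ∃ l : List (U × ℤ),
          v = (l.map fun q => mode (Y₀ q.1) q.2).prod one} := hspan ▸ Submodule.mem_top
        rw [List.map_cons]
        induction hv using Submodule.span_induction with
        | mem v hv =>
          obtain ⟨q, rfl⟩ := hv
          have := ih (L₁ ++ [ψ ((q.map fun q => mode (Y₀ q.1) q.2).prod one)]) (by
            intro a ha
            rcases List.mem_append.mp ha with ha | ha
            · exact hL₁ a ha
            · rw [List.mem_singleton.mp ha]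
              exact hmono q)
          simpa using this
        | zero =>
          rw [map_zero]
          exact IsRational.of_zero _ _
        | add x y _ _ hx hy =>
          rw [map_add]
          exact hx.add hy
        | smul c x _ hx =>
          rw [map_smul]
          exact hx.smul c
    intro l
    simpa using main l [] (by simp)
  have hope : ∀ u ∈ U, ∀ v w, IsOPE (prodSeries (ψ u) (ψ v) w) (iterateSeries ψ u v w) := by
    intro u hu v w
    have h1 := (hrat [u, v]).isOPE (c := ψ u) (d := ψ v) w
    have hA : iterateSeries ψ u v w =
        fun e => cf (nthProduct (ψ u) (ψ v) (-e 0 - 1)) (e 1) w := by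
      funext e
      have h2 := hψ ⟨u, hu⟩ (-e 0 - 1) v
      rw [mode, show -(-e 0 - 1) - 1 = e 0 by ring, ← hrange] at h2
      show cf (ψ (cf (ψ u) (e 0) v)) (e 1) w = _
      rw [h2]
    rw [hA]
    exact h1
  have hgen : ∀ S : Submodule ℂ V, one ∈ S → (∀ u ∈ U, ∀ m, ∀ v ∈ S, cf (ψ u) m v ∈ S) →
      S = ⊤ := by
    intro S h1 h2
    refine hfull S h1 fun u n v hv => ?_
    rw [mode, ← hrange]
    exact h2 u u.2 _ v hv
  have hneg : ∀ v, ∀ m : ℤ, m < 0 → cf (ψ v) m one = 0 := fun v m hm =>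
    (hrat [v]).cf_eq_zero_of_neg hm
  -- The states satisfying creation form a subspace. It is closed under modes of U because Y(Y(u,
  -- x_0)v, x)1 and Y(u, x_0)Y(v, x)1 have the same constant term in x.
  have hconst : ∀ v, cf (ψ v) 0 one = v := by
    let S : Submodule ℂ V :=
      { carrier := {v | cf (ψ v) 0 one = v}
        add_mem' := fun {a b} ha hb => by
          simp only [Set.mem_ofPred_eq] at ha hb ⊢
          rw [map_add, cf_add, LinearMap.add_apply, ha, hb]
        zero_mem' := by
          simp only [Set.mem_ofPred_eq]
          rw [map_zero, cf_zero, LinearMap.zero_apply]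
        smul_mem' := fun c v hv => by
          simp only [Set.mem_ofPred_eq] at hv ⊢
          rw [map_smul, cf_smul, LinearMap.smul_apply, hv] }
    have hStop : S = ⊤ := by
      refine hgen S ?_ fun u hu m v hv => ?_
      · show cf (ψ one) 0 one = one
        rw [hψ_one, cf_idE, if_pos rfl]
      · show cf (ψ (cf (ψ u) m v)) 0 one = cf (ψ u) m v
        obtain ⟨P, hP, -, hPB⟩ := IsRational.named (l := [((0 : Fin 2), ψ u), (1, ψ v)])
          (one := one) ⟨by simp, fun i => by fin_cases i <;> simp⟩ (hrat [u, v])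
        have hB : namedProd [((0 : Fin 2), ψ u), (1, ψ v)] one = prodSeries (ψ u) (ψ v) one := by
          funext m
          simp [namedProd, prodSeries]
        rw [hB] at hPB
        have hv' : cf (ψ v) 0 one = v := hv
        have := IsOPE.eq_of_snd_eq_zero hP hPB (hope u hu v one)
          (fun m hm => by rw [prodSeries, hneg v _ hm, map_zero])
          (by
            obtain ⟨N, hN⟩ := exists_cf_eq_zero (ψ u) v
            refine ⟨N, fun m h1 h2 => ?_⟩
            rw [prodSeries, h1, hv', hN _ h2]) (m := ![m, 0]) rfl
        simpa [iterateSeries, prodSeries, hv'] using this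
    intro v
    have : v ∈ S := hStop ▸ Submodule.mem_top
    exact this
  exact ⟨hrange, hψ_one, fun v => ⟨hneg v, hconst v⟩, hrat, hope, hgen⟩

end Generated

/-! ### Composition of translations in three variables -/

section Dense

variable {ι V : Type*} [Fintype ι] [DecidableEq ι] [AddCommGroup V] [Module ℂ V]

/-- The constant series `v`. -/
def constSeries (ι : Type*) (v : V) [DecidableEq (ι → ℤ)] : (ι → ℤ) → V :=
  fun m => if m = 0 then v else 0

/-- The part of total degree `d`. -/
def degPart (d : ℤ) : Module.End ℂ ((ι → ℤ) → V) where
  toFun F m := if ∑ i, m i = d then F m else 0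
  map_add' F G := by
    funext m
    by_cases h : ∑ i, m i = d <;> simp [h]
  map_smul' c F := by
    funext m
    by_cases h : ∑ i, m i = d <;> simp [h]

lemma degPart_apply (d : ℤ) (F : (ι → ℤ) → V) (m : ι → ℤ) :
    degPart d F m = if ∑ i, m i = d then F m else 0 := rfl

lemma isPower_constSeries (v : V) : IsPower (constSeries ι v) := by
  rintro m ⟨i, hi⟩
  refine if_neg ?_
  rintro rfl
  exact absurd hi (by simp)

lemma act_monomial_constSeries (e : ι →₀ ℕ) (v : V) (m : ι → ℤ) :
    act (monomial e 1) (constSeries ι v) m = if m = (fun i => (e i : ℤ)) then v else 0 := by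
  rw [act_monomial, one_smul, constSeries]
  refine if_congr ?_ rfl rfl
  rw [← sub_eq_zero (a := m)]
  rfl

lemma degPart_eq_sum {F : (ι → ℤ) → V} (hF : IsPower F) (d : ℕ) :
    degPart (d : ℤ) F = ∑ e ∈ Finset.univ.finsuppAntidiag d,
      act (monomial e 1) (constSeries ι (F fun i => (e i : ℤ))) := by
  funext m
  rw [Finset.sum_apply, degPart_apply]
  simp only [act_monomial_constSeries]
  split_ifs with h
  · by_cases hm : ∃ i, m i < 0
    · rw [hF m hm, Finset.sum_eq_zero]
      intro e _
      split_ifs with h1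
      · rw [← h1, hF m hm]
      · rfl
    · push Not at hm
      set e₀ : ι →₀ ℕ := Finsupp.equivFunOnFinite.symm fun i => (m i).toNat
      have he : (fun i => (e₀ i : ℤ)) = m := by
        funext i
        simp [e₀, hm i]
      rw [Finset.sum_eq_single e₀]
      · rw [he, if_pos rfl]
      · intro e _ hne
        refine if_neg fun h1 => hne ?_
        ext i
        have := congrFun (he.trans h1) i
        simpa using this.symm
      · intro hn
        refine absurd ?_ hn
        rw [Finset.mem_finsuppAntidiag]
        refine ⟨?_, Finset.subset_univ _⟩
        have : ((∑ i, e₀ i : ℕ) : ℤ) = d := by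
          rw [Nat.cast_sum, ← h]
          exact Finset.sum_congr rfl fun i _ => congrFun he i
        exact_mod_cast this
  · refine (Finset.sum_eq_zero fun e he => if_neg fun h1 => h ?_).symm
    rw [Finset.mem_finsuppAntidiag] at he
    rw [h1, ← he.1]
    push_cast
    rfl

/-- Two semilinear operators which preserve the total degree agree on power series as soon as they
agree on constants. -/
lemma eq_of_semilinear {Φ Ψ : Module.End ℂ ((ι → ℤ) → V)}
    {σ : MvPolynomial ι ℂ →ₐ[ℂ] MvPolynomial ι ℂ}
    (hΦ : ∀ p F, IsPower F → Φ (act p F) = act (σ p) (Φ F))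
    (hΨ : ∀ p F, IsPower F → Ψ (act p F) = act (σ p) (Ψ F))
    (hΦd : ∀ d F, Φ (degPart d F) = degPart d (Φ F))
    (hΨd : ∀ d F, Ψ (degPart d F) = degPart d (Ψ F))
    (hΦp : ∀ F, IsPower F → IsPower (Φ F)) (hΨp : ∀ F, IsPower F → IsPower (Ψ F))
    (h0 : ∀ v, Φ (constSeries ι v) = Ψ (constSeries ι v)) {F : (ι → ℤ) → V} (hF : IsPower F) :
    Φ F = Ψ F := by
  funext m
  by_cases hm : ∃ i, m i < 0
  · rw [hΦp F hF m hm, hΨp F hF m hm]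
  push Not at hm
  obtain ⟨d, hd⟩ := Int.eq_ofNat_of_zero_le
    (Finset.sum_nonneg (s := Finset.univ) (f := m) fun i _ => hm i)
  have h1 : ∀ G : (ι → ℤ) → V, G m = degPart (d : ℤ) G m := fun G => (if_pos hd).symm
  -- A homogeneous part of a power series is a finite sum of monomials applied to constants, so
  -- semilinearity finishes the proof.
  rw [h1 (Φ F), h1 (Ψ F), ← hΦd, ← hΨd, degPart_eq_sum hF, map_sum, map_sum]
  refine congrFun (Finset.sum_congr rfl fun e _ => ?_) m
  rw [hΦ _ _ (isPower_constSeries _), hΨ _ _ (isPower_constSeries _), h0]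

lemma translate_degPart {i j : ι} (hij : i ≠ j) (N d : ℤ) (F : (ι → ℤ) → V) :
    translate i j N (degPart d F) = degPart d (translate i j N F) := by
  have hsum : ∀ (m : ι → ℤ) (k : ℤ), ∑ l, Function.update (Function.update m i (m i + k)) j (m j - k) l =
      ∑ l, m l := by
    intro m k
    have h : ∀ l, Function.update (Function.update m i (m i + k)) j (m j - k) l =
        m l + (Pi.single i k : ι → ℤ) l - (Pi.single j k : ι → ℤ) l := by
      intro l
      rcases eq_or_ne l j with rfl | hl
      · simp [hij.symm]
      · rcases eq_or_ne l i with rfl | hl'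
        · simp [hl]
        · simp [hl, hl']
    simp [h, Finset.sum_add_distrib, Finset.sum_sub_distrib]
  funext m
  rw [degPart_apply, translate_def, translate_def]
  simp only [degPart_apply, hsum]
  split_ifs
  · rfl
  · simp

lemma translate_constSeries {i j : ι} (hij : i ≠ j) (v : V) :
    translate i j 0 (constSeries ι v) = constSeries ι v := by
  funext m
  rw [translate_def, Finset.sum_range_succ']
  have h0 : ∀ k : ℕ, (Ring.choose (m i + (k + 1 : ℕ)) (k + 1) : ℤ) • constSeries ι v
      (Function.update (Function.update m i (m i + (k + 1 : ℕ))) j (m j - (k + 1 : ℕ))) = 0 := by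
    intro k
    unfold constSeries
    split_ifs with h
    · have := congrFun h i
      rw [Function.update_of_ne hij, Function.update_self] at this
      rw [this, Pi.zero_apply, choose_eq_zero_of_nonneg_of_lt le_rfl (by omega), zero_smul]
    · rw [smul_zero]
  rw [Finset.sum_eq_zero fun k _ => h0 k]
  simp

lemma shiftHom_comp_comm {i j k : ι} (hij : i ≠ j) (hik : i ≠ k) (hjk : j ≠ k) :
    (shiftHom j k).comp (shiftHom i j) =
      (shiftHom i j).comp ((shiftHom i k).comp (shiftHom j k)) := by
  refine algHom_ext fun l => ?_
  simp only [AlgHom.comp_apply]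
  rcases eq_or_ne l i with rfl | hi
  · simp only [shiftHom_X_self, shiftHom_X_of_ne _ hij, shiftHom_X_of_ne _ hik.symm, map_add]
    ring
  · rcases eq_or_ne l j with rfl | hj
    · simp only [shiftHom_X_self, shiftHom_X_of_ne _ hi, shiftHom_X_of_ne _ hik.symm, map_add]
    · simp only [shiftHom_X_of_ne _ hi, shiftHom_X_of_ne _ hj]

lemma shiftHom_shiftHom_comm {i j k : ι} (hij : i ≠ j) (hik : i ≠ k) (hjk : j ≠ k)
    (p : MvPolynomial ι ℂ) :
    shiftHom j k (shiftHom i j p) = shiftHom i j (shiftHom i k (shiftHom j k p)) :=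
  DFunLike.congr_fun (shiftHom_comp_comm hij hik hjk) p

/-- Both sides are F(x_i + x_j + x_k, x_j + x_k, x_k). -/
lemma translate_comm {i j k : ι} (hij : i ≠ j) (hik : i ≠ k) (hjk : j ≠ k) {F : (ι → ℤ) → V}
    (hF : IsPower F) :
    translate j k 0 (translate i j 0 F) =
      translate i j 0 (translate i k 0 (translate j k 0 F)) := by
  refine eq_of_semilinear (Φ := translate j k 0 ∘ₗ translate i j 0)
    (Ψ := translate i j 0 ∘ₗ translate i k 0 ∘ₗ translate j k 0)
    (σ := (shiftHom j k).comp (shiftHom i j)) ?_ ?_ ?_ ?_ ?_ ?_ ?_ hF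
  · intro p F hF
    simp only [LinearMap.comp_apply, AlgHom.comp_apply]
    rw [translate_act hij _ (hF.eq_zero_of_lt j), translate_act hjk _
      ((hF.translate hij).eq_zero_of_lt k)]
  · intro p F hF
    simp only [LinearMap.comp_apply]
    rw [shiftHom_comp_comm hij hik hjk, AlgHom.comp_apply, AlgHom.comp_apply,
      translate_act hjk _ (hF.eq_zero_of_lt k),
      translate_act hik _ ((hF.translate hjk).eq_zero_of_lt k), translate_act hij _
      (((hF.translate hjk).translate hik).eq_zero_of_lt j)]
  · intro d F
    simp only [LinearMap.comp_apply, translate_degPart hij, translate_degPart hjk]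
  · intro d F
    simp only [LinearMap.comp_apply, translate_degPart hij, translate_degPart hjk,
      translate_degPart hik]
  · exact fun F hF => (hF.translate hij).translate hjk
  · exact fun F hF => ((hF.translate hjk).translate hik).translate hij
  · intro v
    simp only [LinearMap.comp_apply, translate_constSeries hij, translate_constSeries hjk,
      translate_constSeries hik]

end Dense

/-! ### Associativity of operator products for all states -/

section Pentagon

variable {V : Type*} [AddCommGroup V] [Module ℂ V]

lemma slice_act_rename_succ (q : MvPolynomial (Fin 2) ℂ) (F : (Fin 3 → ℤ) → V) (t : Fin 3 → ℤ) :
    slice 1 2 t (act (rename Fin.succ q) F) = act q (slice 1 2 t F) := by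
  induction q using MvPolynomial.induction_on generalizing F with
  | C c => rw [rename_C, act_C, act_C, map_smul]
  | add p q hp hq => rw [map_add, act_add, act_add, map_add, hp, hq]
  | mul_X p k hp =>
    rw [map_mul, act_mul, act_mul, hp, rename_X]
    congr 1
    obtain rfl | rfl : k = 0 ∨ k = 1 := by omega
    · exact slice_act_X_fst (by decide) t F
    · exact slice_act_X_snd (by decide) t F

lemma shiftHom_rename_succ (q : MvPolynomial (Fin 2) ℂ) :
    shiftHom 1 2 (rename Fin.succ q : MvPolynomial (Fin 3) ℂ) = rename Fin.succ (shiftHom 0 1 q) := by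
  have : (shiftHom (1 : Fin 3) 2).comp (rename Fin.succ) =
      (rename (R := ℂ) Fin.succ).comp (shiftHom (0 : Fin 2) 1) := by
    refine algHom_ext fun k => ?_
    obtain rfl | rfl : k = 0 ∨ k = 1 := by omega
    · simp only [AlgHom.comp_apply, rename_X, shiftHom_X_self, map_add]
      exact shiftHom_X_self _ _
    · simp only [AlgHom.comp_apply, rename_X]
      rw [shiftHom_X_of_ne (1 : Fin 2) (by decide : (1 : Fin 2) ≠ 0), rename_X]
      exact shiftHom_X_of_ne _ (by decide)
  exact DFunLike.congr_fun this q

/-- Operator product expansions in the last two variables, for all coefficients of the first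
variable, can be checked after multiplication with a polynomial with a leading coefficient in the
first variable. -/
lemma isOPE_slice_of_act {B A : (Fin 3 → ℤ) → V} {R : MvPolynomial (Fin 2) ℂ} (hR : R ≠ 0) {e : ℕ}
    {R' : MvPolynomial (Fin 3) ℂ}
    (h : ∀ t, IsOPE (slice 1 2 t (act (X 0 ^ e * (rename Fin.succ R + X 0 * R')) B))
      (slice 1 2 t (act (shiftHom 1 2 (X 0 ^ e * (rename Fin.succ R + X 0 * R'))) A)))
    (hA : ∀ t, IsIterated 0 1 (slice 1 2 t A)) {N : ℤ} (hBN : ∀ m, m 0 < N → B m = 0)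
    (hAN : ∀ m, m 0 < N → A m = 0) (t : Fin 3 → ℤ) : IsOPE (slice 1 2 t B) (slice 1 2 t A) := by
  have hX0 : ∀ (t : Fin 3 → ℤ) (F : (Fin 3 → ℤ) → V), slice 1 2 t (act (X 0) F) =
      slice 1 2 (Function.update t 0 (t 0 - 1)) F := fun t F =>
    slice_act_X_of_ne (by decide) (by decide) t F
  have hs : shiftHom 1 2 (X 0 : MvPolynomial (Fin 3) ℂ) = X 0 := shiftHom_X_of_ne _ (by decide)
  have hX0e : ∀ (e : ℕ) (t : Fin 3 → ℤ) (F : (Fin 3 → ℤ) → V), slice 1 2 t (act (X 0 ^ e) F) =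
      slice 1 2 (Function.update t 0 (t 0 - e)) F := by
    intro e
    induction e with
    | zero => simp
    | succ e ih =>
      intro t F
      rw [pow_succ', act_mul, hX0, ih]
      simp only [Function.update_self, Function.update_idem]
      rw [show t 0 - 1 - (e : ℤ) = t 0 - ((e + 1 : ℕ) : ℤ) by push_cast; ring]
  -- Induction on the power of x_0. At a given power, R times the slice equals the given slice minus
  -- a contribution of R' from lower powers.
  have key : ∀ n : ℕ, ∀ t : Fin 3 → ℤ, t 0 < N + n → IsOPE (slice 1 2 t B) (slice 1 2 t A) := by
    intro n
    induction n with
    | zero =>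
      intro t ht
      have h0 : ∀ F : (Fin 3 → ℤ) → V, (∀ m, m 0 < N → F m = 0) → slice 1 2 t F = 0 := by
        intro F hF
        funext e
        rw [slice_apply, hF _ (by simpa using ht)]
        rfl
      rw [h0 B hBN, h0 A hAN]
      exact IsOPE.zero
    | succ n ih =>
      intro t ht
      refine IsOPE.of_act hR (hA t) ?_
      have h1 := h (Function.update t 0 (t 0 + e))
      rw [act_mul, map_mul, act_mul, map_pow (shiftHom 1 2), hs, hX0e, hX0e] at h1
      simp only [Function.update_self, add_sub_cancel_right, Function.update_idem,
        Function.update_eq_self] at h1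
      rw [act_add, map_add, slice_act_rename_succ, map_add (shiftHom 1 2), act_add, map_add,
        shiftHom_rename_succ, slice_act_rename_succ, map_mul (shiftHom 1 2), hs, act_mul, act_mul, hX0,
        hX0] at h1
      set t' := Function.update t 0 (t 0 - 1) with ht'
      -- The series is truncated above the lower powers of x_0, so that `IsOPE.slice_act` requires
      -- the expansion only where the induction hypothesis supplies it.
      let tr : ((Fin 3 → ℤ) → V) → (Fin 3 → ℤ) → V := fun F m => if m 0 < t 0 then F m else 0
      have htr : ∀ (p : MvPolynomial (Fin 3) ℂ) (F : (Fin 3 → ℤ) → V),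
          slice 1 2 t' (act p F) = slice 1 2 t' (act p (tr F)) := by
        intro p F
        have h2 : ∀ m : Fin 3 → ℤ, m 0 < t 0 → act p (F - tr F) m = 0 := by
          intro m hm
          refine act_eq_zero_of_mem (Z := {m : Fin 3 → ℤ | m 0 < t 0}) (fun m hm e => ?_)
            (fun m hm => ?_) p m hm
          · simp only [Set.mem_ofPred_eq] at hm ⊢
            omega
          · simp only [Set.mem_ofPred_eq] at hm
            simp [tr, hm]
        funext e
        rw [slice_apply, slice_apply]
        have := h2 (Function.update (Function.update t' 1 (e 0)) 2 (e 1)) (by simp [ht'])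
        rw [map_sub, Pi.sub_apply] at this
        exact sub_eq_zero.mp this
      have h3 : IsOPE (slice 1 2 t' (act R' B)) (slice 1 2 t' (act (shiftHom 1 2 R') A)) := by
        rw [htr, htr _ A]
        refine IsOPE.slice_act (by decide) (fun s => ?_) R' t'
        have hst : ∀ F, slice 1 2 s (tr F) = if s 0 < t 0 then slice 1 2 s F else 0 := by
          intro F
          funext e
          rw [slice_apply]
          simp only [tr]
          split_ifs with h4 h5 h5
          · rfl
          · exact absurd h4 (by simpa using h5)
          · exact absurd h5 (by simpa using h4)
          · rfl
        rw [hst, hst]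
        split_ifs with h4
        · exact ih s (by push_cast at ht; omega)
        · exact IsOPE.zero
      have h4 := h1.sub h3
      rwa [add_sub_cancel_right, add_sub_cancel_right] at h4
  exact key (t 0 - N + 1).toNat t (by omega)

variable {Y : V →ₗ[ℂ] E V} {one : V} {U : Set V}

lemma isIterated_iterateSeries (Y : V →ₗ[ℂ] E V) (u v w : V) :
    IsIterated 0 1 (iterateSeries Y u v w) := by
  constructor
  · obtain ⟨N, hN⟩ := exists_cf_eq_zero (Y u) v
    exact ⟨N, fun m hm => by rw [iterateSeries, hN _ hm, map_zero, cf_zero, LinearMap.zero_apply]⟩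
  · intro a
    obtain ⟨M, hM⟩ := exists_cf_eq_zero (Y (cf (Y u) a v)) w
    exact ⟨M, fun m h1 h2 => by rw [iterateSeries, h1, hM _ h2]⟩

lemma slice_eq_of_eq {ι : Type*} [DecidableEq ι] {i j : ι} {F : (ι → ℤ) → V} {G : (Fin 2 → ℤ) → V}
    {t : ι → ℤ} (h : ∀ a b, F (Function.update (Function.update t i a) j b) = G ![a, b]) :
    slice i j t F = G := by
  funext e
  rw [slice_apply, h, ← vec_eta e]

/-- The triple product Y(c)Y(d)Y(v)w can be contracted as (cd)v or as c(dv). All edges of the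
resulting pentagon are known except the one from (cd), v to (cd)v, and this edge follows from the
others because translations compose consistently. -/
lemma IsGenerated.isOPE_cf (h : IsGenerated Y one U) {c : V} (hc : c ∈ U) {d : V}
    (hd : ∀ v w, IsOPE (prodSeries (Y d) (Y v) w) (iterateSeries Y d v w)) (m : ℤ) (v w : V) :
    IsOPE (prodSeries (Y (cf (Y c) m d)) (Y v) w) (iterateSeries Y (cf (Y c) m d) v w) := by
  -- The known edges are T → T₁ and T₃ → T₄ in x_0, x_1, then T → T₂ in x_1, x_2, and T₂ → T₃ in
  -- x_0, x_2. The edge sought is T₁ → T₄ in x_1, x_2.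
  set T : (Fin 3 → ℤ) → V := fun m => cf (Y c) (m 0) (cf (Y d) (m 1) (cf (Y v) (m 2) w)) with hT
  set T₁ : (Fin 3 → ℤ) → V := fun m => cf (Y (cf (Y c) (m 0) d)) (m 1) (cf (Y v) (m 2) w) with hT₁
  set T₂ : (Fin 3 → ℤ) → V := fun m => cf (Y c) (m 0) (cf (Y (cf (Y d) (m 1) v)) (m 2) w) with hT₂
  set T₃ : (Fin 3 → ℤ) → V := fun m => cf (Y (cf (Y c) (m 0) (cf (Y d) (m 1) v))) (m 2) w with hT₃
  set T₄ : (Fin 3 → ℤ) → V := fun m => cf (Y (cf (Y (cf (Y c) (m 0) d)) (m 1) v)) (m 2) w with hT₄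
  have h01 : ∀ t, IsOPE (slice 0 1 t T) (slice 0 1 t T₁) := by
    intro t
    have h1 := h.isOPE c hc d (cf (Y v) (t 2) w)
    convert h1 using 1
    · exact slice_eq_of_eq fun a b => by simp [hT, prodSeries]
    · exact slice_eq_of_eq fun a b => by simp [hT₁, iterateSeries]
  have h12 : ∀ t, IsOPE (slice 1 2 t T) (slice 1 2 t T₂) := by
    intro t
    have h1 := (hd v w).map (cf (Y c) (t 0))
    convert h1 using 1
    · exact slice_eq_of_eq fun a b => by simp [hT, prodSeries]
    · exact slice_eq_of_eq fun a b => by simp [hT₂, iterateSeries]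
  have h02 : ∀ t, IsOPE (slice 0 2 t T₂) (slice 0 2 t T₃) := by
    intro t
    have h1 := h.isOPE c hc (cf (Y d) (t 1) v) w
    convert h1 using 1
    · exact slice_eq_of_eq fun a b => by simp [hT₂, prodSeries]
    · exact slice_eq_of_eq fun a b => by simp [hT₃, iterateSeries]
  have h01' : ∀ t, IsOPE (slice 0 1 t T₃) (slice 0 1 t T₄) := by
    intro t
    let f : V →ₗ[ℂ] V :=
      { toFun := fun u => cf (Y u) (t 2) w
        map_add' := fun a b => by rw [map_add, cf_add, LinearMap.add_apply]
        map_smul' := fun a b => by rw [map_smul, cf_smul, LinearMap.smul_apply]; rfl }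
    have h1 := (h.isOPE c hc d v).map f
    convert h1 using 1
    · exact slice_eq_of_eq fun a b => by simp [hT₃, prodSeries, f]
    · exact slice_eq_of_eq fun a b => by simp [hT₄, iterateSeries, f]
  obtain ⟨P, hP, hPT, -⟩ := IsRational.named
    (l := [((0 : Fin 3), Y c), (1, Y d), (2, Y v)]) (one := one)
    ⟨by simp, fun i => by fin_cases i <;> simp⟩ (h.rational [c, d, v])
  have hTn : namedProd [((0 : Fin 3), Y c), (1, Y d), (2, Y v)] w = T := by
    funext m
    simp [namedProd, hT]
  obtain ⟨N, hH⟩ := isLowerTruncated_iff.mp (hPT w)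
  rw [hTn, ← act_mul] at hH
  set Q := (∏ i, X i) ^ N * P with hQ
  obtain ⟨e, R, hR, hlead⟩ := exists_hasLead (0 : Fin 2) hP
  obtain ⟨R', hR'⟩ := ((hasLead_prod_X (j := (0 : Fin 2))).pow N).mul hlead
  rw [← hQ, show Fin.succ (0 : Fin 2) = 1 from rfl] at hR'
  have e1 := IsOPE.transfer (by decide) h01 hH
  have e2 := IsOPE.transfer (by decide) h12 hH
  have p2 : IsPower (act (shiftHom 1 2 Q) T₂) := e2 ▸ hH.translate (by decide)
  have e3 := IsOPE.transfer (by decide) h02 p2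
  have p3 : IsPower (act (shiftHom 0 2 (shiftHom 1 2 Q)) T₃) := e3 ▸ p2.translate (by decide)
  have e4 := IsOPE.transfer (by decide) h01' p3
  rw [e3, e2] at e4
  -- The chain through T₂ and T₃ becomes: the shift of Q along x_0, x_1 clears T₁, and translating
  -- the result in x_1, x_2 gives the shifted polynomial times T₄.
  rw [← shiftHom_shiftHom_comm (by decide) (by decide) (by decide), ← translate_comm (by decide) (by decide) (by decide) hH, ← e1] at e4
  have p1 : IsPower (act (shiftHom 0 1 Q) T₁) := e1 ▸ hH.translate (by decide)
  rw [hR'] at e4 p1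
  obtain ⟨M, hM⟩ := exists_cf_eq_zero (Y c) d
  -- The clearing polynomial still involves x_0; its lead permits passage to the coefficients of
  -- x_0.
  have hfin := isOPE_slice_of_act (B := T₁) (A := T₄) (e := 0 + e) (R' := R')
    (R := (X 0 * ∏ i, X i) ^ N * R) ?_ (fun t => ?_) (fun t => ?_) (N := M)
    (fun m hm => ?_) (fun m hm => ?_) (Function.update 0 0 m)
  · convert hfin using 1
    · exact (slice_eq_of_eq fun a b => by simp [hT₁, prodSeries]).symm
    · exact (slice_eq_of_eq fun a b => by simp [hT₄, iterateSeries]).symm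
  · exact mul_ne_zero (pow_ne_zero _ (mul_ne_zero (X_ne_zero _)
      (Finset.prod_ne_zero_iff.mpr fun i _ => X_ne_zero i))) (ne_zero_of_mem_diffMonoid hR)
  · rw [e4, slice_translate (by decide)]
    exact IsOPE.of_isPower (p1.slice (by decide) t)
  · have h1 := isIterated_iterateSeries Y (cf (Y c) (t 0) d) v w
    convert h1 using 1
    exact slice_eq_of_eq fun a b => by simp [hT₄, iterateSeries]
  · simp only [hT₁]
    rw [hM _ hm, map_zero, cf_zero, LinearMap.zero_apply]
  · simp only [hT₄]
    rw [hM _ hm, map_zero, cf_zero, LinearMap.zero_apply, map_zero, cf_zero, LinearMap.zero_apply]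

/-- Operator product expansions hold for all pairs of states. -/
theorem IsGenerated.isOPE_all (h : IsGenerated Y one U) (u v w : V) :
    IsOPE (prodSeries (Y u) (Y v) w) (iterateSeries Y u v w) := by
  let S : Submodule ℂ V :=
    { carrier := {u | ∀ v w, IsOPE (prodSeries (Y u) (Y v) w) (iterateSeries Y u v w)}
      add_mem' := fun {a b} ha hb v w => by
        convert (ha v w).add (hb v w) using 1 <;> funext m <;>
          simp [prodSeries, iterateSeries, cf_add]
      zero_mem' := fun v w => by
        convert IsOPE.zero (V := V) using 1 <;> funext m <;>
          simp [prodSeries, iterateSeries, cf_zero]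
      smul_mem' := fun c a ha v w => by
        convert (ha v w).smul c using 1 <;> funext m <;>
          simp [prodSeries, iterateSeries, cf_smul] }
  have hS : S = ⊤ := by
    refine h.span S (fun v w => ?_) fun c hc m d hd v w => h.isOPE_cf hc hd m v w
    obtain ⟨N, hN⟩ := exists_cf_eq_zero (Y v) w
    have hA : iterateSeries Y one v w = prodSeries (Y one) (Y v) w := by
      funext m
      rw [iterateSeries, prodSeries, h.vacuum, cf_idE, cf_idE]
      split_ifs
      · rfl
      · rw [map_zero, cf_zero, LinearMap.zero_apply]
    -- For the vacuum the product is constant in the first variable. It is therefore its own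
    -- re-expansion, and only the poles of Y(v, x_1)w need clearing.
    refine ⟨isIterated_iterateSeries Y one v w, X 1 ^ (-N).toNat, pow_ne_zero _ (X_ne_zero _), ?_, ?_⟩
    · rintro m ⟨i, hi⟩
      rw [act_X_pow, prodSeries, h.vacuum, cf_idE]
      obtain rfl | rfl : i = 0 ∨ i = 1 := by omega
      · rw [if_neg]
        simp only [Function.update_of_ne IsOPE.zero_ne_one]
        omega
      · rw [hN _ (by simp; omega), ite_self]
    · have hB : ∀ m : Fin 2 → ℤ, m 1 < 0 →
          act (X 1 ^ (-N).toNat) (prodSeries (Y one) (Y v) w) m = 0 := by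
        intro m hm
        rw [act_X_pow, prodSeries, hN _ (by simp; omega), map_zero]
      rw [map_pow, shiftHom_X_of_ne _ (by decide), hA]
      funext m
      rw [translate_def, Finset.sum_range_succ', Finset.sum_eq_zero, zero_add]
      · simp
      · intro k _
        rw [act_X_pow, prodSeries, h.vacuum, cf_idE]
        split_ifs with h0
        · have h1 : m 0 + ((k + 1 : ℕ) : ℤ) = 0 := by simpa using h0
          rw [h1, choose_eq_zero_of_nonneg_of_lt le_rfl (by omega), zero_smul]
        · rw [smul_zero]
  have : u ∈ S := hS ▸ Submodule.mem_top
  exact this v w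

end Pentagon

/-! ### Locally finite series -/

section LocallyFinite

variable {ι V : Type*} [AddCommGroup V] [Module ℂ V]

/-- Each coefficient of the product of `F` with a power series is a finite sum. -/
def LocFin (F : (ι → ℤ) → V) : Prop :=
  ∀ m : ι → ℤ, {e : ι → ℕ | F (fun i => m i - (e i : ℤ)) ≠ 0}.Finite

lemma LocFin.add {F G : (ι → ℤ) → V} (hF : LocFin F) (hG : LocFin G) : LocFin (F + G) := by
  intro m
  refine ((hF m).union (hG m)).subset fun e he => ?_
  by_contra h
  simp only [Set.mem_union, Set.mem_ofPred_eq, not_or, not_not] at h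
  exact he (by rw [Pi.add_apply, h.1, h.2, add_zero])

lemma LocFin.zero : LocFin (0 : (ι → ℤ) → V) := fun m => by simp

lemma LocFin.sum {α : Type*} {s : Finset α} {F : α → (ι → ℤ) → V} (h : ∀ a ∈ s, LocFin (F a)) :
    LocFin (∑ a ∈ s, F a) :=
  Finset.sum_induction _ _ (fun _ _ => LocFin.add) LocFin.zero h

lemma LocFin.map {V' : Type*} [AddCommGroup V'] [Module ℂ V'] (f : V →ₗ[ℂ] V')
    {F : (ι → ℤ) → V} (hF : LocFin F) : LocFin fun m => f (F m) :=
  fun m => (hF m).subset fun e he h => he (by simp only [h, map_zero])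

lemma LocFin.smul {F : (ι → ℤ) → V} (hF : LocFin F) (c : ℂ) : LocFin (c • F) :=
  hF.map (c • LinearMap.id : V →ₗ[ℂ] V)

lemma LocFin.neg {F : (ι → ℤ) → V} (hF : LocFin F) : LocFin (-F) :=
  hF.map (-LinearMap.id : V →ₗ[ℂ] V)

lemma LocFin.sub {F G : (ι → ℤ) → V} (hF : LocFin F) (hG : LocFin G) : LocFin (F - G) := by
  rw [sub_eq_add_neg]
  exact hF.add hG.neg

/-- A series each of whose coefficients is controlled by coefficients of `F` of lower exponent. -/
lemma LocFin.of_forall_exists [Finite ι] {F G : (ι → ℤ) → V} (hF : LocFin F)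
    (h : ∀ m, G m ≠ 0 → ∃ e : ι → ℕ, F (fun i => m i - (e i : ℤ)) ≠ 0) : LocFin G := by
  intro m
  have := Fintype.ofFinite ι
  classical
  refine ((hF m).biUnion fun e _ => Set.finite_Icc (0 : ι → ℕ) e).subset fun e he => ?_
  obtain ⟨e', he'⟩ := h _ he
  simp only [Set.mem_iUnion]
  refine ⟨e + e', ?_, ?_⟩
  · simp only [Set.mem_ofPred_eq, Pi.add_apply]
    convert he' using 3
    push_cast
    ring
  · exact ⟨fun i => Nat.zero_le _, fun i => Nat.le_add_right _ _⟩

lemma LocFin.act [Finite ι] {F : (ι → ℤ) → V} (hF : LocFin F) (p : MvPolynomial ι ℂ) :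
    LocFin (act p F) := by
  refine hF.of_forall_exists fun m hm => ?_
  rw [act_eq_sum] at hm
  obtain ⟨e, -, he⟩ := Finset.exists_ne_zero_of_sum_ne_zero hm
  exact ⟨e, fun h0 => he (by rw [h0, smul_zero])⟩

lemma IsPower.locFin [Finite ι] {F : (ι → ℤ) → V} (hF : IsPower F) : LocFin F := by
  intro m
  have := Fintype.ofFinite ι
  classical
  refine (Set.finite_Icc (0 : ι → ℕ) fun i => (m i).toNat).subset fun e he =>
    ⟨fun i => Nat.zero_le _, fun i => ?_⟩
  by_contra h
  refine he (hF _ ⟨i, ?_⟩)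
  simp only at h ⊢
  omega

lemma LocFin.of_level {F : (ι → ℤ) → V} (i : ι) (h1 : ∃ N : ℤ, ∀ m, m i < N → F m = 0)
    (h2 : ∀ a, LocFin fun m => if m i = a then F m else 0) : LocFin F := by
  intro m
  obtain ⟨N, hN⟩ := h1
  refine ((Set.finite_Icc N (m i)).biUnion fun a _ => h2 a m).subset fun e he => ?_
  simp only [Set.mem_iUnion]
  refine ⟨m i - e i, ⟨?_, by omega⟩, ?_⟩
  · by_contra h
    exact he (hN _ (by simpa using h))
  · simpa using he

lemma LocFin.of_point {F : (ι → ℤ) → V} (p : ι → ℤ) (h : ∀ m, m ≠ p → F m = 0) : LocFin F := by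
  intro m
  refine Set.Subsingleton.finite fun e he e' he' => ?_
  have h1 : (fun i => m i - (e i : ℤ)) = p := by
    by_contra h1
    exact he (h _ h1)
  have h2 : (fun i => m i - (e' i : ℤ)) = p := by
    by_contra h1
    exact he' (h _ h1)
  funext i
  have : m i - (e i : ℤ) = m i - (e' i : ℤ) := congrFun (h1.trans h2.symm) i
  omega

lemma IsIterated.locFin {i j : Fin 2} (hij : i ≠ j) {F : (Fin 2 → ℤ) → V} (hF : IsIterated i j F) :
    LocFin F := by
  obtain ⟨h1, h2⟩ := hF
  refine LocFin.of_level i h1 fun a => LocFin.of_level j ?_ fun b => ?_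
  · obtain ⟨M, hM⟩ := h2 a
    refine ⟨M, fun m hm => ?_⟩
    show ite _ _ _ = (0 : V)
    split_ifs with h
    · exact hM m h hm
    · rfl
  · refine LocFin.of_point (Function.update (fun _ => b) i a) fun m hm => ?_
    show ite _ (ite _ _ _) _ = (0 : V)
    split_ifs with hb ha
    · refine absurd ?_ hm
      funext l
      rcases eq_or_ne l i with rfl | hl
      · simpa using ha
      · obtain rfl : l = j := by omega
        simpa [hl] using hb
    · rfl
    · rfl

/-- The hypotheses describe V((x_k))((x_j))((x_i)). Finiteness is found one variable at a time,
starting with x_i. -/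
lemma locFin_of_three {i j k : Fin 3} (hij : i ≠ j) (hik : i ≠ k) (hjk : j ≠ k)
    {F : (Fin 3 → ℤ) → V} (h1 : ∃ N : ℤ, ∀ m, m i < N → F m = 0)
    (h2 : ∀ a, ∃ N : ℤ, ∀ m, m i = a → m j < N → F m = 0)
    (h3 : ∀ a b, ∃ N : ℤ, ∀ m, m i = a → m j = b → m k < N → F m = 0) : LocFin F := by
  refine LocFin.of_level i h1 fun a => LocFin.of_level j ?_ fun b => LocFin.of_level k ?_ fun c => ?_
  · obtain ⟨M, hM⟩ := h2 a
    refine ⟨M, fun m hm => ?_⟩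
    show ite _ _ _ = (0 : V)
    split_ifs with h
    · exact hM m h hm
    · rfl
  · obtain ⟨M, hM⟩ := h3 a b
    refine ⟨M, fun m hm => ?_⟩
    show ite _ (ite _ _ _) _ = (0 : V)
    split_ifs with h h'
    · exact hM m h' h hm
    · rfl
    · rfl
  · refine LocFin.of_point (Function.update (Function.update (fun _ => c) j b) i a) fun m hm => ?_
    show ite _ (ite _ (ite _ _ _) _) _ = (0 : V)
    split_ifs with hc hb ha
    · refine absurd ?_ hm
      funext l
      rcases eq_or_ne l i with rfl | hl
      · simpa using ha
      · rcases eq_or_ne l j with rfl | hl'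
        · simpa [hl] using hb
        · obtain rfl : l = k := by omega
          simpa [hl, hl'] using hc
    · rfl
    · rfl
    · rfl

end LocallyFinite

/-! ### The action of power series in a polynomial -/

section PowerSeriesAction

variable {ι V : Type*} [Fintype ι] [AddCommGroup V] [Module ℂ V]

/-- The action of the power series `φ(ε)`. -/
def psAct (φ : PowerSeries ℂ) (ε : MvPolynomial ι ℂ) (F : (ι → ℤ) → V) : (ι → ℤ) → V :=
  fun m => ∑ᶠ n : ℕ, PowerSeries.coeff n φ • act (ε ^ n) F m

/-- Without constant term, ε^n has only monomials of total degree at least n. On locally finite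
series φ(ε) is therefore a finite sum in each coefficient. -/
lemma act_pow_eq_zero {ε : MvPolynomial ι ℂ} (hε : constantCoeff ε = 0) {F : (ι → ℤ) → V} (n : ℕ)
    {m : ι → ℤ} (h : ∀ e : ι → ℕ, n ≤ ∑ i, e i → F (fun i => m i - (e i : ℤ)) = 0) :
    act (ε ^ n) F m = 0 := by
  induction n generalizing m with
  | zero => simpa using h 0 (Nat.zero_le _)
  | succ n ih =>
    rw [pow_succ', act_mul, act_eq_sum]
    refine Finset.sum_eq_zero fun e he => ?_
    rw [ih, smul_zero]
    intro e' he'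
    have h1 : 1 ≤ ∑ i, e i := by
      by_contra h0
      have h2 : ∑ i, e i = 0 := by omega
      rw [Finset.sum_eq_zero_iff] at h2
      have : e = 0 := by
        ext i
        simpa using h2 i
      rw [this, mem_support_iff] at he
      exact he hε
    have := h (e + e') (by
      simp only [Pi.add_apply, Finset.sum_add_distrib]
      omega)
    convert this using 2
    funext i
    simp only [Pi.add_apply]
    push_cast
    ring

lemma LocFin.exists_bound {F : (ι → ℤ) → V} (hF : LocFin F) {ε : MvPolynomial ι ℂ}
    (hε : constantCoeff ε = 0) (m : ι → ℤ) : ∃ K : ℕ, ∀ n, K ≤ n → FormalVA.act (ε ^ n) F m = 0 := by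
  obtain ⟨K, hK⟩ := ((hF m).image fun e => ∑ i, e i).bddAbove
  refine ⟨K + 1, fun n hn => act_pow_eq_zero hε n fun e he => ?_⟩
  by_contra h
  have := hK ⟨e, h, rfl⟩
  simp only at this
  omega

lemma psAct_eq_sum {φ : PowerSeries ℂ} {ε : MvPolynomial ι ℂ} {F : (ι → ℤ) → V} {m : ι → ℤ} {K : ℕ}
    (hK : ∀ n, K ≤ n → act (ε ^ n) F m = 0) :
    psAct φ ε F m = ∑ n ∈ Finset.range K, PowerSeries.coeff n φ • act (ε ^ n) F m := by
  refine finsum_eq_sum_of_support_subset _ fun n hn => ?_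
  simp only [Finset.coe_range, Set.mem_Iio]
  by_contra h
  exact hn (by simp only [hK n (by omega), smul_zero])

variable {ε : MvPolynomial ι ℂ} {F G : (ι → ℤ) → V}

lemma LocFin.psAct (hF : LocFin F) (hε : constantCoeff ε = 0) (φ : PowerSeries ℂ) :
    LocFin (psAct φ ε F) := by
  refine hF.of_forall_exists fun m hm => ?_
  obtain ⟨K, hK⟩ := hF.exists_bound hε m
  rw [psAct_eq_sum hK] at hm
  obtain ⟨n, -, hn⟩ := Finset.exists_ne_zero_of_sum_ne_zero hm
  have hn' : FormalVA.act (ε ^ n) F m ≠ 0 := fun h => hn (by rw [h, smul_zero])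
  rw [act_eq_sum] at hn'
  obtain ⟨e, -, he⟩ := Finset.exists_ne_zero_of_sum_ne_zero hn'
  exact ⟨e, fun h0 => he (by rw [h0, smul_zero])⟩

lemma IsPower.psAct (hF : IsPower F) (φ : PowerSeries ℂ) : IsPower (psAct φ ε F) := by
  intro m hm
  refine finsum_eq_zero_of_forall_eq_zero fun n => ?_
  rw [hF.act _ m hm, smul_zero]

lemma psAct_add (hF : LocFin F) (hG : LocFin G) (hε : constantCoeff ε = 0) (φ : PowerSeries ℂ) :
    psAct φ ε (F + G) = psAct φ ε F + psAct φ ε G := by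
  funext m
  obtain ⟨K, hK⟩ := hF.exists_bound hε m
  obtain ⟨K', hK'⟩ := hG.exists_bound hε m
  rw [Pi.add_apply, psAct_eq_sum (K := max K K') fun n hn => hK n (by omega),
    psAct_eq_sum (K := max K K') fun n hn => hK' n (by omega),
    psAct_eq_sum (K := max K K') fun n hn => by
      rw [map_add, Pi.add_apply, hK n (by omega), hK' n (by omega), add_zero],
    ← Finset.sum_add_distrib]
  exact Finset.sum_congr rfl fun n _ => by rw [map_add, Pi.add_apply, smul_add]

lemma psAct_zero (φ : PowerSeries ℂ) : psAct φ ε (0 : (ι → ℤ) → V) = 0 := by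
  funext m
  exact finsum_eq_zero_of_forall_eq_zero fun n => by rw [map_zero, Pi.zero_apply, smul_zero]

lemma psAct_sum {α : Type*} {s : Finset α} {F : α → (ι → ℤ) → V} (hF : ∀ a ∈ s, LocFin (F a))
    (hε : constantCoeff ε = 0) (φ : PowerSeries ℂ) :
    psAct φ ε (∑ a ∈ s, F a) = ∑ a ∈ s, psAct φ ε (F a) := by
  classical
  induction s using Finset.induction_on with
  | empty => simpa using psAct_zero φ
  | insert a s ha ih =>
    rw [Finset.sum_insert ha, Finset.sum_insert ha, psAct_add (hF a (Finset.mem_insert_self a s))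
      (LocFin.sum fun b hb => hF b (Finset.mem_insert_of_mem hb)) hε,
      ih fun b hb => hF b (Finset.mem_insert_of_mem hb)]

lemma psAct_map {V' : Type*} [AddCommGroup V'] [Module ℂ V'] (f : V →ₗ[ℂ] V') (hF : LocFin F)
    (hε : constantCoeff ε = 0) (φ : PowerSeries ℂ) :
    psAct φ ε (fun m => f (F m)) = fun m => f (psAct φ ε F m) := by
  funext m
  obtain ⟨K, hK⟩ := hF.exists_bound hε m
  rw [psAct_eq_sum hK, psAct_eq_sum (K := K) fun n hn => by rw [act_map]; simp only [hK n hn, map_zero],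
    map_sum]
  exact Finset.sum_congr rfl fun n _ => by rw [act_map, map_smul]

lemma psAct_act (hF : LocFin F) (hε : constantCoeff ε = 0) (φ : PowerSeries ℂ)
    (p : MvPolynomial ι ℂ) : psAct φ ε (act p F) = act p (psAct φ ε F) := by
  funext m
  have hb : ∀ e : ι →₀ ℕ, ∃ K : ℕ, ∀ n, K ≤ n →
      act (ε ^ n) F (fun i => m i - (e i : ℤ)) = 0 := fun e => hF.exists_bound hε _
  choose K hK using hb
  have hK' : ∀ e ∈ p.support, ∀ n, p.support.sup K ≤ n →
      act (ε ^ n) F (fun i => m i - (e i : ℤ)) = 0 :=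
    fun e he n hn => hK e n ((Finset.le_sup he).trans hn)
  have h1 : ∀ n, act (ε ^ n) (act p F) m =
      ∑ e ∈ p.support, p.coeff e • act (ε ^ n) F (fun i => m i - (e i : ℤ)) := by
    intro n
    rw [act_comm, act_eq_sum]
  rw [act_eq_sum, psAct_eq_sum (K := p.support.sup K) fun n hn => by
    rw [h1]
    exact Finset.sum_eq_zero fun e he => by rw [hK' e he n hn, smul_zero]]
  simp only [h1, Finset.smul_sum]
  rw [Finset.sum_comm]
  refine Finset.sum_congr rfl fun e he => ?_
  rw [psAct_eq_sum (hK' e he), Finset.smul_sum]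
  exact Finset.sum_congr rfl fun n _ => smul_comm _ _ _

lemma psAct_smul (c : ℂ) (hF : LocFin F) (hε : constantCoeff ε = 0) (φ : PowerSeries ℂ) :
    psAct φ ε (c • F) = c • psAct φ ε F := by
  rw [← act_C, psAct_act hF hε, act_C]

lemma psAct_add_left (hF : LocFin F) (hε : constantCoeff ε = 0) (φ ψ : PowerSeries ℂ) :
    psAct (φ + ψ) ε F = psAct φ ε F + psAct ψ ε F := by
  funext m
  obtain ⟨K, hK⟩ := hF.exists_bound hε m
  rw [Pi.add_apply, psAct_eq_sum hK, psAct_eq_sum hK, psAct_eq_sum hK, ← Finset.sum_add_distrib]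
  exact Finset.sum_congr rfl fun n _ => by rw [map_add, add_smul]

lemma psAct_X_pow (n : ℕ) : psAct (PowerSeries.X ^ n) ε F = act (ε ^ n) F := by
  funext m
  unfold psAct
  rw [finsum_eq_single _ n]
  · simp [PowerSeries.coeff_X_pow]
  · intro k hk
    rw [PowerSeries.coeff_X_pow, if_neg hk, zero_smul]

lemma psAct_one : psAct 1 ε F = F := by
  rw [← pow_zero PowerSeries.X, psAct_X_pow, pow_zero, act_one]

lemma psAct_C_mul (c : ℂ) (φ : PowerSeries ℂ) :
    psAct (PowerSeries.C c * φ) ε F = c • psAct φ ε F := by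
  funext m
  unfold psAct
  rw [Pi.smul_apply]
  simp only [PowerSeries.coeff_C_mul, mul_smul]
  rw [← smul_finsum]

lemma psAct_mul (hF : LocFin F) (hε : constantCoeff ε = 0) (φ ψ : PowerSeries ℂ) :
    psAct (φ * ψ) ε F = psAct φ ε (psAct ψ ε F) := by
  funext m
  obtain ⟨K, hK⟩ := hF.exists_bound hε m
  have h1 : ∀ n, act (ε ^ n) (psAct ψ ε F) m =
      ∑ l ∈ Finset.range K, PowerSeries.coeff l ψ • act (ε ^ (n + l)) F m := by
    intro n
    rw [← psAct_act hF hε, psAct_eq_sum (K := K) fun l hl => by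
      rw [← act_mul, ← pow_add, hK _ (by omega)]]
    exact Finset.sum_congr rfl fun l _ => by rw [← act_mul, ← pow_add, add_comm]
  rw [psAct_eq_sum hK, psAct_eq_sum (K := K) fun n hn => by
    rw [h1]
    exact Finset.sum_eq_zero fun l _ => by rw [hK _ (by omega), smul_zero]]
  simp only [h1, Finset.smul_sum, smul_smul]
  simp only [PowerSeries.coeff_mul, Finset.sum_smul]
  rw [← Finset.sum_product', Finset.sum_sigma']
  -- The antidiagonals of total degree below K are embedded in the square; pairs outside them have
  -- degree at least K and act by zero.
  refine Finset.sum_of_injOn (fun x => (x.2.1, x.2.2)) ?_ ?_ ?_ ?_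
  · rintro ⟨n, a, b⟩ h ⟨n', a', b'⟩ h' heq
    simp only [Prod.mk.injEq] at heq
    obtain ⟨rfl, rfl⟩ := heq
    have h1 := Finset.HasAntidiagonal.mem_antidiagonal.1 (Finset.mem_sigma.1 h).2
    have h2 := Finset.HasAntidiagonal.mem_antidiagonal.1 (Finset.mem_sigma.1 h').2
    simp only at h1 h2
    subst h1
    subst h2
    rfl
  · rintro ⟨n, a, b⟩ h
    have h1 := Finset.HasAntidiagonal.mem_antidiagonal.1 (Finset.mem_sigma.1 h).2
    have h2 := Finset.mem_range.1 (Finset.mem_sigma.1 h).1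
    simp only [Finset.coe_product, Set.mem_prod, Finset.mem_coe, Finset.mem_range] at h1 h2 ⊢
    omega
  · rintro ⟨a, b⟩ h hnot
    rw [hK, smul_zero]
    by_contra hlt
    exact hnot ⟨⟨a + b, a, b⟩, Finset.mem_sigma.2 ⟨Finset.mem_range.2 (not_le.1 hlt),
      Finset.HasAntidiagonal.mem_antidiagonal.2 rfl⟩, rfl⟩
  · rintro ⟨n, a, b⟩ h
    have h1 := Finset.HasAntidiagonal.mem_antidiagonal.1 (Finset.mem_sigma.1 h).2
    simp only at h1
    rw [← h1]

lemma translate_psAct [DecidableEq ι] {i j : ι} (hij : i ≠ j) (hF : IsPower F)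
    (hε : constantCoeff ε = 0) (hε' : constantCoeff (shiftHom i j ε) = 0) (φ : PowerSeries ℂ) :
    translate i j 0 (psAct φ ε F) = psAct φ (shiftHom i j ε) (translate i j 0 F) := by
  funext m
  obtain ⟨K, hK⟩ := (hF.translate hij).locFin.exists_bound hε' m
  have hb : ∀ k : ℕ, ∃ K : ℕ, ∀ n, K ≤ n → act (ε ^ n) F
      (Function.update (Function.update m i (m i + k)) j (m j - k)) = 0 :=
    fun e => hF.locFin.exists_bound hε _
  choose M hM using hb
  set s := Finset.range ((m j - 0).toNat + 1)
  have h1 : ∀ n, act (shiftHom i j ε ^ n) (translate i j 0 F) m =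
      translate i j 0 (act (ε ^ n) F) m := by
    intro n
    rw [translate_act hij _ (hF.eq_zero_of_lt j), map_pow (shiftHom i j)]
  rw [psAct_eq_sum (K := max K (s.sup M)) fun n hn => hK n (by omega), translate_def]
  simp only [h1, translate_def, Finset.smul_sum]
  rw [Finset.sum_comm]
  refine Finset.sum_congr rfl fun k hk => ?_
  rw [psAct_eq_sum (K := max K (s.sup M)) fun n hn => hM k n
    ((Finset.le_sup hk).trans ((le_max_right _ _).trans hn)), Finset.smul_sum]
  exact Finset.sum_congr rfl fun n _ => smul_comm _ _ _

/-- Polynomials with nonzero constant term can be inverted. -/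
lemma LocFin.exists_eq_psAct (hF : LocFin F) {u : MvPolynomial ι ℂ} (hu : constantCoeff u ≠ 0) :
    ∃ (φ : PowerSeries ℂ) (ε : MvPolynomial ι ℂ) (c : ℂ),
      F = FormalVA.psAct φ ε (c • FormalVA.act u F) := by
  set c := constantCoeff u with hc
  -- Here u = c(1 - ε) with ε free of constant term, so the inverse of u is c⁻¹ times the geometric
  -- series in ε.
  set ε := 1 - C c⁻¹ * u with hε_def
  have hε : constantCoeff ε = 0 := by
    simp [hε_def, ← hc, hu]
  set φ : PowerSeries ℂ := PowerSeries.mk fun _ => 1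
  have h1 : φ * (1 - PowerSeries.X) = 1 := PowerSeries.mk_one_mul_one_sub_eq_one ℂ
  have h2 : FormalVA.psAct (1 - PowerSeries.X) ε F = c⁻¹ • FormalVA.act u F := by
    have h3 : FormalVA.psAct (1 - PowerSeries.X) ε F + FormalVA.act ε F = F := by
      rw [← pow_one ε, ← psAct_X_pow, pow_one, pow_one, ← psAct_add_left hF hε, sub_add_cancel,
        psAct_one]
    have h4 : FormalVA.act ε F + c⁻¹ • FormalVA.act u F = F := by
      rw [← act_C, ← act_mul, ← act_add, hε_def, sub_add_cancel, act_one]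
    rw [eq_sub_of_add_eq h3, ← eq_sub_of_add_eq' h4]
  exact ⟨φ, ε, c⁻¹, by rw [← h2, ← psAct_mul hF hε, h1, psAct_one]⟩

lemma LocFin.isPower_of_act (hF : LocFin F) {u : MvPolynomial ι ℂ} (hu : constantCoeff u ≠ 0)
    (h : IsPower (FormalVA.act u F)) : IsPower F := by
  obtain ⟨φ, ε, c, hφ⟩ := hF.exists_eq_psAct hu
  rw [hφ]
  exact (h.smul c).psAct φ

lemma LocFin.eq_zero_of_act (hF : LocFin F) {u : MvPolynomial ι ℂ} (hu : constantCoeff u ≠ 0)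
    (h : FormalVA.act u F = 0) : F = 0 := by
  obtain ⟨φ, ε, c, hφ⟩ := hF.exists_eq_psAct hu
  rw [hφ, h, smul_zero, psAct_zero]

end PowerSeriesAction

/-! ### Diagonal poles, weak associativity and uniqueness -/

section Poles

variable {V : Type*} [AddCommGroup V] [Module ℂ V]

/-- Write g(s) = s^e (c + s h(s)) with c ≠ 0. The second factor is invertible on locally finite
series, so only the pole along x_0 = x_1 matters. -/
lemma exists_eq_pow_mul_of_mem_diffMonoid {P : MvPolynomial (Fin 2) ℂ}
    (hP : P ∈ diffMonoid (Fin 2)) : ∃ (e : ℕ) (u : MvPolynomial (Fin 2) ℂ),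
      constantCoeff u ≠ 0 ∧ P = (X 0 - X 1) ^ e * u := by
  obtain ⟨g, hg, rfl⟩ := exists_eq_aeval_of_mem_diffMonoid hP
  obtain ⟨e, c, h, hc, rfl⟩ := exists_aeval_eq_pow_mul hg
  refine ⟨e, C c + (X 0 - X 1) * Polynomial.aeval (X 0 - X 1) h, by simpa using hc, ?_⟩
  rw [map_mul, map_pow, Polynomial.aeval_X, map_add, Polynomial.aeval_C, map_mul,
    Polynomial.aeval_X, algebraMap_eq]

lemma act_X_eq_zero {ι : Type*} [DecidableEq ι] {i : ι} {F : (ι → ℤ) → V}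
    (h : act (X i) F = 0) : F = 0 := by
  funext m
  have := congrFun h (Function.update m i (m i + 1))
  rw [act_X] at this
  simpa using this

lemma act_pow_eq_zero_of {ι : Type*} {p : MvPolynomial ι ℂ}
    (hp : ∀ F : (ι → ℤ) → V, act p F = 0 → F = 0) (n : ℕ) {F : (ι → ℤ) → V}
    (h : act (p ^ n) F = 0) : F = 0 := by
  induction n with
  | zero => simpa using h
  | succ n ih =>
    rw [pow_succ', act_mul] at h
    exact ih (hp _ h)

lemma act_X_mul_prod_X_eq_zero {ι : Type*} [Fintype ι] [DecidableEq ι] {i : ι} {F : (ι → ℤ) → V}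
    (h : act (X i * ∏ i, X i) F = 0) : F = 0 := by
  rw [act_mul] at h
  have h1 := act_X_eq_zero h
  funext m
  have := congrFun h1 fun i => m i + 1
  rw [← pow_one (∏ i, X i), act_prod_X_pow] at this
  simpa using this

lemma isIterated_prodSeries (a b : E V) (w : V) : IsIterated 1 0 (prodSeries a b w) := by
  constructor
  · obtain ⟨N, hN⟩ := exists_cf_eq_zero b w
    exact ⟨N, fun m hm => by rw [prodSeries, hN _ hm, map_zero]⟩
  · intro t
    obtain ⟨M, hM⟩ := exists_cf_eq_zero a (cf b t w)
    exact ⟨M, fun m h1 h2 => by rw [prodSeries, h1, hM _ h2]⟩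

variable {Y : V →ₗ[ℂ] E V} {one : V} {U : Set V}

/-- The exponent comes from a polynomial that serves all w, which makes it independent of w. The
other factor of that polynomial is inverted as a power series. -/
lemma IsGenerated.exists_pow (h : IsGenerated Y one U) (u v : V) : ∃ K : ℕ, ∀ w,
    IsLowerTruncated (act ((X 0 - X 1) ^ K) (prodSeries (Y u) (Y v) w)) := by
  obtain ⟨P, hP, hPB⟩ := IsRational.exists_pair (h.rational [u, v])
  obtain ⟨e, p, hp, rfl⟩ := exists_eq_pow_mul_of_mem_diffMonoid hP
  refine ⟨e, fun w => ?_⟩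
  have h1 := hPB w
  rw [polyMul_eq_act, fieldProd_pair, mul_comm, act_mul] at h1
  obtain ⟨N, hN⟩ := isLowerTruncated_iff.mp h1
  rw [act_comm] at hN
  exact isLowerTruncated_iff.mpr ⟨N, ((((isIterated_prodSeries (Y u) (Y v) w).locFin
    (by decide)).act _).act _).isPower_of_act hp hN⟩

lemma translate_eq_translate {ι : Type*} [DecidableEq ι] {i j : ι} {N M : ℤ} {F : (ι → ℤ) → V}
    (hN : ∀ m : ι → ℤ, m j < N → F m = 0) (hM : ∀ m : ι → ℤ, m j < M → F m = 0) :
    translate i j N F = translate i j M F := by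
  funext m
  rw [translate_apply hN (K := (max (m j - N) (m j - M)).toNat + 1) (by omega),
    translate_apply hM (K := (max (m j - N) (m j - M)).toNat + 1) (by omega)]

lemma shiftedProd_eq_translate {a b : E V} {w : V} {M : ℤ} (hM : ∀ m < M, cf b m w = 0) :
    shiftedProd a b w = translate 0 1 M (prodSeries a b w) := by
  funext m
  rw [shiftedProd, translate_def]
  have h1 : ∀ k : ℕ, prodSeries a b w
      (Function.update (Function.update m 0 (m 0 + k)) 1 (m 1 - k)) =
        cf a (m 0 + k) (cf b (m 1 - k) w) := fun k => by simp [prodSeries]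
  simp only [h1]
  refine finsum_eq_sum_of_support_subset _ fun k hk => ?_
  simp only [Finset.coe_range, Set.mem_Iio]
  by_contra h2
  refine hk ?_
  simp only
  rw [hM _ (by omega), map_zero, smul_zero]

/-- Weak associativity, with an exponent which may be enlarged. -/
theorem IsGenerated.weak_assoc (h : IsGenerated Y one U) (u v w : V) : ∃ l : ℕ, ∀ n, l ≤ n →
    act ((X 0 + X 1) ^ n) (shiftedProd (Y u) (Y v) w) =
      act ((X 0 + X 1) ^ n) (iterateSeries Y u v w) := by
  obtain ⟨K, hK⟩ := h.exists_pow u v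
  obtain ⟨N, hN⟩ := isLowerTruncated_iff.mp (hK w)
  obtain ⟨M, hM⟩ := exists_cf_eq_zero (Y v) w
  rw [← act_mul] at hN
  set q : MvPolynomial (Fin 2) ℂ := (∏ i, X i) ^ N * (X 0 - X 1) ^ K
  have hB : ∀ m : Fin 2 → ℤ, m 1 < M → prodSeries (Y u) (Y v) w m = 0 := fun m hm => by
    rw [prodSeries, hM _ hm, map_zero]
  have h1 : act (shiftHom 0 1 q) (iterateSeries Y u v w) =
      act (shiftHom 0 1 q) (shiftedProd (Y u) (Y v) w) := by
    rw [((h.isOPE_all u v w).act q).eq_translate hN, shiftedProd_eq_translate hM,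
      ← translate_act (by decide) _ hB]
    exact translate_eq_translate (hN.eq_zero_of_lt 1) (act_eq_zero_of_lt hB q)
  -- After the shift the pole x_0 - x_1 is a power of x_0. Powers of single variables cancel on any
  -- series, leaving a power of x_0 + x_1.
  have hq : shiftHom 0 1 q = X 1 ^ N * (X 0 ^ K * (X 0 + X 1) ^ N) := by
    simp only [q, Fin.prod_univ_two, mul_pow, map_mul, map_pow, map_sub, shiftHom_X_self,
      shiftHom_X_of_ne (1 : Fin 2) (by decide : (1 : Fin 2) ≠ 0), add_sub_cancel_right]
    ring
  rw [← sub_eq_zero, ← map_sub, hq, act_mul, act_mul] at h1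
  have h2 := act_pow_eq_zero_of (fun _ => act_X_eq_zero) _
    (act_pow_eq_zero_of (fun _ => act_X_eq_zero) _ h1)
  rw [map_sub, sub_eq_zero] at h2
  refine ⟨N, fun n hn => ?_⟩
  rw [← Nat.sub_add_cancel hn, pow_add, act_mul, act_mul, h2]

theorem IsGenerated.isNonlocalVertexAlgebra (h : IsGenerated Y one U) :
    IsNonlocalVertexAlgebra Y one where
  vacuum := h.vacuum
  creation := h.creation
  weak_assoc u v w := by
    obtain ⟨l, hl⟩ := h.weak_assoc u v w
    refine ⟨l, ?_⟩
    rw [polyMul_eq_act, polyMul_eq_act]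
    exact hl l le_rfl

/-- If the two maps agree on v, then weak associativity makes the iterates of u ∈ U with v agree up
to a power of x_0 + x_2, which is cancellable in V((x_2))((x_0)). The set of agreement is thus
closed under modes of U. -/
theorem IsGenerated.eq_of_isNonlocalVertexAlgebra (h : IsGenerated Y one U) {Y' : V →ₗ[ℂ] E V}
    (hY' : IsNonlocalVertexAlgebra Y' one) (hU : ∀ u ∈ U, Y' u = Y u) : Y' = Y := by
  have hX : (X 0 + X 1 : MvPolynomial (Fin 2) ℂ) ≠ 0 := by
    intro h0
    have := congrArg (eval ![1, 0]) h0
    simp at this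
  have hS : LinearMap.eqLocus Y' Y = ⊤ := by
    refine h.span _ (hY'.vacuum.trans h.vacuum.symm) fun u hu m v hv => ?_
    have hv : Y' v = Y v := hv
    refine LinearMap.ext fun w => ?_
    ext k
    obtain ⟨l, hl⟩ := h.weak_assoc u v w
    obtain ⟨l', hl'⟩ := hY'.weak_assoc u v w
    rw [polyMul_eq_act, polyMul_eq_act, hU u hu, hv] at hl'
    have h1 : act ((X 0 + X 1) ^ (l + l')) (iterateSeries Y' u v w) =
        act ((X 0 + X 1) ^ (l + l')) (iterateSeries Y u v w) := by
      rw [← hl _ (Nat.le_add_right _ _), pow_add, act_mul, ← hl', ← act_mul]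
    have h2 := IsIterated.act_injective (by decide) (isIterated_iterateSeries Y' u v w)
      (isIterated_iterateSeries Y u v w) (pow_ne_zero _ hX) h1
    have h3 := congrFun h2 ![m, k]
    simp only [iterateSeries, Matrix.cons_val_zero, Matrix.cons_val_one, hU u hu] at h3
    exact h3
  exact LinearMap.ext fun v => (hS ▸ Submodule.mem_top : v ∈ LinearMap.eqLocus Y' Y)

end Poles

/-! ### Exchange relations with power series coefficients -/

section ExchangeRelations

variable {V : Type*} [AddCommGroup V] [Module ℂ V]

/-- The series `b(x_1) a(x_0) w`. -/
def oppSeries (a b : E V) (w : V) : (Fin 2 → ℤ) → V := fun m => cf b (m 1) (cf a (m 0) w)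

lemma isIterated_oppSeries (a b : E V) (w : V) : IsIterated 0 1 (oppSeries a b w) := by
  constructor
  · obtain ⟨N, hN⟩ := exists_cf_eq_zero a w
    exact ⟨N, fun m hm => by rw [oppSeries, hN _ hm, map_zero]⟩
  · intro t
    obtain ⟨M, hM⟩ := exists_cf_eq_zero b (cf a t w)
    exact ⟨M, fun m h1 h2 => by rw [oppSeries, h1, hM _ h2]⟩

lemma locFin_oppSeries (a b : E V) (w : V) : LocFin (oppSeries a b w) :=
  (isIterated_oppSeries a b w).locFin (by decide)

/-- The polynomial `x_1 - x_0`. -/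
def swapDiff : MvPolynomial (Fin 2) ℂ := X 1 - X 0

lemma constantCoeff_swapDiff : constantCoeff swapDiff = 0 := by simp [swapDiff]

/-- The span of the families `φ(x_1 - x_0) b(x_1) a(x_0) w`, for fields `a` of states in `T`. -/
def oppSpan (Y : V →ₗ[ℂ] E V) (T : Set V) : Submodule ℂ (V → (Fin 2 → ℤ) → V) :=
  Submodule.span ℂ {F | ∃ (φ : PowerSeries ℂ) (u v : V), u ∈ T ∧
    F = fun w => psAct φ swapDiff (oppSeries (Y u) (Y v) w)}

/-- The families which lie in `oppSpan` up to a power of `x_1 - x_0`. -/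
def IsExchangeable (Y : V →ₗ[ℂ] E V) (T : Set V) (F : V → (Fin 2 → ℤ) → V) : Prop :=
  ∃ k : ℕ, (fun w => act (swapDiff ^ k) (F w)) ∈ oppSpan Y T

variable {Y : V →ₗ[ℂ] E V} {T : Set V} {F G : V → (Fin 2 → ℤ) → V}

lemma locFin_of_mem_oppSpan (hF : F ∈ oppSpan Y T) (w : V) : LocFin (F w) := by
  induction hF using Submodule.span_induction with
  | mem F hF =>
    obtain ⟨φ, u, v, -, rfl⟩ := hF
    exact (locFin_oppSeries _ _ _).psAct constantCoeff_swapDiff φ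
  | zero => exact LocFin.zero
  | add F G _ _ hF hG => exact hF.add hG
  | smul c F _ hF => exact hF.smul c

lemma psAct_mem_oppSpan (hF : F ∈ oppSpan Y T) (φ : PowerSeries ℂ) :
    (fun w => psAct φ swapDiff (F w)) ∈ oppSpan Y T := by
  induction hF using Submodule.span_induction with
  | mem F hF =>
    obtain ⟨ψ, u, v, hu, rfl⟩ := hF
    refine Submodule.subset_span ⟨φ * ψ, u, v, hu, funext fun w => ?_⟩
    rw [psAct_mul (locFin_oppSeries _ _ _) constantCoeff_swapDiff]
  | zero =>
    convert (oppSpan Y T).zero_mem using 1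
    exact funext fun w => psAct_zero φ
  | add F G hF' hG' hF hG =>
    convert (oppSpan Y T).add_mem hF hG using 1
    exact funext fun w => psAct_add (locFin_of_mem_oppSpan hF' w) (locFin_of_mem_oppSpan hG' w)
      constantCoeff_swapDiff φ
  | smul c F hF' hF =>
    convert (oppSpan Y T).smul_mem c hF using 1
    exact funext fun w => psAct_smul c (locFin_of_mem_oppSpan hF' w) constantCoeff_swapDiff φ

lemma act_mem_oppSpan (hF : F ∈ oppSpan Y T) (n : ℕ) :
    (fun w => act (swapDiff ^ n) (F w)) ∈ oppSpan Y T := by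
  convert psAct_mem_oppSpan hF (PowerSeries.X ^ n) using 1
  exact funext fun w => (psAct_X_pow n).symm

lemma oppSeries_mem_oppSpan {u : V} (hu : u ∈ T) (v : V) : oppSeries (Y u) (Y v) ∈ oppSpan Y T :=
  Submodule.subset_span ⟨1, u, v, hu, funext fun _ => psAct_one.symm⟩

/-- Families in `oppSpan` are finite sums of generators. -/
lemma exists_eq_sum_of_mem_oppSpan (hF : F ∈ oppSpan Y T) :
    ∃ (r : ℕ) (φ : Fin r → PowerSeries ℂ) (u v : Fin r → V), (∀ i, u i ∈ T) ∧
      ∀ w, F w = ∑ i, psAct (φ i) swapDiff (oppSeries (Y (u i)) (Y (v i)) w) := by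
  induction hF using Submodule.span_induction with
  | mem F hF =>
    obtain ⟨φ, u, v, hu, rfl⟩ := hF
    exact ⟨1, fun _ => φ, fun _ => u, fun _ => v, fun _ => hu, fun w => by simp⟩
  | zero => exact ⟨0, 0, 0, 0, fun i => i.elim0, fun w => by simp⟩
  | add F G _ _ hF hG =>
    obtain ⟨r, φ, u, v, hu, hF⟩ := hF
    obtain ⟨r', φ', u', v', hu', hG⟩ := hG
    refine ⟨r + r', Fin.append φ φ', Fin.append u u', Fin.append v v', fun i => ?_, fun w => ?_⟩
    · induction i using Fin.addCases with
      | left i => rw [Fin.append_left]; exact hu i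
      | right i => rw [Fin.append_right]; exact hu' i
    · rw [Pi.add_apply, hF, hG, Fin.sum_univ_add]
      simp only [Fin.append_left, Fin.append_right]
  | smul c F _ hF =>
    obtain ⟨r, φ, u, v, hu, hF⟩ := hF
    refine ⟨r, fun i => PowerSeries.C c * φ i, u, v, hu, fun w => ?_⟩
    rw [Pi.smul_apply, hF, Finset.smul_sum]
    exact Finset.sum_congr rfl fun i _ => (psAct_C_mul c _).symm

lemma isExchangeable_of_mem (hF : F ∈ oppSpan Y T) : IsExchangeable Y T F :=
  ⟨0, act_mem_oppSpan hF 0⟩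

lemma IsExchangeable.add (hF : IsExchangeable Y T F) (hG : IsExchangeable Y T G) :
    IsExchangeable Y T (F + G) := by
  obtain ⟨k, hk⟩ := hF
  obtain ⟨l, hl⟩ := hG
  refine ⟨k + l, ?_⟩
  convert (oppSpan Y T).add_mem (act_mem_oppSpan hk l) (act_mem_oppSpan hl k) using 1
  funext w
  rw [Pi.add_apply, Pi.add_apply, map_add, ← act_mul, ← act_mul, ← pow_add, ← pow_add, add_comm k l]

lemma IsExchangeable.smul (hF : IsExchangeable Y T F) (c : ℂ) : IsExchangeable Y T (c • F) := by
  obtain ⟨k, hk⟩ := hF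
  refine ⟨k, ?_⟩
  convert (oppSpan Y T).smul_mem c hk using 1
  funext w
  rw [Pi.smul_apply, Pi.smul_apply, map_smul]

lemma IsExchangeable.sum {α : Type*} {s : Finset α} {F : α → V → (Fin 2 → ℤ) → V}
    (h : ∀ a ∈ s, IsExchangeable Y T (F a)) : IsExchangeable Y T (∑ a ∈ s, F a) :=
  Finset.sum_induction _ _ (fun _ _ => IsExchangeable.add)
    (isExchangeable_of_mem (oppSpan Y T).zero_mem) h

lemma IsExchangeable.act (hF : IsExchangeable Y T F) (n : ℕ) :
    IsExchangeable Y T fun w => FormalVA.act (swapDiff ^ n) (F w) := by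
  obtain ⟨k, hk⟩ := hF
  refine ⟨k, ?_⟩
  convert act_mem_oppSpan hk n using 1
  exact funext fun w => act_comm _ _ _

lemma IsExchangeable.of_act {n : ℕ}
    (hF : IsExchangeable Y T fun w => FormalVA.act (swapDiff ^ n) (F w)) :
    IsExchangeable Y T F := by
  obtain ⟨k, hk⟩ := hF
  refine ⟨k + n, ?_⟩
  convert hk using 1
  funext w
  rw [pow_add, act_mul]

end ExchangeRelations

/-! ### The action of Laurent series in x_1 - x_0 -/

section LaurentAction

variable {V : Type*} [AddCommGroup V] [Module ℂ V]

/-- The action of `(x_1 - x_0) ^ q`, expanded in nonnegative powers of `x_0`. -/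
def binAct (q : ℤ) (O : (Fin 2 → ℤ) → V) : (Fin 2 → ℤ) → V :=
  fun m => ∑ᶠ k : ℕ, ((-1) ^ k * Ring.choose q k : ℤ) • O ![m 0 - k, m 1 - q + k]

/-- The action of `g(x_1 - x_0)`, expanded in nonnegative powers of `x_0`, for the Laurent series
with coefficients `g`. -/
def laurentAct (g : ℤ → ℂ) (O : (Fin 2 → ℤ) → V) : (Fin 2 → ℤ) → V :=
  fun m => ∑ᶠ q : ℤ, g q • binAct q O m

/-- Pascal's rule for sums. -/
lemma finsum_choose_succ (q : ℤ) {g : ℕ → V} (hg : (Function.support g).Finite) :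
    ∑ᶠ k : ℕ, ((-1) ^ k * Ring.choose (q + 1) k : ℤ) • g k =
      (∑ᶠ k : ℕ, ((-1) ^ k * Ring.choose q k : ℤ) • g k) -
        ∑ᶠ k : ℕ, ((-1) ^ k * Ring.choose q k : ℤ) • g (k + 1) := by
  obtain ⟨K, hK⟩ : ∃ K, ∀ k, K ≤ k → g k = 0 := by
    obtain ⟨K, hK⟩ := hg.bddAbove
    refine ⟨K + 1, fun k hk => ?_⟩
    by_contra h
    have := hK h
    omega
  have h1 : ∀ (q : ℤ) (g : ℕ → V) (K : ℕ), (∀ k, K ≤ k → g k = 0) →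
      ∑ᶠ k : ℕ, ((-1) ^ k * Ring.choose q k : ℤ) • g k =
        ∑ k ∈ Finset.range K, ((-1) ^ k * Ring.choose q k : ℤ) • g k := by
    intro q g K hK
    refine finsum_eq_sum_of_support_subset _ fun k hk => ?_
    simp only [Finset.coe_range, Set.mem_Iio]
    by_contra h
    exact hk (by simp only [hK k (by omega), smul_zero])
  rw [h1 _ g (K + 1) fun k hk => hK k (by omega), h1 _ g (K + 1) fun k hk => hK k (by omega),
    h1 _ (fun k => g (k + 1)) K fun k hk => hK _ (by omega), Finset.sum_range_succ',
    Finset.sum_range_succ' _ K]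
  simp only [Ring.choose_zero_right, Ring.choose_succ_succ]
  rw [add_sub_right_comm, ← Finset.sum_sub_distrib]
  congr 1
  refine Finset.sum_congr rfl fun k _ => ?_
  rw [← sub_smul]
  congr 1
  ring

variable {O : (Fin 2 → ℤ) → V}

lemma act_swapDiff (F : (Fin 2 → ℤ) → V) (m : Fin 2 → ℤ) :
    act swapDiff F m = F ![m 0, m 1 - 1] - F ![m 0 - 1, m 1] := by
  rw [swapDiff, act_sub, Pi.sub_apply, act_X, act_X]
  congr 2 <;> funext i <;> fin_cases i <;> simp

lemma finite_support_of_lt {g : ℕ → V} {m N : ℤ} (h : ∀ k : ℕ, m - k < N → g k = 0) :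
    (Function.support g).Finite := by
  refine (Set.finite_Iic (m - N).toNat).subset fun k hk => ?_
  simp only [Set.mem_Iic]
  by_contra h1
  exact hk (h k (by omega))

/-- Pascal's rule again, now for (x_1 - x_0)^q with q of either sign. -/
lemma binAct_succ (hO : IsIterated 0 1 O) (q : ℤ) :
    binAct (q + 1) O = act swapDiff (binAct q O) := by
  obtain ⟨N, hN⟩ := hO.1
  funext m
  rw [act_swapDiff]
  unfold binAct
  rw [finsum_choose_succ q (finite_support_of_lt (m := m 0) (N := N) fun k hk => hN _ (by simpa using hk))]
  simp only [Matrix.cons_val_zero, Matrix.cons_val_one]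
  congr 1
  · refine finsum_congr fun k => ?_
    rw [show m 1 - (q + 1) + (k : ℤ) = m 1 - 1 - q + k by ring]
  · refine finsum_congr fun k => ?_
    rw [show m 1 - (q + 1) + ((k + 1 : ℕ) : ℤ) = m 1 - q + k by push_cast; ring,
      show m 0 - ((k + 1 : ℕ) : ℤ) = m 0 - 1 - k by push_cast; ring]

lemma binAct_zero : binAct 0 O = O := by
  funext m
  unfold binAct
  rw [finsum_eq_single _ 0]
  · simp [← vec_eta m]
  · intro k hk
    rw [Ring.choose_zero_pos _ (Nat.pos_of_ne_zero hk), mul_zero, zero_smul]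

lemma binAct_natCast (hO : IsIterated 0 1 O) (n : ℕ) : binAct (n : ℤ) O = act (swapDiff ^ n) O := by
  induction n with
  | zero => rw [Nat.cast_zero, binAct_zero, pow_zero, act_one]
  | succ n ih => rw [Nat.cast_succ, binAct_succ hO, ih, pow_succ', act_mul]

/-- The pairs contributing to a coefficient of `laurentAct`. -/
lemma IsIterated.finite_pairs (hO : IsIterated 0 1 O) {g : ℤ → ℂ} {K : ℤ}
    (hg : ∀ q < K, g q = 0) (m : Fin 2 → ℤ) :
    {q : ℤ × ℕ | g q.1 ≠ 0 ∧ O ![m 0 - q.2, m 1 - q.1 + q.2] ≠ 0}.Finite := by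
  obtain ⟨⟨N, hN⟩, h2⟩ := hO
  choose M hM using h2
  refine ((Set.finite_Iic (m 0 - N).toNat).biUnion fun k _ =>
    ((Set.finite_Icc K (m 1 + k - M (m 0 - k))).image fun q => (q, k))).subset ?_
  rintro ⟨q, k⟩ ⟨h3, h4⟩
  simp only [Set.mem_iUnion, Set.mem_image, Set.mem_Iic, Set.mem_Icc]
  refine ⟨k, ?_, q, ⟨?_, ?_⟩, rfl⟩
  · by_contra h
    exact h4 (hN _ (by simp; omega))
  · by_contra h
    exact h3 (hg _ (by omega))
  · by_contra h
    exact h4 (hM (m 0 - k) _ (by simp) (by simp; omega))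

lemma IsIterated.finite_support (hO : IsIterated 0 1 O) {g : ℤ → ℂ} {K : ℤ}
    (hg : ∀ q < K, g q = 0) (m : Fin 2 → ℤ) :
    (Function.support fun q => g q • binAct q O m).Finite := by
  refine ((hO.finite_pairs hg m).image Prod.fst).subset fun q hq => ?_
  by_contra h
  refine hq ?_
  by_cases hg0 : g q = 0
  · simp [hg0]
  · have : binAct q O m = 0 := by
      refine finsum_eq_zero_of_forall_eq_zero fun k => ?_
      by_contra h1
      exact h ⟨(q, k), ⟨hg0, fun h2 => h1 (by simp only at h2; rw [h2, smul_zero])⟩, rfl⟩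
    simp [this]

lemma laurentAct_eq_finsum (hO : IsIterated 0 1 O) {g : ℤ → ℂ} {K : ℤ}
    (hg : ∀ q < K, g q = 0) (m : Fin 2 → ℤ) :
    laurentAct g O m = ∑ᶠ q : ℤ × ℕ, (g q.1 * ((-1) ^ q.2 * (Ring.choose q.1 q.2 : ℤ))) •
      O ![m 0 - q.2, m 1 - q.1 + q.2] := by
  rw [finsum_curry]
  · refine finsum_congr fun q => ?_
    unfold binAct
    rw [smul_finsum]
    refine finsum_congr fun k => ?_
    simp only
    rw [← Int.cast_smul_eq_zsmul ℂ, smul_smul]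
    push_cast
    rfl
  · refine (hO.finite_pairs hg m).subset fun q hq => ⟨fun h => hq ?_, fun h => hq ?_⟩
    · simp only [h, zero_mul, zero_smul]
    · simp only [h, smul_zero]

lemma laurentAct_shift (hO : IsIterated 0 1 O) {g : ℤ → ℂ} {K : ℤ} (hg : ∀ q < K, g q = 0) :
    laurentAct (fun q => g (q - 1)) O = act swapDiff (laurentAct g O) := by
  funext m
  rw [act_swapDiff]
  unfold laurentAct
  rw [← finsum_sub_distrib (hO.finite_support hg _) (hO.finite_support hg _),
    ← finsum_comp_equiv (Equiv.addRight (1 : ℤ))]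
  refine finsum_congr fun q => ?_
  simp only [Equiv.coe_addRight, add_sub_cancel_right]
  rw [binAct_succ hO, act_swapDiff, smul_sub]

/-- Combined with `laurentAct_powerSeries`, this converts a Laurent coefficient into a power series
coefficient at the cost of a power of x_1 - x_0. -/
lemma laurentAct_shift_pow (hO : IsIterated 0 1 O) {g : ℤ → ℂ} {K : ℤ} (hg : ∀ q < K, g q = 0)
    (n : ℕ) : laurentAct (fun q => g (q - n)) O = act (swapDiff ^ n) (laurentAct g O) := by
  induction n with
  | zero => simp
  | succ n ih =>
    rw [pow_succ', act_mul, ← ih, ← laurentAct_shift hO (K := K + n) fun q hq => hg _ (by omega)]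
    congr 1
    funext q
    congr 1
    push_cast
    ring

lemma laurentAct_powerSeries (hO : IsIterated 0 1 O) {g : ℤ → ℂ} (hg : ∀ q < 0, g q = 0) :
    laurentAct g O = psAct (PowerSeries.mk fun n => g n) swapDiff O := by
  funext m
  unfold laurentAct psAct
  simp only [PowerSeries.coeff_mk]
  rw [← finsum_mem_univ (f := fun n : ℕ => g n • act (swapDiff ^ n) O m)]
  simp only [← binAct_natCast hO]
  rw [← finsum_mem_image (f := fun q : ℤ => g q • binAct q O m) (g := fun n : ℕ => (n : ℤ)) (fun a _ b _ h => by simpa using h)]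
  rw [finsum_mem_inter_support_eq _ _ Set.univ, finsum_mem_univ]
  ext q
  simp only [Set.mem_inter_iff, Set.mem_univ, true_and, and_iff_right_iff_imp]
  intro hq
  have h0 : 0 ≤ q := by
    by_contra h
    exact hq (by simp only [hg q (by omega), zero_smul])
  exact ⟨q.toNat, Set.mem_univ _, by simp [h0]⟩

end LaurentAction

/-! ### Coefficients of powers of x_0 -/

section Levels

variable {V : Type*} [AddCommGroup V] [Module ℂ V] {n : ℕ}

/-- The coefficient of `x_0 ^ a`. -/
def level (a : ℤ) : ((Fin (n + 1) → ℤ) → V) →ₗ[ℂ] ((Fin n → ℤ) → V) where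
  toFun F t := F (Fin.cons a t : Fin (n + 1) → ℤ)
  map_add' _ _ := rfl
  map_smul' _ _ := rfl

lemma level_apply (a : ℤ) (F : (Fin (n + 1) → ℤ) → V) (t : Fin n → ℤ) :
    level a F t = F (Fin.cons a t : Fin (n + 1) → ℤ) := rfl

lemma level_act_rename_succ (a : ℤ) (p : MvPolynomial (Fin n) ℂ) (F : (Fin (n + 1) → ℤ) → V) :
    level a (act (rename Fin.succ p) F) = act p (level a F) :=
  funext fun t => act_rename_succ p F a t

lemma level_act_X_pow (a : ℤ) (b : ℕ) (F : (Fin (n + 1) → ℤ) → V) :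
    level a (act (X 0 ^ b) F) = level (a - b) F := by
  funext t
  rw [level_apply, act_X_pow, level_apply, Fin.update_cons_zero, Fin.cons_zero]

lemma LocFin.level {F : (Fin (n + 1) → ℤ) → V} (hF : LocFin F) (a : ℤ) :
    LocFin (level a F) := by
  intro t
  refine ((hF (Fin.cons a t : Fin (n + 1) → ℤ)).preimage (f := fun e : Fin n → ℕ =>
    (Fin.cons 0 e : Fin (n + 1) → ℕ)) fun e _ e' _ h => Fin.cons_right_injective _ h).subset fun e he => ?_
  simp only [Set.mem_preimage, Set.mem_ofPred_eq, level_apply] at he ⊢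
  convert he using 3 with i
  induction i using Fin.cases with
  | zero => simp
  | succ i => simp

lemma level_psAct_rename_succ (a : ℤ) (φ : PowerSeries ℂ) (p : MvPolynomial (Fin n) ℂ)
    (F : (Fin (n + 1) → ℤ) → V) :
    level a (psAct φ (rename Fin.succ p) F) = psAct φ p (level a F) := by
  funext t
  rw [level_apply]
  refine finsum_congr fun k => ?_
  rw [← level_act_rename_succ, map_pow (rename Fin.succ)]
  rfl

/-- The binomial theorem in x_0. Truncation of F in x_0 allows a number of terms that does not
depend on k. -/
lemma level_act_add_pow (p : MvPolynomial (Fin n) ℂ) (c : ℂ) (k : ℕ)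
    {F : (Fin (n + 1) → ℤ) → V} {a : ℤ} {B : ℕ} (hB : ∀ b : ℕ, B ≤ b → level (a - b) F = 0) :
    level a (act ((rename Fin.succ p + C c * X 0) ^ k) F) =
      ∑ b ∈ Finset.range B, ((k.choose b : ℂ) * c ^ b) • act (p ^ (k - b)) (level (a - b) F) := by
  have h1 : level a (act ((rename Fin.succ p + C c * X 0) ^ k) F) =
      ∑ b ∈ Finset.range (k + 1),
        ((k.choose b : ℂ) * c ^ b) • act (p ^ (k - b)) (level (a - b) F) := by
    rw [add_comm (rename Fin.succ p), add_pow, map_sum, LinearMap.sum_apply, map_sum]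
    refine Finset.sum_congr rfl fun b _ => ?_
    rw [show (C c * X 0 : MvPolynomial (Fin (n + 1)) ℂ) ^ b * rename Fin.succ p ^ (k - b) *
      (k.choose b : MvPolynomial (Fin (n + 1)) ℂ) =
        C ((k.choose b : ℂ) * c ^ b) * (rename Fin.succ (p ^ (k - b)) * X 0 ^ b) by
      rw [map_pow, map_mul, map_pow, mul_pow, map_natCast]
      ring, act_mul, act_C, map_smul, act_mul, level_act_rename_succ, level_act_X_pow]
  rw [h1, Finset.sum_subset (Finset.range_subset_range.mpr (le_max_left (k + 1) B)),
    Finset.sum_subset (Finset.range_subset_range.mpr (le_max_right (k + 1) B))]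
  · intro b _ hb
    rw [hB b (by simpa using hb), map_zero, smul_zero]
  · intro b _ hb
    rw [Nat.choose_eq_zero_of_lt (by simpa using hb), Nat.cast_zero, zero_mul, zero_smul]

/-- The coefficient of `y ^ b` in `γ(x + c y)`. -/
def taylorCoeff (γ : PowerSeries ℂ) (c : ℂ) (b : ℕ) : PowerSeries ℂ :=
  PowerSeries.mk fun k => PowerSeries.coeff (b + k) γ * (((b + k).choose b : ℂ) * c ^ b)

/-- Taylor's formula for γ(p + c x_0) in powers of x_0, with finitely many terms because F is
truncated in x_0. -/
lemma level_psAct_add {p : MvPolynomial (Fin n) ℂ} (hp : constantCoeff p = 0) (c : ℂ)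
    (γ : PowerSeries ℂ) {F : (Fin (n + 1) → ℤ) → V} (hF : LocFin F) {a : ℤ} {B : ℕ}
    (hB : ∀ b : ℕ, B ≤ b → level (a - b) F = 0) :
    level a (psAct γ (rename Fin.succ p + C c * X 0) F) =
      ∑ b ∈ Finset.range B, psAct (taylorCoeff γ c b) p (level (a - b) F) := by
  funext t
  have hp' : constantCoeff (rename Fin.succ p + C c * X 0 : MvPolynomial (Fin (n + 1)) ℂ) = 0 := by
    simp [hp]
  obtain ⟨K₀, hK₀⟩ := hF.exists_bound hp' (Fin.cons a t : Fin (n + 1) → ℤ)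
  have h1 : ∀ b : ℕ, ∃ K, ∀ k, K ≤ k → act (p ^ k) (level (a - b) F) t = 0 := fun b =>
    (hF.level _).exists_bound hp t
  choose K hK using h1
  set M := K₀ + (Finset.range B).sup K + B with hM
  rw [level_apply, psAct_eq_sum (K := M) fun k hk => hK₀ k (by omega), Finset.sum_apply]
  simp only [← level_apply, level_act_add_pow p c _ hB, Finset.sum_apply, Pi.smul_apply,
    Finset.smul_sum]
  rw [Finset.sum_comm]
  refine Finset.sum_congr rfl fun b hb => ?_
  have hKb : K b ≤ (Finset.range B).sup K := Finset.le_sup hb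
  have hb' : b < B := Finset.mem_range.mp hb
  -- Terms with k < b have vanishing binomial coefficient, so the sum over k starts at b and is
  -- reindexed as b + k.
  rw [psAct_eq_sum (K := M - b) fun k hk => hK b k (by omega),
    show M = b + (M - b) by omega, Finset.sum_range_add, Finset.sum_eq_zero, zero_add,
    show b + (M - b) - b = M - b by omega]
  · refine Finset.sum_congr rfl fun k _ => ?_
    rw [taylorCoeff, PowerSeries.coeff_mk, smul_smul, Nat.add_sub_cancel_left]
  · intro k hk
    rw [Nat.choose_eq_zero_of_lt (by simpa using hk), Nat.cast_zero, zero_mul, zero_smul, smul_zero]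

end Levels

/-! ### Exchange relations for coefficients of operator products -/

section Contraction

variable {V : Type*} [AddCommGroup V] [Module ℂ V] {Y : V →ₗ[ℂ] E V} {T : Set V}

lemma IsPower.act_prod_X_of_le {r : ℕ} {F : (Fin r → ℤ) → V} {N M : ℕ} (hNM : N ≤ M)
    (h : IsPower (FormalVA.act ((∏ i, X i) ^ N) F)) :
    IsPower (FormalVA.act ((∏ i, X i) ^ M) F) := by
  rw [← Nat.sub_add_cancel hNM, pow_add, act_mul]
  exact h.act _

lemma shiftHom_zero_rename_succ (j : Fin 2) :
    shiftHom 0 j.succ (rename Fin.succ swapDiff : MvPolynomial (Fin 3) ℂ) =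
      rename Fin.succ swapDiff := by
  simp only [swapDiff, map_sub, rename_X, shiftHom_X_of_ne _ (Fin.succ_ne_zero _)]

/-- Exchange relations in three variables pass to the coefficients of operator product
expansions, up to powers of `x_2 - x_1` which do not depend on the vector. -/
lemma exists_act_level_eq_zero {j : Fin 2} {c : ℂ} {δ : MvPolynomial (Fin 3) ℂ}
    (hδ0 : constantCoeff δ = 0)
    (hδ : shiftHom 0 j.succ δ = rename Fin.succ swapDiff + C c * X 0) {α : Type*} [Fintype α] {k₁ k₂ : ℕ}
    {F F₁ : V → (Fin 3 → ℤ) → V} {S S₁ : α → V → (Fin 3 → ℤ) → V}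
    {φ γ : α → PowerSeries ℂ}
    (hrel : ∀ w, act (rename Fin.succ swapDiff ^ k₁ * δ ^ k₂) (F w) =
      ∑ i, psAct (φ i) (rename Fin.succ swapDiff) (psAct (γ i) δ (S i w)))
    (hpole : ∃ P ∈ diffMonoid (Fin 3), ∀ w, IsLowerTruncated (act P (F w)) ∧
      ∀ i, IsLowerTruncated (act P (S i w)))
    (hF : ∀ w t, IsOPE (slice 0 j.succ t (F w)) (slice 0 j.succ t (F₁ w)))
    (hS : ∀ i w t, IsOPE (slice 0 j.succ t (S i w)) (slice 0 j.succ t (S₁ i w)))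
    (hSfin : ∀ i w, LocFin (S i w)) (hF₁fin : ∀ w, LocFin (F₁ w)) (hS₁fin : ∀ i w, LocFin (S₁ i w))
    {a : ℤ} (hF₁ : ∀ w m, m 0 < a → F₁ w m = 0) (hS₁ : ∀ i w m, m 0 < a → S₁ i w m = 0) (l : ℤ) :
    ∃ K : ℕ, ∀ w, act (swapDiff ^ K) (level l
      (act (rename Fin.succ swapDiff ^ k₁ * (rename Fin.succ swapDiff + C c * X 0) ^ k₂) (F₁ w) -
        ∑ i, psAct (φ i) (rename Fin.succ swapDiff)
          (psAct (γ i) (rename Fin.succ swapDiff + C c * X 0) (S₁ i w)))) = 0 := by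
  have h0 : constantCoeff (rename Fin.succ swapDiff : MvPolynomial (Fin 3) ℂ) = 0 := by
    rw [constantCoeff_rename, constantCoeff_swapDiff]
  have h0' : constantCoeff (rename Fin.succ swapDiff + C c * X 0 : MvPolynomial (Fin 3) ℂ) = 0 := by
    simp [h0]
  have h0j : (0 : Fin 3) ≠ j.succ := (Fin.succ_ne_zero j).symm
  set D := fun w =>
    act (rename Fin.succ swapDiff ^ k₁ * (rename Fin.succ swapDiff + C c * X 0) ^ k₂) (F₁ w) -
        ∑ i, psAct (φ i) (rename Fin.succ swapDiff)
          (psAct (γ i) (rename Fin.succ swapDiff + C c * X 0) (S₁ i w)) with hD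
  obtain ⟨P, hP, hPF⟩ := hpole
  obtain ⟨e, R, hR, hlead⟩ := exists_hasLead j hP
  obtain ⟨κ, p, hp, rfl⟩ := exists_eq_pow_mul_of_mem_diffMonoid hR
  -- The number of x_0-levels from a up to l. With the pole order κ of the lead it yields an
  -- exponent that does not depend on w.
  set k := (l - a).toNat + 1 with hk
  refine ⟨κ * k, fun w => ?_⟩
  obtain ⟨N₀, hN₀⟩ := isLowerTruncated_iff.mp (hPF w).1
  have hNi : ∀ i, ∃ N : ℕ, IsPower (act ((∏ i, X i) ^ N) (act P (S i w))) := fun i =>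
    isLowerTruncated_iff.mp ((hPF w).2 i)
  choose Ni hNi using hNi
  set N := max N₀ (Finset.univ.sup Ni)
  have hQF : IsPower (act ((∏ i, X i) ^ N * P) (F w)) := by
    rw [act_mul]
    exact hN₀.act_prod_X_of_le (le_max_left _ _)
  have hQS : ∀ i, IsPower (act ((∏ i, X i) ^ N * P) (S i w)) := fun i => by
    rw [act_mul]
    exact (hNi i).act_prod_X_of_le ((Finset.le_sup (Finset.mem_univ i)).trans (le_max_right _ _))
  obtain ⟨R', hR'⟩ := ((hasLead_prod_X (j := j)).pow N).mul hlead
  set Q := (∏ i, X i) ^ N * P with hQ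
  -- The relation for F and S is multiplied by Q and then translated; the cleared series become the
  -- shifted Q applied to F₁ and S₁, and δ becomes (x_2 - x_1) + c x_0.
  have key : act (shiftHom 0 j.succ Q) (D w) = 0 := by
    have h1 : act (rename Fin.succ swapDiff ^ k₁ * δ ^ k₂) (act Q (F w)) =
        ∑ i, psAct (φ i) (rename Fin.succ swapDiff) (psAct (γ i) δ (act Q (S i w))) := by
      rw [act_comm, hrel, map_sum]
      refine Finset.sum_congr rfl fun i _ => ?_
      rw [psAct_act (hSfin i w) hδ0, psAct_act ((hSfin i w).psAct hδ0 _) h0]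
    have h2 := congrArg (translate 0 j.succ 0) h1
    rw [translate_act h0j _ (hQF.eq_zero_of_lt _), ← IsOPE.transfer h0j (hF w) hQF, map_sum,
      map_mul, map_pow, map_pow, hδ, shiftHom_zero_rename_succ] at h2
    rw [hD]
    simp only
    rw [map_sub, act_comm, h2, map_sum, sub_eq_zero]
    refine Finset.sum_congr rfl fun i _ => ?_
    rw [translate_psAct h0j ((hQS i).psAct _) h0 (by rw [shiftHom_zero_rename_succ, h0]),
      translate_psAct h0j (hQS i) hδ0 (by rw [hδ, h0']), shiftHom_zero_rename_succ, hδ,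
      ← IsOPE.transfer h0j (hS i w) (hQS i), psAct_act (hS₁fin i w) h0',
      psAct_act ((hS₁fin i w).psAct h0' _) h0]
  have hDlow : ∀ m : Fin 3 → ℤ, m 0 < a → D w m = 0 := by
    intro m hm
    have hZ : ∀ m : Fin 3 → ℤ, m ∈ {m : Fin 3 → ℤ | m 0 < a} → ∀ e : Fin 3 →₀ ℕ,
        (fun i => m i - (e i : ℤ)) ∈ {m : Fin 3 → ℤ | m 0 < a} := by
      intro m hm e
      simp only [Set.mem_ofPred_eq] at hm ⊢
      omega
    have hps : ∀ (ψ : PowerSeries ℂ) (ε : MvPolynomial (Fin 3) ℂ) (G : (Fin 3 → ℤ) → V),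
        (∀ m ∈ {m : Fin 3 → ℤ | m 0 < a}, G m = 0) →
        ∀ m ∈ {m : Fin 3 → ℤ | m 0 < a}, psAct ψ ε G m = 0 := fun ψ ε G hG m hm =>
      finsum_eq_zero_of_forall_eq_zero fun k => by
        rw [act_eq_zero_of_mem hZ hG _ m hm, smul_zero]
    simp only [hD]
    rw [Pi.sub_apply, Finset.sum_apply, act_eq_zero_of_mem hZ (fun m hm => hF₁ w m hm) _ m hm,
      Finset.sum_eq_zero, sub_zero]
    exact fun i _ => hps _ _ _ (hps _ _ _ fun m hm => hS₁ i w m hm) m hm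
  have hDfin : LocFin (D w) :=
    ((hF₁fin w).act _).sub (LocFin.sum fun i _ => ((hS₁fin i w).psAct h0' _).psAct h0 _)
  rw [hR'] at key
  -- The lead argument isolates one level. Monomials cancel and p is invertible, so only a power of
  -- the difference remains.
  have h1 : act (((X j * ∏ i, X i) ^ N * ((X 0 - X 1) ^ κ * p)) ^ k) (level l (D w)) = 0 := by
    rw [← level_act_rename_succ, map_pow]
    funext t
    exact act_pow_lead_eq_zero (Z := Set.univ) (fun _ _ _ => Set.mem_univ _)
      (fun m _ => by rw [key]; rfl) hDlow k _ (Set.mem_univ _) (by rw [Fin.cons_zero]; omega)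
  rw [mul_pow, ← pow_mul, act_mul] at h1
  have h2 := act_pow_eq_zero_of (fun _ => act_X_mul_prod_X_eq_zero) _ h1
  rw [mul_pow, mul_comm, ← pow_mul, act_mul] at h2
  have h3 := ((hDfin.level l).act _).eq_zero_of_act (by rw [map_pow]; exact pow_ne_zero _ hp) h2
  rw [show swapDiff ^ (κ * k) = (-1) ^ (κ * k) * (X 0 - X 1) ^ (κ * k) by
    rw [← mul_pow, swapDiff]; ring, act_mul, h3, map_zero]

/-- The coefficient of x_0^l in the contracted relation consists of (x_2 - x_1)^(k₁ + k₂) times the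
level l of F₁, lower levels of F₁, and levels of the S₁. Induction on l handles the lower levels. -/
theorem isExchangeable_level {j : Fin 2} {c : ℂ} {δ : MvPolynomial (Fin 3) ℂ}
    (hδ0 : constantCoeff δ = 0)
    (hδ : shiftHom 0 j.succ δ = rename Fin.succ swapDiff + C c * X 0) {α : Type*} [Fintype α] {k₁ k₂ : ℕ}
    {F F₁ : V → (Fin 3 → ℤ) → V} {S S₁ : α → V → (Fin 3 → ℤ) → V}
    {φ γ : α → PowerSeries ℂ}
    (hrel : ∀ w, act (rename Fin.succ swapDiff ^ k₁ * δ ^ k₂) (F w) =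
      ∑ i, psAct (φ i) (rename Fin.succ swapDiff) (psAct (γ i) δ (S i w)))
    (hpole : ∃ P ∈ diffMonoid (Fin 3), ∀ w, IsLowerTruncated (act P (F w)) ∧
      ∀ i, IsLowerTruncated (act P (S i w)))
    (hF : ∀ w t, IsOPE (slice 0 j.succ t (F w)) (slice 0 j.succ t (F₁ w)))
    (hS : ∀ i w t, IsOPE (slice 0 j.succ t (S i w)) (slice 0 j.succ t (S₁ i w)))
    (hSfin : ∀ i w, LocFin (S i w)) (hF₁fin : ∀ w, LocFin (F₁ w)) (hS₁fin : ∀ i w, LocFin (S₁ i w))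
    {a : ℤ} (hF₁ : ∀ w m, m 0 < a → F₁ w m = 0) (hS₁ : ∀ i w m, m 0 < a → S₁ i w m = 0)
    (hmem : ∀ i l, (fun w => level l (S₁ i w)) ∈ oppSpan Y T) (l : ℤ) :
    IsExchangeable Y T fun w => level l (F₁ w) := by
  have h0 : constantCoeff (rename Fin.succ swapDiff : MvPolynomial (Fin 3) ℂ) = 0 := by
    rw [constantCoeff_rename, constantCoeff_swapDiff]
  have hlow : ∀ (G : (Fin 3 → ℤ) → V), (∀ m, m 0 < a → G m = 0) → ∀ l < a, level l G = 0 :=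
    fun G hG l hl => funext fun t => hG _ (by rwa [Fin.cons_zero])
  suffices h : ∀ n : ℕ, ∀ l < a + n, IsExchangeable Y T fun w => level l (F₁ w) from
    h (l - a + 1).toNat l (by omega)
  intro n
  induction n with
  | zero =>
    intro l hl
    convert isExchangeable_of_mem (oppSpan Y T).zero_mem using 1
    exact funext fun w => hlow _ (hF₁ w) l (by simpa using hl)
  | succ n ih =>
    intro l hl
    obtain ⟨K, hK⟩ := exists_act_level_eq_zero hδ0 hδ hrel hpole hF hS hSfin hF₁fin hS₁fin hF₁ hS₁ l
    set B := (l - a).toNat with hB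
    have hBlow : ∀ (G : (Fin 3 → ℤ) → V), (∀ m, m 0 < a → G m = 0) →
        ∀ b : ℕ, B + 1 ≤ b → level (l - b) G = 0 := fun G hG b hb => hlow G hG _ (by omega)
    have hS₁low : ∀ i w, ∀ b : ℕ, B + 1 ≤ b → level (l - b) (S₁ i w) = 0 := fun i w =>
      hBlow _ (hS₁ i w)
    -- `G` is the right side of the relation at level l, and `H` the terms of the left side with
    -- lower levels of F₁. They have to cancel against the leading term after multiplication by the
    -- K-th power.
    let G : V → (Fin 2 → ℤ) → V := ∑ i, ∑ b ∈ Finset.range (B + 1), fun w =>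
      psAct (φ i) swapDiff (psAct (taylorCoeff (γ i) c b) swapDiff (level (l - b) (S₁ i w)))
    let H : V → (Fin 2 → ℤ) → V := ∑ b ∈ Finset.range B, (((k₂.choose (b + 1) : ℂ) * c ^ (b + 1)) •
      fun w => act (swapDiff ^ (k₁ + (k₂ - (b + 1)))) (level (l - (b + 1 : ℕ)) (F₁ w)))
    have hG : IsExchangeable Y T G := IsExchangeable.sum fun i _ => IsExchangeable.sum fun b _ =>
      isExchangeable_of_mem (psAct_mem_oppSpan (psAct_mem_oppSpan (hmem i _) _) _)
    have hH : IsExchangeable Y T H := IsExchangeable.sum fun b _ =>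
      ((ih _ (by push_cast at hl ⊢; omega)).act _).smul _
    refine IsExchangeable.of_act (n := K + (k₁ + k₂)) ?_
    convert (hG.add (hH.smul (-1))).act K using 1
    funext w
    rw [pow_add, act_mul, ← sub_eq_zero, ← map_sub]
    refine Eq.trans ?_ (hK w)
    congr 1
    rw [map_sub, map_sum, act_mul, ← map_pow (rename Fin.succ), level_act_rename_succ,
      level_act_add_pow _ _ _ (hBlow _ (hF₁ w)), Finset.sum_range_succ', map_add, map_sum]
    simp only [level_psAct_rename_succ,
      level_psAct_add constantCoeff_swapDiff c _ (hS₁fin _ w) (hS₁low _ w)]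
    simp only [Pi.add_apply, Pi.neg_apply, Pi.smul_apply, G, H, Finset.sum_apply, map_smul, neg_smul, one_smul,
      ← act_mul, ← pow_add, Nat.choose_zero_right, Nat.cast_one, pow_zero, mul_one, Nat.sub_zero,
      Nat.cast_zero, sub_zero]
    have h1 : ∀ i, psAct (φ i) swapDiff (∑ b ∈ Finset.range (B + 1),
        psAct (taylorCoeff (γ i) c b) swapDiff (level (l - b) (S₁ i w))) =
        ∑ b ∈ Finset.range (B + 1), psAct (φ i) swapDiff
          (psAct (taylorCoeff (γ i) c b) swapDiff (level (l - b) (S₁ i w))) := fun i =>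
      psAct_sum (fun b _ => ((hS₁fin i w).level _).psAct constantCoeff_swapDiff _)
        constantCoeff_swapDiff _
    simp only [h1]
    abel

end Contraction

/-! ### Commuting power series actions and slices -/

section Commutation

variable {ι V : Type*} [Fintype ι] [AddCommGroup V] [Module ℂ V]

lemma LocFin.exists_bound₂ {F : (ι → ℤ) → V} (hF : LocFin F) {δ : MvPolynomial ι ℂ}
    (hδ : constantCoeff δ = 0) (m : ι → ℤ) :
    ∃ K : ℕ, ∀ n, K ≤ n → ∀ p, FormalVA.act (δ ^ n) (FormalVA.act p F) m = 0 := by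
  obtain ⟨K, hK⟩ := ((hF m).image fun e => ∑ i, e i).bddAbove
  refine ⟨K + 1, fun n hn p => act_pow_eq_zero hδ n fun e he => ?_⟩
  rw [act_eq_sum]
  refine Finset.sum_eq_zero fun e' _ => ?_
  by_contra h
  have h1 : F (fun i => m i - ((e + e' : ι → ℕ) i : ℤ)) ≠ 0 := by
    refine fun h0 => h ?_
    rw [← smul_zero (p.coeff e'), ← h0]
    congr 2
    funext i
    simp only [Pi.add_apply]
    push_cast
    ring
  have := hK ⟨e + e', h1, rfl⟩
  simp only [Pi.add_apply, Finset.sum_add_distrib] at this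
  omega

/-- In each coefficient both sides are the same finite double sum. The bounds in
`LocFin.exists_bound₂` are uniform in the inner polynomial, which makes the double sum finite. -/
lemma psAct_comm {F : (ι → ℤ) → V} (hF : LocFin F) {δ ε : MvPolynomial ι ℂ}
    (hδ : constantCoeff δ = 0) (hε : constantCoeff ε = 0) (φ γ : PowerSeries ℂ) :
    psAct φ δ (psAct γ ε F) = psAct γ ε (psAct φ δ F) := by
  funext m
  obtain ⟨K, hK⟩ := hF.exists_bound₂ hδ m
  obtain ⟨K', hK'⟩ := hF.exists_bound₂ hε m
  have h1 : ∀ n, act (δ ^ n) (psAct γ ε F) m = ∑ l ∈ Finset.range K',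
      PowerSeries.coeff l γ • act (ε ^ l) (act (δ ^ n) F) m := fun n => by
    rw [← psAct_act hF hε, psAct_eq_sum fun l hl => hK' l hl _]
  have h2 : ∀ l, act (ε ^ l) (psAct φ δ F) m = ∑ n ∈ Finset.range K,
      PowerSeries.coeff n φ • act (δ ^ n) (act (ε ^ l) F) m := fun l => by
    rw [← psAct_act hF hδ, psAct_eq_sum fun n hn => hK n hn _]
  rw [psAct_eq_sum (K := K) fun n hn => by
      rw [h1]
      exact Finset.sum_eq_zero fun l _ => by rw [act_comm, hK n hn, smul_zero],
    psAct_eq_sum (K := K') fun l hl => by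
      rw [h2]
      exact Finset.sum_eq_zero fun n _ => by rw [act_comm, hK' l hl, smul_zero]]
  simp only [h1, h2, Finset.smul_sum]
  rw [Finset.sum_comm]
  refine Finset.sum_congr rfl fun l _ => Finset.sum_congr rfl fun n _ => ?_
  rw [smul_comm, act_comm]

variable [DecidableEq ι] {i j : ι}

lemma slice_act_rename (hij : i ≠ j) (p : MvPolynomial (Fin 2) ℂ) (t : ι → ℤ)
    (F : (ι → ℤ) → V) : slice i j t (act (rename ![i, j] p) F) = act p (slice i j t F) := by
  induction p using MvPolynomial.induction_on generalizing F with
  | C c => rw [rename_C, act_C, act_C, map_smul]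
  | add p q hp hq => rw [map_add, act_add, act_add, map_add, hp, hq]
  | mul_X p k hp =>
    rw [map_mul, act_mul, act_mul, hp, rename_X]
    congr 1
    obtain rfl | rfl : k = 0 ∨ k = 1 := by omega
    · exact slice_act_X_fst hij t F
    · exact slice_act_X_snd hij t F

lemma slice_psAct_rename (hij : i ≠ j) (φ : PowerSeries ℂ) (p : MvPolynomial (Fin 2) ℂ)
    (t : ι → ℤ) (F : (ι → ℤ) → V) :
    slice i j t (psAct φ (rename ![i, j] p) F) = psAct φ p (slice i j t F) := by
  funext m
  rw [slice_apply]
  refine finsum_congr fun k => ?_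
  rw [← slice_act_rename hij, map_pow (rename ![i, j])]
  rfl

end Commutation

/-! ### Propagation of exchange relations to all states -/

section TripleProducts

variable {V : Type*} [AddCommGroup V] [Module ℂ V]

/-- The series `a(x_i) b(x_j) c(x_k) w`. -/
def tripleSeries (i j k : Fin 3) (a b c : E V) (w : V) : (Fin 3 → ℤ) → V :=
  fun m => cf a (m i) (cf b (m j) (cf c (m k) w))

lemma locFin_tripleSeries {i j k : Fin 3} (hij : i ≠ j) (hik : i ≠ k) (hjk : j ≠ k)
    (a b c : E V) (w : V) : LocFin (tripleSeries i j k a b c w) := by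
  refine locFin_of_three hjk.symm hik.symm hij.symm ?_ (fun s => ?_) fun s t => ?_
  · obtain ⟨N, hN⟩ := exists_cf_eq_zero c w
    exact ⟨N, fun m hm => by rw [tripleSeries, hN _ hm, map_zero, map_zero]⟩
  · obtain ⟨N, hN⟩ := exists_cf_eq_zero b (cf c s w)
    exact ⟨N, fun m h hm => by rw [tripleSeries, h, hN _ hm, map_zero]⟩
  · obtain ⟨N, hN⟩ := exists_cf_eq_zero a (cf b t (cf c s w))
    exact ⟨N, fun m h h' hm => by rw [tripleSeries, h, h', hN _ hm]⟩

variable {Y : V →ₗ[ℂ] E V} {one : V} {U : Set V}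

lemma IsGenerated.exists_pole_tripleSeries (h : IsGenerated Y one U) {i j k : Fin 3} (hij : i ≠ j)
    (hik : i ≠ k) (hjk : j ≠ k) (a b c : V) : ∃ P ∈ diffMonoid (Fin 3), ∀ w,
      IsLowerTruncated (act P (tripleSeries i j k (Y a) (Y b) (Y c) w)) := by
  obtain ⟨P, hP, h1, -⟩ := IsRational.named (l := [(i, Y a), (j, Y b), (k, Y c)]) (one := one)
    ⟨by simp [hij, hik, hjk], fun l => by simp; omega⟩ (h.rational [a, b, c])
  refine ⟨P, hP, fun w => ?_⟩
  convert h1 w using 2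
  funext m
  simp [namedProd, tripleSeries]

lemma exists_common_pole {n : ℕ} {α : Type*} [Fintype α] {F : V → (Fin n → ℤ) → V}
    {S : α → V → (Fin n → ℤ) → V}
    (hF : ∃ P ∈ diffMonoid (Fin n), ∀ w, IsLowerTruncated (act P (F w)))
    (hS : ∀ a, ∃ P ∈ diffMonoid (Fin n), ∀ w, IsLowerTruncated (act P (S a w))) :
    ∃ P ∈ diffMonoid (Fin n), ∀ w, IsLowerTruncated (act P (F w)) ∧
      ∀ a, IsLowerTruncated (act P (S a w)) := by
  obtain ⟨P, hP, hPF⟩ := hF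
  choose Q hQ hQS using hS
  refine ⟨P * ∏ a, Q a, mul_mem hP (prod_mem fun a _ => hQ a), fun w => ⟨?_, fun a => ?_⟩⟩
  · rw [mul_comm, act_mul]
    exact (hPF w).act _
  · obtain ⟨D, hD⟩ := (Finset.dvd_prod_of_mem Q (Finset.mem_univ a)).mul_left P
    rw [hD, mul_comm, act_mul]
    exact (hQS a w).act _

lemma exists_common_bound {α : Type*} [Finite α] (a : V → E V) (b : V) (c : V) (f g : α → V) :
    ∃ N : ℤ, (∀ m < N, cf (a b) m c = 0) ∧ ∀ i, ∀ m < N, cf (a (f i)) m (g i) = 0 := by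
  obtain ⟨N, hN⟩ := exists_cf_eq_zero (a b) c
  have h1 : ∀ i, ∃ M : ℤ, ∀ m < M, cf (a (f i)) m (g i) = 0 := fun i => exists_cf_eq_zero _ _
  choose M hM using h1
  obtain ⟨M', hM'⟩ := (Set.finite_range M).bddBelow
  exact ⟨min N M', fun m hm => hN m (by omega), fun i m hm =>
    hM i m (lt_of_lt_of_le hm ((min_le_right _ _).trans (hM' ⟨i, rfl⟩)))⟩

variable {T T' : Set V}

lemma IsExchangeable.exists_sum {F : V → (Fin 2 → ℤ) → V} (hF : IsExchangeable Y T F) :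
    ∃ (k r : ℕ) (φ : Fin r → PowerSeries ℂ) (u v : Fin r → V), (∀ i, u i ∈ T) ∧ ∀ w,
      FormalVA.act (swapDiff ^ k) (F w) =
        ∑ i, psAct (φ i) swapDiff (oppSeries (Y (u i)) (Y (v i)) w) := by
  obtain ⟨k, hk⟩ := hF
  exact ⟨k, exists_eq_sum_of_mem_oppSpan hk⟩

lemma IsExchangeable.exists_sum_of_fintype {α : Type*} [Fintype α] {F : α → V → (Fin 2 → ℤ) → V}
    (hF : ∀ a, IsExchangeable Y T (F a)) :
    ∃ (k : ℕ) (r : α → ℕ) (φ : ∀ a, Fin (r a) → PowerSeries ℂ) (u v : ∀ a, Fin (r a) → V),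
      (∀ a i, u a i ∈ T) ∧ ∀ a w, FormalVA.act (swapDiff ^ k) (F a w) =
        ∑ i, psAct (φ a i) swapDiff (oppSeries (Y (u a i)) (Y (v a i)) w) := by
  choose k hk using hF
  have h1 : ∀ a, (fun w => FormalVA.act (swapDiff ^ (Finset.univ.sup k)) (F a w)) ∈
      oppSpan Y T := fun a => by
    convert act_mem_oppSpan (hk a) (Finset.univ.sup k - k a) using 1
    funext w
    rw [← act_mul, ← pow_add, Nat.sub_add_cancel (Finset.le_sup (Finset.mem_univ a))]
  choose r φ u v hu h2 using fun a => exists_eq_sum_of_mem_oppSpan (h1 a)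
  exact ⟨_, r, φ, u, v, hu, h2⟩

/-- Exchange relations for a pair of variables in a series in three variables. -/
lemma act_eq_sum_of_slice {i j : Fin 3} (hij : i ≠ j) {F : (Fin 3 → ℤ) → V} {α : Type*} [Fintype α]
    {G : α → (Fin 3 → ℤ) → V} {k : ℕ} {φ : α → PowerSeries ℂ} {F' : V → (Fin 2 → ℤ) → V}
    {u v : α → E V}
    (h : ∀ w, act (swapDiff ^ k) (F' w) = ∑ a, psAct (φ a) swapDiff (oppSeries (u a) (v a) w))
    (f : (Fin 3 → ℤ) → Module.End ℂ V) (w : (Fin 3 → ℤ) → V)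
    (hF : ∀ t, slice i j t F = fun m => f t (F' (w t) m))
    (hG : ∀ a t, slice i j t (G a) = fun m => f t (oppSeries (u a) (v a) (w t) m)) :
    act (rename ![i, j] swapDiff ^ k) F = ∑ a, psAct (φ a) (rename ![i, j] swapDiff) (G a) := by
  refine ext_slice (i := i) (j := j) fun t => ?_
  rw [← map_pow, slice_act_rename hij, map_sum, hF, act_map, h]
  funext m
  rw [Finset.sum_apply, Finset.sum_apply, map_sum]
  refine Finset.sum_congr rfl fun a _ => ?_
  rw [slice_psAct_rename hij, hG, psAct_map _ (locFin_oppSeries _ _ _) constantCoeff_swapDiff]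

lemma constantCoeff_rename_swapDiff (i j : Fin 3) :
    constantCoeff (rename ![i, j] swapDiff) = 0 := by
  rw [constantCoeff_rename, constantCoeff_swapDiff]

lemma rename_succ_swapDiff :
    rename Fin.succ swapDiff = (rename ![1, 2] swapDiff : MvPolynomial (Fin 3) ℂ) := by
  simp only [swapDiff, map_sub, rename_X]
  rfl

/-- In Y(u)Y(a)Y(b) the first field is moved past Y(a) and then past Y(b). The remaining fields are
then neighbours on the left, and their operator product coefficients give the required relation. -/
theorem IsGenerated.isExchangeable_right (h : IsGenerated Y one U) {u a b : V}
    (h1 : IsExchangeable Y T (prodSeries (Y u) (Y a)))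
    (h2 : ∀ c ∈ T, IsExchangeable Y T' (prodSeries (Y c) (Y b))) (l : ℤ) :
    IsExchangeable Y T' (prodSeries (Y u) (Y (cf (Y a) l b))) := by
  obtain ⟨k, r, φ, u₁, a₁, hu₁, h1⟩ := h1.exists_sum
  obtain ⟨k', r', γ, u₂, b₂, hu₂, h2⟩ :=
    IsExchangeable.exists_sum_of_fintype fun i => h2 (u₁ i) (hu₁ i)
  obtain ⟨N, hN, hN'⟩ := exists_common_bound (fun v => Y v) a b
    (fun i : Σ i, Fin (r' i) => a₁ i.1) fun i => b₂ i.1 i.2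
  -- The fields of u, a, b carry x_1, x_0, x_2. Exchanging u and a gives δ = x_0 - x_1, which
  -- becomes (x_2 - x_1) + x_0 when x_0 is shifted by x_2; hence c = 1.
  set δ : MvPolynomial (Fin 3) ℂ := rename ![1, 0] swapDiff with hδ
  have hδ0 : constantCoeff δ = 0 := constantCoeff_rename_swapDiff _ _
  have h0 : constantCoeff (rename Fin.succ swapDiff : MvPolynomial (Fin 3) ℂ) = 0 := by
    rw [constantCoeff_rename, constantCoeff_swapDiff]
  have key := isExchangeable_level (Y := Y) (T := T') (j := 1) (c := 1) (δ := δ) hδ0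
    ?_ (α := Σ i, Fin (r' i)) (k₁ := k') (k₂ := k)
    (F := fun w => tripleSeries 1 0 2 (Y u) (Y a) (Y b) w)
    (F₁ := fun w m => cf (Y u) (m 1) (cf (Y (cf (Y a) (m 0) b)) (m 2) w))
    (S := fun i w => tripleSeries 0 2 1 (Y (a₁ i.1)) (Y (b₂ i.1 i.2)) (Y (u₂ i.1 i.2)) w)
    (S₁ := fun i w m => cf (Y (cf (Y (a₁ i.1)) (m 0) (b₂ i.1 i.2))) (m 2)
      (cf (Y (u₂ i.1 i.2)) (m 1) w))
    (φ := fun i => γ i.1 i.2) (γ := fun i => φ i.1) (fun w => ?_)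
    (exists_common_pole (h.exists_pole_tripleSeries (by decide) (by decide) (by decide) _ _ _)
      fun i => h.exists_pole_tripleSeries (by decide) (by decide) (by decide) _ _ _)
    (fun w t => ?_) (fun i w t => ?_)
    (fun i w => locFin_tripleSeries (by decide) (by decide) (by decide) _ _ _ w)
    (fun w => ?_) (fun i w => ?_) (a := N) (fun w m hm => ?_) (fun i w m hm => ?_) (fun i l => ?_) l
  · exact key
  · simp only [hδ, swapDiff, map_sub, rename_X, C_1, one_mul]
    simp only [Matrix.cons_val_zero, Matrix.cons_val_one, Fin.succ_one_eq_two, Fin.succ_zero_eq_one]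
    rw [shiftHom_X_self, shiftHom_X_of_ne _ (by decide)]
    ring
  · have e1 : act (δ ^ k) (tripleSeries 1 0 2 (Y u) (Y a) (Y b) w) =
        ∑ i, psAct (φ i) δ (tripleSeries 0 1 2 (Y (a₁ i)) (Y (u₁ i)) (Y b) w) := by
      refine act_eq_sum_of_slice (by decide) h1 (fun _ => LinearMap.id) (fun t => cf (Y b) (t 2) w)
        (fun t => ?_) fun i t => ?_ <;>
      exact slice_eq_of_eq fun a b => by simp [tripleSeries, prodSeries, oppSeries]
    have e2 : ∀ i, act (rename Fin.succ swapDiff ^ k')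
        (tripleSeries 0 1 2 (Y (a₁ i)) (Y (u₁ i)) (Y b) w) =
        ∑ j, psAct (γ i j) (rename Fin.succ swapDiff)
          (tripleSeries 0 2 1 (Y (a₁ i)) (Y (b₂ i j)) (Y (u₂ i j)) w) := by
      intro i
      rw [rename_succ_swapDiff]
      refine act_eq_sum_of_slice (by decide) (h2 i) (fun t => cf (Y (a₁ i)) (t 0)) (fun _ => w)
        (fun t => ?_) fun j t => ?_ <;>
      exact slice_eq_of_eq fun a b => by simp [tripleSeries, prodSeries, oppSeries]
    rw [act_mul, e1, map_sum, Fintype.sum_sigma]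
    refine Finset.sum_congr rfl fun i _ => ?_
    rw [← psAct_act (locFin_tripleSeries (by decide) (by decide) (by decide) _ _ _ w) hδ0, e2,
      psAct_sum (fun j _ => (locFin_tripleSeries (by decide) (by decide) (by decide) _ _ _ w).psAct
        h0 _) hδ0]
    exact Finset.sum_congr rfl fun j _ => psAct_comm
      (locFin_tripleSeries (by decide) (by decide) (by decide) _ _ _ w) hδ0 h0 _ _
  · have e1 := (h.isOPE_all a b w).map (cf (Y u) (t 1))
    convert e1 using 1
    · exact slice_eq_of_eq fun a b => by simp [tripleSeries, prodSeries]
    · exact slice_eq_of_eq fun a b => by simp [iterateSeries]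
  · have e1 := h.isOPE_all (a₁ i.1) (b₂ i.1 i.2) (cf (Y (u₂ i.1 i.2)) (t 1) w)
    convert e1 using 1
    · exact slice_eq_of_eq fun a b => by simp [tripleSeries, prodSeries]
    · exact slice_eq_of_eq fun a b => by simp [iterateSeries]
  · refine locFin_of_three (i := 0) (j := 2) (k := 1) (by decide) (by decide) (by decide)
      ⟨N, fun m hm => by simp only [hN _ hm, map_zero, cf_zero, LinearMap.zero_apply]⟩
      (fun s => ?_) fun s t => ?_
    · obtain ⟨M, hM⟩ := exists_cf_eq_zero (Y (cf (Y a) s b)) w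
      exact ⟨M, fun m h hm => by simp only [h, hM _ hm, map_zero]⟩
    · obtain ⟨M, hM⟩ := exists_cf_eq_zero (Y u) (cf (Y (cf (Y a) s b)) t w)
      exact ⟨M, fun m h h' hm => by simp only [h, h', hM _ hm]⟩
  · refine locFin_of_three (i := 0) (j := 1) (k := 2) (by decide) (by decide) (by decide)
      ⟨N, fun m hm => by simp only [hN' i _ hm, map_zero, cf_zero, LinearMap.zero_apply]⟩
      (fun s => ?_) fun s t => ?_
    · obtain ⟨M, hM⟩ := exists_cf_eq_zero (Y (u₂ i.1 i.2)) w
      exact ⟨M, fun m h hm => by simp only [hM _ hm, map_zero]⟩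
    · obtain ⟨M, hM⟩ := exists_cf_eq_zero (Y (cf (Y (a₁ i.1)) s (b₂ i.1 i.2)))
        (cf (Y (u₂ i.1 i.2)) t w)
      exact ⟨M, fun m h h' hm => by simp only [h, h', hM _ hm]⟩
  · simp only [hN _ hm, map_zero, cf_zero, LinearMap.zero_apply]
  · simp only [hN' i _ hm, map_zero, cf_zero, LinearMap.zero_apply]
  · exact oppSeries_mem_oppSpan (Y := Y) (hu₂ i.1 i.2) (cf (Y (a₁ i.1)) l (b₂ i.1 i.2))

/-- In Y(c)Y(d)Y(v) the last field is moved to the left past Y(d) and then past Y(c), after which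
the two others are contracted. The contracted states are arbitrary, so the exchanged fields are no
longer confined to a subset. -/
theorem IsGenerated.isExchangeable_left (h : IsGenerated Y one U) {c d v : V}
    (h1 : IsExchangeable Y T (prodSeries (Y d) (Y v)))
    (h2 : ∀ v, IsExchangeable Y T' (prodSeries (Y c) (Y v))) (l : ℤ) :
    IsExchangeable Y Set.univ (prodSeries (Y (cf (Y c) l d)) (Y v)) := by
  obtain ⟨k, r, φ, d₁, v₁, -, h1⟩ := h1.exists_sum
  obtain ⟨k', r', γ, c₂, v₂, -, h2⟩ := IsExchangeable.exists_sum_of_fintype fun i => h2 (v₁ i)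
  obtain ⟨N, hN, hN'⟩ := exists_common_bound (fun v => Y v) c d
    (fun i : Σ i, Fin (r' i) => c₂ i.1 i.2) fun i => d₁ i.1
  -- The fields of c, d, v carry x_0, x_1, x_2. Exchanging c and v gives δ = x_2 - x_0, which
  -- becomes (x_2 - x_1) - x_0 when x_0 is shifted by x_1; hence c = -1.
  set δ : MvPolynomial (Fin 3) ℂ := rename ![0, 2] swapDiff with hδ
  have hδ0 : constantCoeff δ = 0 := constantCoeff_rename_swapDiff _ _
  have h0 : constantCoeff (rename Fin.succ swapDiff : MvPolynomial (Fin 3) ℂ) = 0 := by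
    rw [constantCoeff_rename, constantCoeff_swapDiff]
  have key := isExchangeable_level (Y := Y) (T := Set.univ) (j := 0) (c := -1) (δ := δ) hδ0
    ?_ (α := Σ i, Fin (r' i)) (k₁ := k) (k₂ := k')
    (F := fun w => tripleSeries 0 1 2 (Y c) (Y d) (Y v) w)
    (F₁ := fun w m => cf (Y (cf (Y c) (m 0) d)) (m 1) (cf (Y v) (m 2) w))
    (S := fun i w => tripleSeries 2 0 1 (Y (v₂ i.1 i.2)) (Y (c₂ i.1 i.2)) (Y (d₁ i.1)) w)
    (S₁ := fun i w m => cf (Y (v₂ i.1 i.2)) (m 2)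
      (cf (Y (cf (Y (c₂ i.1 i.2)) (m 0) (d₁ i.1))) (m 1) w))
    (φ := fun i => φ i.1) (γ := fun i => γ i.1 i.2) (fun w => ?_)
    (exists_common_pole (h.exists_pole_tripleSeries (by decide) (by decide) (by decide) _ _ _)
      fun i => h.exists_pole_tripleSeries (by decide) (by decide) (by decide) _ _ _)
    (fun w t => ?_) (fun i w t => ?_)
    (fun i w => locFin_tripleSeries (by decide) (by decide) (by decide) _ _ _ w)
    (fun w => ?_) (fun i w => ?_) (a := N) (fun w m hm => ?_) (fun i w m hm => ?_) (fun i l => ?_) l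
  · exact key
  · simp only [hδ, swapDiff, map_sub, rename_X, C_neg, C_1, neg_mul, one_mul]
    simp only [Matrix.cons_val_zero, Matrix.cons_val_one, Fin.succ_one_eq_two, Fin.succ_zero_eq_one]
    rw [shiftHom_X_self, shiftHom_X_of_ne _ (by decide)]
    ring
  · have e1 : act (rename Fin.succ swapDiff ^ k) (tripleSeries 0 1 2 (Y c) (Y d) (Y v) w) =
        ∑ i, psAct (φ i) (rename Fin.succ swapDiff)
          (tripleSeries 0 2 1 (Y c) (Y (v₁ i)) (Y (d₁ i)) w) := by
      rw [rename_succ_swapDiff]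
      refine act_eq_sum_of_slice (by decide) h1 (fun t => cf (Y c) (t 0)) (fun _ => w)
        (fun t => ?_) fun i t => ?_ <;>
      exact slice_eq_of_eq fun a b => by simp [tripleSeries, prodSeries, oppSeries]
    have e2 : ∀ i, act (δ ^ k') (tripleSeries 0 2 1 (Y c) (Y (v₁ i)) (Y (d₁ i)) w) =
        ∑ j, psAct (γ i j) δ
          (tripleSeries 2 0 1 (Y (v₂ i j)) (Y (c₂ i j)) (Y (d₁ i)) w) := by
      intro i
      refine act_eq_sum_of_slice (by decide) (h2 i) (fun _ => LinearMap.id)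
        (fun t => cf (Y (d₁ i)) (t 1) w) (fun t => ?_) fun j t => ?_ <;>
      exact slice_eq_of_eq fun a b => by simp [tripleSeries, prodSeries, oppSeries]
    rw [mul_comm, act_mul, e1, map_sum, Fintype.sum_sigma]
    refine Finset.sum_congr rfl fun i _ => ?_
    rw [← psAct_act (locFin_tripleSeries (by decide) (by decide) (by decide) _ _ _ w) h0, e2,
      psAct_sum (fun j _ => (locFin_tripleSeries (by decide) (by decide) (by decide) _ _ _ w).psAct
        hδ0 _) h0]
  · have e1 := h.isOPE_all c d (cf (Y v) (t 2) w)
    convert e1 using 1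
    · exact slice_eq_of_eq fun a b => by simp [tripleSeries, prodSeries]
    · exact slice_eq_of_eq fun a b => by simp [iterateSeries]
  · have e1 := (h.isOPE_all (c₂ i.1 i.2) (d₁ i.1) w).map (cf (Y (v₂ i.1 i.2)) (t 2))
    convert e1 using 1
    · exact slice_eq_of_eq fun a b => by simp [tripleSeries, prodSeries]
    · exact slice_eq_of_eq fun a b => by simp [iterateSeries]
  · refine locFin_of_three (i := 0) (j := 2) (k := 1) (by decide) (by decide) (by decide)
      ⟨N, fun m hm => by simp only [hN _ hm, map_zero, cf_zero, LinearMap.zero_apply]⟩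
      (fun s => ?_) fun s t => ?_
    · obtain ⟨M, hM⟩ := exists_cf_eq_zero (Y v) w
      exact ⟨M, fun m h hm => by simp only [hM _ hm, map_zero]⟩
    · obtain ⟨M, hM⟩ := exists_cf_eq_zero (Y (cf (Y c) s d)) (cf (Y v) t w)
      exact ⟨M, fun m h h' hm => by simp only [h, h', hM _ hm]⟩
  · refine locFin_of_three (i := 0) (j := 1) (k := 2) (by decide) (by decide) (by decide)
      ⟨N, fun m hm => by simp only [hN' i _ hm, map_zero, cf_zero, LinearMap.zero_apply]⟩
      (fun s => ?_) fun s t => ?_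
    · obtain ⟨M, hM⟩ := exists_cf_eq_zero (Y (cf (Y (c₂ i.1 i.2)) s (d₁ i.1))) w
      exact ⟨M, fun m h hm => by simp only [h, hM _ hm, map_zero]⟩
    · obtain ⟨M, hM⟩ := exists_cf_eq_zero (Y (v₂ i.1 i.2))
        (cf (Y (cf (Y (c₂ i.1 i.2)) s (d₁ i.1))) t w)
      exact ⟨M, fun m h h' hm => by simp only [h, h', hM _ hm]⟩
  · simp only [hN _ hm, map_zero, cf_zero, LinearMap.zero_apply]
  · simp only [hN' i _ hm, map_zero, cf_zero, LinearMap.zero_apply]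
  · exact oppSeries_mem_oppSpan (Y := Y) (Set.mem_univ (cf (Y (c₂ i.1 i.2)) l (d₁ i.1)))
      (v₂ i.1 i.2)

/-- If the fields of `U` satisfy exchange relations among themselves, then all fields satisfy
exchange relations. -/
theorem IsGenerated.isExchangeable_all (h : IsGenerated Y one U)
    (hU : ∀ a ∈ U, ∀ b ∈ U, IsExchangeable Y U (prodSeries (Y a) (Y b))) (u v : V) :
    IsExchangeable Y Set.univ (prodSeries (Y u) (Y v)) := by
  -- The second state is generalized first, keeping the exchanged field in U: in the induction step
  -- it has to be moved past a further field. Only then is the first state generalized.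
  have hR : ∀ v, ∀ c ∈ U, IsExchangeable Y U (prodSeries (Y c) (Y v)) := by
    let S : Submodule ℂ V :=
      { carrier := {v | ∀ c ∈ U, IsExchangeable Y U (prodSeries (Y c) (Y v))}
        add_mem' := fun {a b} ha hb c hc => by
          convert (ha c hc).add (hb c hc) using 1
          funext w m
          simp [prodSeries, cf_add]
        zero_mem' := fun c hc => by
          convert isExchangeable_of_mem (oppSpan Y U).zero_mem using 1
          funext w m
          simp [prodSeries, cf_zero]
        smul_mem' := fun s a ha c hc => by
          convert (ha c hc).smul s using 1
          funext w m
          simp [prodSeries, cf_smul] }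
    have hS : S = ⊤ := by
      refine h.span S (fun c hc => ?_) fun a ha m b hb c hc =>
        h.isExchangeable_right (hU c hc a ha) hb m
      convert isExchangeable_of_mem (oppSeries_mem_oppSpan (Y := Y) hc one) using 1
      funext w m
      rw [prodSeries, oppSeries, h.vacuum, cf_idE, cf_idE]
      split_ifs <;> simp
    exact fun v => (hS ▸ Submodule.mem_top : v ∈ S)
  let S : Submodule ℂ V :=
    { carrier := {u | ∀ v, IsExchangeable Y Set.univ (prodSeries (Y u) (Y v))}
      add_mem' := fun {a b} ha hb v => by
        convert (ha v).add (hb v) using 1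
        funext w m
        simp [prodSeries, cf_add]
      zero_mem' := fun v => by
        convert isExchangeable_of_mem (oppSpan Y Set.univ).zero_mem using 1
        funext w m
        simp [prodSeries, cf_zero]
      smul_mem' := fun s a ha v => by
        convert (ha v).smul s using 1
        funext w m
        simp [prodSeries, cf_smul] }
  have hS : S = ⊤ := by
    refine h.span S (fun v => ?_) fun c hc m d hd v =>
      h.isExchangeable_left (hd v) (fun v => hR v c hc) m
    convert isExchangeable_of_mem (oppSeries_mem_oppSpan (Y := Y) (Set.mem_univ one) v) using 1
    funext w m
    rw [prodSeries, oppSeries, h.vacuum, cf_idE, cf_idE]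
    split_ifs <;> simp
  exact (hS ▸ Submodule.mem_top : u ∈ S) v

end TripleProducts

/-! ### Locality as an exchange relation -/

section Locality

variable {V : Type*} [AddCommGroup V] [Module ℂ V] {Y : V →ₗ[ℂ] E V} {T : Set V}

lemma laurentSeries_bddBelow (f : LaurentSeries ℂ) : ∃ K : ℕ, ∀ q : ℤ, q < -K → f.coeff q = 0 := by
  refine ⟨(-f.order).toNat, fun q hq => ?_⟩
  by_contra h
  have := HahnSeries.order_le_of_coeff_ne_zero h
  omega

lemma exchangeCoeff_eq_laurentAct (f : LaurentSeries ℂ) (a b : E V) (w : V) :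
    (fun e : Fin 2 → ℤ => exchangeCoeff f b a w (e 0) (e 1)) =
      laurentAct f.coeff (oppSeries a b w) := by
  obtain ⟨K, hK⟩ := laurentSeries_bddBelow f
  funext e
  rw [laurentAct_eq_finsum (isIterated_oppSeries a b w) hK]
  rfl

/-- A Laurent series has a pole of finite order, which a power of x_1 - x_0 removes. -/
lemma isExchangeable_laurentAct (f : LaurentSeries ℂ) {u : V} (hu : u ∈ T) (v : V) :
    IsExchangeable Y T fun w => laurentAct f.coeff (oppSeries (Y u) (Y v) w) := by
  obtain ⟨K, hK⟩ := laurentSeries_bddBelow f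
  refine ⟨K, ?_⟩
  convert psAct_mem_oppSpan (oppSeries_mem_oppSpan (Y := Y) hu v)
    (PowerSeries.mk fun n => f.coeff (n - K)) using 1
  funext w
  rw [← laurentAct_shift_pow (isIterated_oppSeries _ _ _) hK,
    laurentAct_powerSeries (isIterated_oppSeries _ _ _) fun q hq => hK _ (by omega)]

lemma swapDiff_pow (k : ℕ) : swapDiff ^ k = (-1) ^ k * (X 0 - X 1) ^ k := by
  rw [← mul_pow, swapDiff]
  ring

/-- Locality supplies (x_1 - x_2)^k times a sum with Laurent coefficients. Up to sign this is the
power used for exchange relations, and each summand is exchangeable. -/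
lemma isExchangeable_of_sLocal {S : Set (E V)} (hS : SLocal S) {U : Set V}
    (hU : ∀ a ∈ S, ∃ u ∈ U, Y u = a) {u v : V} (hu : Y u ∈ S) (hv : Y v ∈ S) :
    IsExchangeable Y U (prodSeries (Y u) (Y v)) := by
  obtain ⟨r, f, b, a, k, hb, ha, h⟩ := hS _ hu _ hv
  choose u' hu' hYu' using fun i => hU _ (ha i)
  choose v' hv' hYv' using fun i => hU _ (hb i)
  refine IsExchangeable.of_act (n := k) ?_
  convert (IsExchangeable.sum (s := Finset.univ) fun i _ =>
    isExchangeable_laurentAct (Y := Y) (f i) (hu' i) (v' i)).act k using 1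
  funext w
  have h1 := h w
  rw [polyMul_eq_act, polyMul_eq_act, fieldProd_pair] at h1
  rw [swapDiff_pow, act_mul, act_mul]
  congr 1
  refine h1.trans ?_
  congr 1
  rw [Finset.sum_apply]
  funext e
  rw [Finset.sum_apply]
  refine Finset.sum_congr rfl fun i _ => ?_
  rw [hYu', hYv', ← exchangeCoeff_eq_laurentAct]

end Locality

/-! ### The Jacobi identity -/

section Jacobi

variable {V : Type*} [AddCommGroup V] [Module ℂ V]

lemma act_X_sub_X (F : (Fin 2 → ℤ) → V) (m : Fin 2 → ℤ) :
    act (X 0 - X 1) F m = F ![m 0 - 1, m 1] - F ![m 0, m 1 - 1] := by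
  rw [act_sub, Pi.sub_apply, act_X, act_X]
  congr 2 <;> funext i <;> fin_cases i <;> simp

/-- The lowest power of x_0 in F has to vanish, and so on upwards. The bound is essential, as x_0 -
x_1 annihilates delta functions. -/
lemma eq_zero_of_act_X_sub_X {F : (Fin 2 → ℤ) → V} (h : act (X 0 - X 1) F = 0) {M : ℤ}
    (hM : ∀ m, m 0 < M → F m = 0) : F = 0 := by
  have h1 : ∀ (k : ℕ) (m : Fin 2 → ℤ), m 0 < M + k → F m = 0 := by
    intro k
    induction k with
    | zero => simpa using hM
    | succ k ih =>
      intro m hm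
      have h2 := congrFun h ![m 0, m 1 + 1]
      rw [act_X_sub_X] at h2
      simp only [Matrix.cons_val_zero, Matrix.cons_val_one, add_sub_cancel_right, Pi.zero_apply]
        at h2
      rw [vec_eta m, ← sub_eq_zero.mp h2]
      exact ih _ (by simp; push_cast at hm; omega)
  exact funext fun m => h1 (m 0 - M + 1).toNat m (by omega)

lemma neg_one_pow_mul_choose (p : ℤ) (k : ℕ) :
    (-1) ^ k * Ring.choose (-p - 1) k = Ring.choose (p + k) k := by
  rw [show -p - 1 = -(p + 1) by ring, Ring.choose_neg, show p + 1 + k - 1 = p + k by ring]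
  rw [Units.smul_def, smul_eq_mul, ← mul_assoc]
  convert one_mul _
  rw [Int.negOnePow_def]
  rw [zpow_natCast, Units.val_pow_eq_pow_val, ← mul_pow]
  simp

lemma finsum_eq_sum_range {g : ℕ → V} {c : ℕ → ℤ} {K : ℕ} (h : ∀ k, K ≤ k → c k = 0 ∨ g k = 0) :
    ∑ᶠ k, c k • g k = ∑ k ∈ Finset.range K, c k • g k := by
  refine finsum_eq_sum_of_support_subset _ fun k hk => ?_
  simp only [Finset.coe_range, Set.mem_Iio]
  by_contra h1
  rcases h k (by omega) with h2 | h2 <;> exact hk (by simp only [h2, zero_smul, smul_zero])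

/-- The three terms of the Jacobi identity, as families of series indexed by the exponent
of `x_0`. -/
def firstSeries (a b : E V) (w : V) (p : ℤ) : (Fin 2 → ℤ) → V :=
  fun m => jacobiFirst a b w p (m 0) (m 1)

/-- See `firstSeries`. -/
def secondSeries (f : LaurentSeries ℂ) (b a : E V) (w : V) (p : ℤ) : (Fin 2 → ℤ) → V :=
  fun m => jacobiSecond f b a w p (m 0) (m 1)

/-- See `firstSeries`. -/
def thirdSeries (Y : V →ₗ[ℂ] E V) (u v w : V) (p : ℤ) : (Fin 2 → ℤ) → V :=
  fun m => jacobiThird Y u v w p (m 0) (m 1)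

/-- Multiplying the delta function by x_0 is the same as multiplying it by x_1 - x_2. The second and
third terms obey the same recursion, hence so does their difference from the first. -/
lemma firstSeries_pred (a b : E V) (w : V) (p : ℤ) :
    firstSeries a b w (p - 1) = act (X 0 - X 1) (firstSeries a b w p) := by
  obtain ⟨N, hN⟩ := exists_cf_eq_zero b w
  funext m
  rw [act_X_sub_X]
  simp only [firstSeries, jacobiFirst, Matrix.cons_val_zero, Matrix.cons_val_one]
  rw [show -(p - 1) - 1 = -p - 1 + 1 by ring, finsum_choose_succ _
    (finite_support_of_lt (m := m 1) (N := N) fun k hk => by rw [hN _ hk, map_zero])]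
  congr 1
  · refine finsum_congr fun k => ?_
    rw [show m 0 - 1 + p + 1 + (k : ℤ) = m 0 + (p - 1) + 1 + k by ring]
  · refine finsum_congr fun k => ?_
    rw [show m 0 + (p - 1) + 1 + ((k + 1 : ℕ) : ℤ) = m 0 + p + 1 + k by push_cast; ring,
      show m 1 - ((k + 1 : ℕ) : ℤ) = m 1 - 1 - k by push_cast; ring]

lemma firstSeries_neg_one (a b : E V) (w : V) : firstSeries a b w (-1) = prodSeries a b w := by
  funext m
  simp only [firstSeries, jacobiFirst]
  rw [finsum_eq_single _ 0]
  · simp [prodSeries]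
  · intro k hk
    rw [show (-(-1) - 1 : ℤ) = 0 by ring, Ring.choose_zero_pos _ (Nat.pos_of_ne_zero hk), mul_zero,
      zero_smul]

lemma firstSeries_of_neg (a b : E V) (w : V) (q : ℕ) :
    firstSeries a b w (-1 - q) = act ((X 0 - X 1) ^ q) (prodSeries a b w) := by
  induction q with
  | zero => simp [firstSeries_neg_one]
  | succ q ih =>
    rw [pow_succ', act_mul, ← ih, ← firstSeries_pred]
    congr 1
    push_cast
    ring

lemma jacobiThird_eq (Y : V →ₗ[ℂ] E V) (u v w : V) (p m n : ℤ) :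
    jacobiThird Y u v w p m n = ∑ᶠ k : ℕ, ((-1) ^ k * Ring.choose (-m - 1) k : ℤ) •
      ((-1 : ℤ) ^ k • iterateSeries Y u v w ![p - k, n + m + k + 1]) := by
  refine finsum_congr fun k => ?_
  rw [neg_one_pow_mul_choose, smul_smul, mul_comm]
  rfl

lemma thirdSeries_pred (Y : V →ₗ[ℂ] E V) (u v w : V) (p : ℤ) :
    thirdSeries Y u v w (p - 1) = act (X 0 - X 1) (thirdSeries Y u v w p) := by
  obtain ⟨N, hN⟩ := (isIterated_iterateSeries Y u v w).1
  funext m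
  rw [act_X_sub_X]
  simp only [thirdSeries, jacobiThird_eq, Matrix.cons_val_zero, Matrix.cons_val_one]
  rw [show -(m 0 - 1) - 1 = -m 0 - 1 + 1 by ring, finsum_choose_succ _
    (finite_support_of_lt (m := p) (N := N) fun k hk => by rw [hN _ (by simpa using hk), smul_zero]),
    show m 1 - 1 + m 0 = m 1 + (m 0 - 1) by ring, sub_sub_cancel_left, ← finsum_neg_distrib]
  refine finsum_congr fun k => ?_
  rw [pow_succ, mul_neg_one, neg_smul, smul_neg, neg_neg,
    show p - ((k + 1 : ℕ) : ℤ) = p - 1 - k by push_cast; ring,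
    show m 1 + (m 0 - 1) + ((k + 1 : ℕ) : ℤ) + 1 = m 1 + m 0 + k + 1 by push_cast; ring]

lemma thirdSeries_eq_zero {Y : V →ₗ[ℂ] E V} {u v w : V} {N : ℤ}
    (hN : ∀ m : Fin 2 → ℤ, m 0 < N → iterateSeries Y u v w m = 0) {p : ℤ} (hp : p < N) :
    thirdSeries Y u v w p = 0 := by
  funext m
  rw [thirdSeries, jacobiThird_eq]
  refine finsum_eq_zero_of_forall_eq_zero fun k => ?_
  rw [hN _ (by simp; omega), smul_zero, smul_zero]

lemma secondSeries_eq (f : LaurentSeries ℂ) (b a : E V) (w : V) (p : ℤ) :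
    secondSeries f b a w p =
      ((-1 : ℂ) ^ (p + 1)) • laurentAct (fun q => f.coeff (q + p + 1)) (oppSeries a b w) := by
  obtain ⟨K, hK⟩ := laurentSeries_bddBelow f
  funext m
  rw [Pi.smul_apply, laurentAct_eq_finsum (isIterated_oppSeries a b w) (K := -K - p - 1)
    fun q hq => hK _ (by omega), smul_finsum]
  simp only [secondSeries, jacobiSecond]
  rw [← finsum_comp_equiv ((Equiv.addRight (p + 1)).prodCongr (Equiv.refl ℕ))]
  refine finsum_congr fun q => ?_
  simp only [Equiv.prodCongr_apply, Prod.map_fst, Prod.map_snd, Equiv.coe_addRight,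
    Equiv.refl_apply]
  rw [show q.1 + (p + 1) - p - 1 = q.1 by ring, smul_smul]
  congr 1
  rw [show q.1 + p + 1 = q.1 + (p + 1) by ring, zpow_add₀ (by norm_num : (-1 : ℂ) ≠ 0)]
  have : (-1 : ℂ) ^ q.1 * (-1) ^ q.1 = 1 := by rw [← mul_zpow]; simp
  linear_combination ((-1 : ℂ) ^ (p + 1) * f.coeff (q.1 + (p + 1)) *
    ((-1) ^ q.2 * (Ring.choose q.1 q.2 : ℤ))) * this

lemma secondSeries_pred (f : LaurentSeries ℂ) (b a : E V) (w : V) (p : ℤ) :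
    secondSeries f b a w (p - 1) = act (X 0 - X 1) (secondSeries f b a w p) := by
  obtain ⟨K, hK⟩ := laurentSeries_bddBelow f
  rw [secondSeries_eq, secondSeries_eq, map_smul,
    show (fun q => f.coeff (q + (p - 1) + 1)) = fun q => (fun q => f.coeff (q + p + 1)) (q - 1) by
      funext q
      congr 1
      ring, laurentAct_shift (g := fun q => f.coeff (q + p + 1)) (isIterated_oppSeries a b w)
    (K := -K - p - 1) fun q hq => hK _ (by omega), show (X 0 - X 1 : MvPolynomial (Fin 2) ℂ) = -swapDiff by
      rw [swapDiff]; ring, map_neg, LinearMap.neg_apply, smul_neg, ← neg_smul]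
  congr 1
  rw [show p - 1 + 1 = p by ring, zpow_add_one₀ (by norm_num)]
  ring

lemma secondSeries_of_neg (f : LaurentSeries ℂ) (b a : E V) (w : V) (q : ℕ) :
    secondSeries f b a w (-1 - q) =
      act ((X 0 - X 1) ^ q) (laurentAct f.coeff (oppSeries a b w)) := by
  induction q with
  | zero => simp [secondSeries_eq]
  | succ q ih =>
    rw [pow_succ', act_mul, ← ih, ← secondSeries_pred]
    congr 1
    push_cast
    ring

lemma exists_secondSeries_eq_zero (f : LaurentSeries ℂ) (b a : E V) (w : V) :
    ∃ M : ℤ, ∀ p m, m 0 < M → secondSeries f b a w p m = 0 := by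
  obtain ⟨M, hM⟩ := (isIterated_oppSeries a b w).1
  refine ⟨M, fun p m hm => ?_⟩
  rw [secondSeries_eq, Pi.smul_apply]
  refine smul_eq_zero_of_right _ (finsum_eq_zero_of_forall_eq_zero fun q => ?_)
  refine smul_eq_zero_of_right _ (finsum_eq_zero_of_forall_eq_zero fun k => ?_)
  rw [hM _ (by simp; omega), smul_zero]

/-- The coefficient of x_1^(-l-1) is the residue in x_1 after multiplication by x_1^l, and the delta
function then substitutes x_1 = x_0 + x_2. With the analogous formula for the third term, weak
associativity equates these coefficients for large l. -/
lemma firstSeries_eq_act_shiftedProd (a b : E V) (w : V) (p n : ℤ) (l : ℕ) :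
    firstSeries a b w p ![-l - 1, n] = act ((X 0 + X 1) ^ l) (shiftedProd a b w) ![p, n] := by
  obtain ⟨M, hM⟩ := exists_cf_eq_zero b w
  have hB : ∀ m : Fin 2 → ℤ, m 1 < M → prodSeries a b w m = 0 := fun m hm => by
    rw [prodSeries, hM _ hm, map_zero]
  have h1 := translate_act (i := (0 : Fin 2)) (j := 1) (by decide) (X 0 ^ l) hB
  rw [map_pow (shiftHom 0 1), shiftHom_X_self, ← shiftedProd_eq_translate hM] at h1
  rw [← h1, translate_def]
  simp only [firstSeries, jacobiFirst, Matrix.cons_val_zero, Matrix.cons_val_one,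
    neg_one_pow_mul_choose]
  rw [finsum_eq_sum_range (K := (n - M).toNat + 1) fun k hk => Or.inr (by
    rw [hM _ (by omega), map_zero])]
  refine Finset.sum_congr rfl fun k _ => ?_
  rw [act_X_pow, prodSeries]
  simp only [Function.update_self, Function.update_of_ne IsOPE.zero_ne_one,
    Function.update_of_ne IsOPE.zero_ne_one.symm]
  rw [show -(l : ℤ) - 1 + p + 1 + k = p + k - l by ring]

lemma thirdSeries_eq_act_iterateSeries (Y : V →ₗ[ℂ] E V) (u v w : V) (p n : ℤ) (l : ℕ) :
    thirdSeries Y u v w p ![-l - 1, n] =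
      act ((X 0 + X 1) ^ l) (iterateSeries Y u v w) ![p, n] := by
  simp only [thirdSeries, jacobiThird_eq, Matrix.cons_val_zero, Matrix.cons_val_one]
  rw [add_pow, map_sum, LinearMap.sum_apply, Finset.sum_apply,
    show -(-(l : ℤ) - 1) - 1 = l by ring,
    finsum_eq_sum_range (K := l + 1) fun k hk => Or.inl (by
      rw [Ring.choose_natCast, Nat.choose_eq_zero_of_lt (by omega), Nat.cast_zero, mul_zero])]
  refine Finset.sum_congr rfl fun k hk => ?_
  have hk' : k ≤ l := by simpa [Nat.lt_succ_iff] using hk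
  rw [← map_natCast C, mul_comm _ (C _), act_mul, act_C, act_mul, Pi.smul_apply, act_X_pow,
    act_X_pow, Ring.choose_natCast, smul_smul, mul_right_comm, ← mul_pow]
  simp only [mul_neg, mul_one, neg_neg, one_pow, one_mul]
  rw [natCast_zsmul, ← Nat.cast_smul_eq_nsmul ℂ]
  congr 2
  funext i
  fin_cases i
  · simp
  · simp
    omega

variable {Y : V →ₗ[ℂ] E V} {one : V} {U : Set V}

/-- The Laurent series `x ^ (-k) φ(x)`. -/
def laurentShift (k : ℕ) (φ : PowerSeries ℂ) : LaurentSeries ℂ :=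
  HahnSeries.ofSuppBddBelow (fun q : ℤ => if -k ≤ q then PowerSeries.coeff (q + k).toNat φ else 0)
    ⟨-k, fun q hq => by
      by_contra h
      exact hq (if_neg h)⟩

lemma coeff_laurentShift (k : ℕ) (φ : PowerSeries ℂ) (q : ℤ) : (laurentShift k φ).coeff q =
    if -k ≤ q then PowerSeries.coeff (q + k).toNat φ else 0 := rfl

lemma act_laurentAct_laurentShift (k : ℕ) (φ : PowerSeries ℂ) {O : (Fin 2 → ℤ) → V}
    (hO : IsIterated 0 1 O) :
    act (swapDiff ^ k) (laurentAct (laurentShift k φ).coeff O) = psAct φ swapDiff O := by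
  rw [← laurentAct_shift_pow hO (g := (laurentShift k φ).coeff) (K := -k) fun q hq =>
    if_neg (by omega), laurentAct_powerSeries (g := fun q => (laurentShift k φ).coeff (q - k)) hO fun q hq =>
      if_neg (by omega)]
  congr 1
  ext n
  rw [PowerSeries.coeff_mk, coeff_laurentShift, if_pos (by omega)]
  simp

/-- The exchange relation settles very negative powers of x_0, and the recursion in that power
carries the vanishing upwards, weak associativity making x_1 - x_2 cancellable. -/
theorem IsGenerated.isWeakQuantumVertexAlgebra (h : IsGenerated Y one U)
    (hU : ∀ a ∈ U, ∀ b ∈ U, IsExchangeable Y U (prodSeries (Y a) (Y b))) :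
    IsWeakQuantumVertexAlgebra Y one where
  vacuum := h.vacuum
  creation := h.creation
  jacobi u v := by
    obtain ⟨k, r, φ, u', v', -, hrel⟩ := (h.isExchangeable_all hU u v).exists_sum
    -- The factor (x_2 - x_1)^k of the exchange relation is divided out, so the coefficients are
    -- f_i(x) = x^(-k) φ_i(x).
    refine ⟨r, v', u', fun i => laurentShift k (φ i), fun w => ?_⟩
    set J : ℤ → (Fin 2 → ℤ) → V := fun p => firstSeries (Y u) (Y v) w p -
      ∑ i, secondSeries (laurentShift k (φ i)) (Y (v' i)) (Y (u' i)) w p -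
        thirdSeries Y u v w p with hJ
    suffices hJ0 : ∀ p, J p = 0 by
      intro p m n
      have := congrFun (hJ0 p) ![m, n]
      simp only [hJ, Pi.sub_apply, Finset.sum_apply, Pi.zero_apply] at this
      exact sub_eq_zero.mp this
    have hpred : ∀ p, J (p - 1) = act (X 0 - X 1) (J p) := fun p => by
      simp only [hJ, map_sub, map_sum, firstSeries_pred, secondSeries_pred, thirdSeries_pred]
    obtain ⟨N, hN⟩ := (isIterated_iterateSeries Y u v w).1
    -- At x_0^(-1-q) the first two terms are (x_1 - x_2)^q times the product and the exchanged sum,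
    -- equal once q ≥ k. The third term vanishes below the lowest power of x_0 in the iterate.
    have hbase : ∀ q : ℕ, k ≤ q → -1 - (q : ℤ) < N → J (-1 - q) = 0 := by
      intro q hq hqN
      simp only [hJ]
      rw [thirdSeries_eq_zero hN hqN, firstSeries_of_neg, sub_zero, sub_eq_zero]
      simp only [secondSeries_of_neg]
      rw [← map_sum]
      have h1 : act (swapDiff ^ k) (prodSeries (Y u) (Y v) w) = act (swapDiff ^ k)
          (∑ i, laurentAct (laurentShift k (φ i)).coeff (oppSeries (Y (u' i)) (Y (v' i)) w)) := by
        rw [hrel, map_sum]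
        exact Finset.sum_congr rfl fun i _ =>
          (act_laurentAct_laurentShift k (φ i) (isIterated_oppSeries _ _ _)).symm
      rw [show (X 0 - X 1 : MvPolynomial (Fin 2) ℂ) ^ q = (-1) ^ q * swapDiff ^ (q - k) * swapDiff ^ k by
        rw [mul_assoc, ← pow_add, Nat.sub_add_cancel hq, swapDiff_pow, ← mul_assoc, ← mul_pow]
        simp, act_mul, act_mul, h1, ← act_mul, ← act_mul]
    -- The bound has to hold for each p. The second terms are bounded by Y(u', x_1)w, while the
    -- first and third cancel at x_1^(-a-1) for a ≥ l.
    have hlow : ∃ M : ℤ, ∀ p m, m 0 < M → J p m = 0 := by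
      obtain ⟨l, hl⟩ := h.weak_assoc u v w
      choose M hM using fun i =>
        exists_secondSeries_eq_zero (laurentShift k (φ i)) (Y (v' i)) (Y (u' i)) w
      obtain ⟨M', hM'⟩ := (Set.finite_range M).bddBelow
      refine ⟨min M' (-l), fun p m hm => ?_⟩
      obtain ⟨a, ha⟩ := Int.eq_ofNat_of_zero_le (show 0 ≤ -m 0 - 1 by omega)
      simp only [hJ, Pi.sub_apply, Finset.sum_apply]
      rw [Finset.sum_eq_zero fun i _ => hM i p m (lt_of_lt_of_le hm
        ((min_le_left _ _).trans (hM' ⟨i, rfl⟩))), vec_eta m, show m 0 = -a - 1 by omega,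
        firstSeries_eq_act_shiftedProd, thirdSeries_eq_act_iterateSeries, hl a (by omega), sub_zero,
        sub_self]
    obtain ⟨M, hM⟩ := hlow
    have hind : ∀ n : ℕ, ∀ p : ℤ, p + k + 1 - min N 0 < n → J p = 0 := by
      intro n
      induction n with
      | zero =>
        intro p hp
        obtain ⟨q, hq⟩ := Int.eq_ofNat_of_zero_le (show 0 ≤ -1 - p by push_cast at hp; omega)
        rw [show p = -1 - q by omega]
        exact hbase q (by push_cast at hp; omega) (by push_cast at hp; omega)
      | succ n ih =>
        intro p hp
        refine eq_zero_of_act_X_sub_X ?_ (hM p)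
        rw [← hpred]
        exact ih _ (by push_cast at hp; omega)
    exact fun p => hind (p + k + 1 - min N 0 + 1).toNat p (by omega)

end Jacobi

end

end FormalVA

/-! ### The theorem -/

open FormalVA in
theorem theorem6p3 {V : Type*} [AddCommGroup V] [Module ℂ V]
    (one : V) (L : Module.End ℂ V) (U : Set V) (Y₀ : U → E V)
    (hL_one : L one = 0)
    (hL_bracket : ∀ (u : U) (m : ℤ),
      ⁅L, cf (Y₀ u) m⁆ = ((m + 1 : ℤ) : ℂ) • cf (Y₀ u) (m + 1))
    (hcreate : ∀ u : U, Creates (Y₀ u) one u)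
    (hqc : QuasiCompatible (Set.range Y₀))
    (hspan : Submodule.span ℂ {v : V | ∃ l : List (U × ℤ),
      v = (l.map fun q => mode (Y₀ q.1) q.2).prod one} = ⊤)
    (hψ : ∃ ψ : V →ₗ[ℂ] generated (Set.range Y₀),
      (ψ one : E V) = idE V ∧
      ∀ (u : U) (n : ℤ) (v : V),
        (ψ (mode (Y₀ u) n v) : E V) = nthProduct (Y₀ u) (ψ v) n) :
    (∃! Y : V →ₗ[ℂ] E V, (∀ u : U, Y u = Y₀ u) ∧ IsNonlocalVertexAlgebra Y one) ∧
    (SLocal (Set.range Y₀) →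
      ∀ Y : V →ₗ[ℂ] E V, (∀ u : U, Y u = Y₀ u) → IsNonlocalVertexAlgebra Y one →
        IsWeakQuantumVertexAlgebra Y one) := by
  obtain ⟨ψ, hψ_one, hψ⟩ := hψ
  obtain ⟨hU, h⟩ := isGenerated_of_map hL_one hL_bracket hcreate hqc hspan
    (ψ := (generated (Set.range Y₀)).subtype ∘ₗ ψ) hψ_one hψ
  have huniq : ∀ Y : V →ₗ[ℂ] E V, (∀ u : U, Y u = Y₀ u) → IsNonlocalVertexAlgebra Y one →
      Y = (generated (Set.range Y₀)).subtype ∘ₗ ψ := fun Y hY hna =>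
    h.eq_of_isNonlocalVertexAlgebra hna fun u hu => (hY ⟨u, hu⟩).trans (hU ⟨u, hu⟩).symm
  refine ⟨⟨_, ⟨hU, h.isNonlocalVertexAlgebra⟩, fun Y hY => huniq Y hY.1 hY.2⟩,
    fun hloc Y hY hna => ?_⟩
  rw [huniq Y hY hna]
  -- Every field in the range of Y₀ is Y(u, x) for some u ∈ U, so locality becomes exchange
  -- relations whose exchanged fields stay in U.
  refine h.isWeakQuantumVertexAlgebra fun a ha b hb => isExchangeable_of_sLocal hloc ?_
    ⟨⟨a, ha⟩, (hU ⟨a, ha⟩).symm⟩ ⟨⟨b, hb⟩, (hU ⟨b, hb⟩).symm⟩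
  rintro _ ⟨u, rfl⟩
  exact ⟨u, u.2, hU u⟩
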